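/- Let $0<H<1$, $\sigma>0$, let $0\le q<p$ be integers, and let $\alpha_0,\dots,\alpha_p,\beta_1,\dots,\beta_q$ be real numbers with $\alpha_1\ne0$ and (if $q\ge1$) $\beta_q\neq0$. Put $\beta_0=1$ and $\beta_j=0$ for $j>q$; let $$\alpha(z)=z^p-\alpha_pz^{p-1}-\dots-\alpha_1,\qquad \beta(z)=1+\beta_1z+\dots+\beta_qz^q,$$ $\delta_p=(0,\dots,0,1)'\in\mathbb R^p$, $\beta=(1,\beta_1,\dots,\beta_{p-1})'\in\mathbb R^p$, and let $A$ be the $p\times p$ companion matrix with ones on the first superdiagonal, last row $(\alpha_1,\dots,\alpha_p)$ and zeros elsewhere. Assume that all eigenvalues of $A$ have negative real parts. Let $\{B^H_t,t\ge0\}$ be a standard fractional Brownian motion with Hurst parameter $H$: a centred Gaussian process with continuous paths, $B^H_0=0$ and $E(B^H_tB^H_s)=\frac12\{t^{2H}+s^{2H}-|t-s|^{2H}\}$. Let $\{Y_t,t\ge0\}$ be a stationary CARFIMA$(p,H,q)$ process, that is, $Y_t=\beta'X_t$, where $X$ is a continuous $\mathbb R^p$-valued process, with an arbitrary random initial value $X_0$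 (possibly dependent on $B^H$), that solves $$X_t=X_0+\int_0^t(AX_s+\alpha_0\delta_p)\,ds+\sigma\delta_pB^H_t,\qquad t\ge0,$$ and $Y$ is stationary: $Y_t$ has finite variance, and $E(Y_t)$ and $\operatorname{cov}(Y_{t+h},Y_t)$ do not depend on $t\geq 0$. Write $\gamma_Y(h)=\operatorname{cov}(Y_{t+h},Y_t)$ for $h\ge0$. (a) For all $h\ge0$ the following integrals converge absolutely and $$\gamma_Y(h)=H\beta'Ae^{Ah}\Big(\int_0^he^{-Au}u^{2H-1}du\Big)V^*\beta-H\beta'Ae^{-Ah}\Big(\int_h^\infty e^{Au}u^{2H-1}du\Big)V^*\beta-H\beta'Ae^{Ah}\Big(\int_0^\infty e^{Au}u^{2H-1}du\Big)V^*\beta,$$ where $V^*=\sigma^2\int_0^\infty e^{Au}\delta_p\delta_p'e^{A'u}du$. (b) If the eigenvalues $\lambda_1,\dots,\lambda_p$ of $A$ are distinct, then for all $h\ge0$ $$\gamma_Y(h)=\frac{\sigma^2}2\Gamma(2H+1)\sum_{i=1}^p\frac{\beta(\lambda_i)\beta(-\lambda_i)}{\alpha^{(1)}(\lambda_i)\alpha(-\lambda_i)}u(H,\lambda_i,h),$$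 where $\alpha^{(1)}$ is the derivative of $\alpha$, $$u(H,\lambda,h)=2(-\lambda)^{1-2H}\cosh(\lambda h)+\lambda^{1-2H}e^{\lambda h}P(2H,\lambda h)-(-\lambda)^{1-2H}e^{-\lambda h}P(2H,-\lambda h),$$ and $P(a,z)=\Gamma(a)^{-1}\int_0^ze^{-w}w^{a-1}dw$, the integral being taken along the segment from $0$ to $z$ in the complex plane; complex powers are principal. (c) If $H\ne1/2$, then $$\gamma_Y(h)\sim\sigma^2H(2H-1)\frac{\beta(0)^2}{\alpha(0)^2}h^{2H-2}\qquad(h\to\infty),$$ that is, the ratio of the two sides tends to $1$. Moreover, if $H<1/2$, then $Y$ is antipersistent: $\gamma_Y(h)<0$ for all large $h$, $\gamma_Y$ is integrable on $(0,\infty)$ and $\int_0^\infty\gamma_Y(h)\,dh=0$ (equivalently, $\int_{-\infty}^\infty\gamma_Y(h)\,dh=0$ for the even extension). If $H>1/2$, then $Y$ has long memory: $\gamma_Y(h)>0$ for all large $h$ and $\int_0^T\gamma_Y(h)\,dh\to\infty$ as $T\to\infty$. -/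

import Mathlib

open MeasureTheory ProbabilityTheory Filter Topology

noncomputable section

namespace Carfima

/-! ### Fractional Brownian motion, stationarity

Processes on `[0, ∞)` are written as functions of a real time; only times `t ≥ 0` matter. -/

/-- `B` is a standard fractional Brownian motion on `[0, ∞)` with Hurst parameter `H`:
a centred Gaussian process with `B_0 = 0`, covariance
`(|t|^{2H} + |s|^{2H} - |t-s|^{2H}) / 2` and (almost surely) continuous paths. -/
structure IsFractionalBrownianMotion {Ω : Type*} [MeasurableSpace Ω] (H : ℝ)
    (B : ℝ → Ω → ℝ) (P : Measure Ω) : Prop where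
  gaussian : IsGaussianProcess (fun t : Set.Ici (0 : ℝ) => B t) P
  start : ∀ᵐ ω ∂P, B 0 ω = 0
  mean : ∀ t, 0 ≤ t → ∫ ω, B t ω ∂P = 0
  kernel : ∀ s t, 0 ≤ s → 0 ≤ t → ∫ ω, B t ω * B s ω ∂P =
    (1 / 2) * (|t| ^ (2 * H) + |s| ^ (2 * H) - |t - s| ^ (2 * H))
  paths : ∀ᵐ ω ∂P, ContinuousOn (fun t => B t ω) (Set.Ici 0)

/-- The covariance `cov(Y_{t+h}, Y_t)`. -/
def autocov {Ω : Type*} [MeasurableSpace Ω] (P : Measure Ω) (Y : ℝ → Ω → ℝ) (t h : ℝ) : ℝ :=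
  covariance (Y (t + h)) (Y t) P

/-- Stationarity of a finite-variance process on `[0, ∞)`: the mean does not depend on time, and
`cov(Y_{t+h}, Y_t)` depends only on `h`. A strictly stationary process with finite variance
has this property. -/
structure IsStationary {Ω : Type*} [MeasurableSpace Ω] (Y : ℝ → Ω → ℝ) (P : Measure Ω) :
    Prop where
  memLp : ∀ t, 0 ≤ t → MemLp (Y t) 2 P
  mean : ∀ t, 0 ≤ t → ∫ ω, Y t ω ∂P = ∫ ω, Y 0 ω ∂P
  cov : ∀ t h, 0 ≤ t → 0 ≤ h → autocov P Y t h = autocov P Y 0 h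

/-! ### The model

The coefficients are `α 0, …, α p` and `β 1, …, β q`; other values of `α`, `β` are never used. -/

/-- The coefficients of the moving average part: `1, β_1, …, β_q, 0, 0, …`. -/
def maCoeff (q : ℕ) (β : ℕ → ℝ) (j : ℕ) : ℝ :=
  if j = 0 then 1 else if j ≤ q then β j else 0

/-- The companion matrix `A`, with last row `α_1, …, α_p` and ones above the diagonal. -/
def companion (p : ℕ) (α : ℕ → ℝ) : Matrix (Fin p) (Fin p) ℝ :=
  Matrix.of fun i j =>
    if (i : ℕ) + 1 = p then α ((j : ℕ) + 1) else if (j : ℕ) = (i : ℕ) + 1 then 1 else 0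

/-- `A` as a complex matrix. -/
def companionC (p : ℕ) (α : ℕ → ℝ) : Matrix (Fin p) (Fin p) ℂ :=
  (companion p α).map Complex.ofReal

/-- The vector `δ_p = (0, …, 0, 1)'`. -/
def delta (p : ℕ) : Fin p → ℝ := fun i => if (i : ℕ) + 1 = p then 1 else 0

/-- The vector `β = (1, β_1, …, β_{p-1})'`, where `β_j = 0` for `j > q`. -/
def maVec (p q : ℕ) (β : ℕ → ℝ) : Fin p → ℝ := fun j => maCoeff q β j

/-- `α(z) = z^p - α_p z^{p-1} - ⋯ - α_1`. -/
def arPoly (p : ℕ) (α : ℕ → ℝ) : Polynomial ℝ :=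
  Polynomial.X ^ p - ∑ j ∈ Finset.range p, Polynomial.C (α (j + 1)) * Polynomial.X ^ j

/-- `β(z) = 1 + β_1 z + ⋯ + β_q z^q`. -/
def maPoly (q : ℕ) (β : ℕ → ℝ) : Polynomial ℝ :=
  ∑ j ∈ Finset.range (q + 1), Polynomial.C (maCoeff q β j) * Polynomial.X ^ j

/-- `X` solves the state equation `dX_t = (A X_t + α_0 δ_p) dt + σ δ_p dB_t` on `[0, ∞)`, in the
integrated form, with an arbitrary random initial value `X_0`. -/
structure IsStateSolution {Ω : Type*} [MeasurableSpace Ω] (p : ℕ) (α : ℕ → ℝ) (σ : ℝ)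
    (B : ℝ → Ω → ℝ) (P : Measure Ω) (X : ℝ → Ω → Fin p → ℝ) : Prop where
  aemeasurable : ∀ t, 0 ≤ t → AEMeasurable (X t) P
  paths : ∀ᵐ ω ∂P, ContinuousOn (fun t => X t ω) (Set.Ici 0)
  equation : ∀ᵐ ω ∂P, ∀ t, 0 ≤ t → ∀ i,
    X t ω i = X 0 ω i
      + (∫ s in (0 : ℝ)..t, ((companion p α).mulVec (X s ω) i + α 0 * delta p i))
      + σ * delta p i * (B t ω - B 0 ω)

/-- `Y` is a CARFIMA`(p, H, q)` process driven by `B`: `Y_t = β' X_t` for a solution `X` of the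
state equation. -/
def IsCarfima {Ω : Type*} [MeasurableSpace Ω] (p q : ℕ) (α β : ℕ → ℝ) (σ : ℝ)
    (B : ℝ → Ω → ℝ) (P : Measure Ω) (Y : ℝ → Ω → ℝ) : Prop :=
  ∃ X : ℝ → Ω → Fin p → ℝ, IsStateSolution p α σ B P X ∧
    ∀ t, 0 ≤ t → ∀ᵐ ω ∂P, Y t ω = dotProduct (maVec p q β) (X t ω)

/-! ### The formulas for the autocovariance function -/

/-- All entries of the matrix-valued function `F` are integrable on `S`. -/
def MatIntegrableOn {p : ℕ} (F : ℝ → Matrix (Fin p) (Fin p) ℝ) (S : Set ℝ) : Prop :=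
  ∀ i j, IntegrableOn (fun u => F u i j) S

/-- The entrywise integral of a matrix-valued function. -/
def matIntegral {p : ℕ} (F : ℝ → Matrix (Fin p) (Fin p) ℝ) (S : Set ℝ) :
    Matrix (Fin p) (Fin p) ℝ :=
  Matrix.of fun i j => ∫ u in S, F u i j

/-- The matrix exponential `e^{At}`. -/
def expA {p : ℕ} (A : Matrix (Fin p) (Fin p) ℝ) (t : ℝ) : Matrix (Fin p) (Fin p) ℝ :=
  NormedSpace.exp (t • A)

/-- The integrand `σ² e^{Au} δ_p δ_p' e^{A'u}` of `V*`. -/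
def vStarIntegrand {p : ℕ} (A : Matrix (Fin p) (Fin p) ℝ) (σ : ℝ) (u : ℝ) :
    Matrix (Fin p) (Fin p) ℝ :=
  σ ^ 2 • (expA A u * Matrix.vecMulVec (delta p) (delta p) * expA A.transpose u)

/-- `V* = σ² ∫_0^∞ e^{Au} δ_p δ_p' e^{A'u} du`. -/
def vStar {p : ℕ} (A : Matrix (Fin p) (Fin p) ℝ) (σ : ℝ) : Matrix (Fin p) (Fin p) ℝ :=
  matIntegral (vStarIntegrand A σ) (Set.Ioi 0)

/-- `P(a, z) = Γ(a)⁻¹ ∫_0^z e^{-w} w^{a-1} dw` along the segment `w = s z`, `0 < s < 1`. -/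
def incGammaP (a : ℝ) (z : ℂ) : ℂ :=
  (∫ s in (0 : ℝ)..1, Complex.exp (-((s : ℂ) * z)) * ((s : ℂ) * z) ^ ((a : ℂ) - 1) * z)
    / (Real.Gamma a : ℂ)

/-- `u(H, λ, h) = 2 (-λ)^{1-2H} cosh(λh) + λ^{1-2H} e^{λh} P(2H, λh)
- (-λ)^{1-2H} e^{-λh} P(2H, -λh)`, with principal powers. -/
def uFun (H : ℝ) (l : ℂ) (h : ℝ) : ℂ :=
  2 * (-l) ^ (1 - 2 * (H : ℂ)) * Complex.cosh (l * h)
    + l ^ (1 - 2 * (H : ℂ)) * Complex.exp (l * h) * incGammaP (2 * H) (l * h)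
    - (-l) ^ (1 - 2 * (H : ℂ)) * Complex.exp (-(l * h)) * incGammaP (2 * H) (-(l * h))

/-! ### Antipersistence and long memory

Both are properties of an autocovariance function `γ`, given on `[0, ∞)` and even. -/

/-- Antipersistence: `γ` is integrable with total integral zero (over the line, or equivalently
over `(0, ∞)` because `γ` is even), and negative at all large lags. -/
def IsAntipersistent (γ : ℝ → ℝ) : Prop :=
  IntegrableOn γ (Set.Ioi 0) ∧ (∫ h in Set.Ioi 0, γ h) = 0 ∧ ∀ᶠ h in atTop, γ h < 0

/-- Long memory: `γ` is positive at all large lags and its integral diverges to `+∞`. -/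
def IsLongMemory (γ : ℝ → ℝ) : Prop :=
  (∀ᶠ h in atTop, 0 < γ h) ∧ Tendsto (fun T => ∫ h in (0 : ℝ)..T, γ h) atTop atTop

end Carfima

end

namespace Carfima

section MatrixExponential

open scoped Matrix

attribute [local instance] Matrix.linftyOpNormedRing Matrix.linftyOpNormedAlgebra

variable {p : ℕ} (A : Matrix (Fin p) (Fin p) ℝ)

lemma expA_zero : expA A 0 = 1 := by
  simp [expA]

lemma expA_add (s t : ℝ) : expA A (s + t) = expA A s * expA A t := by
  unfold expA
  rw [add_smul]
  exact Matrix.exp_add_of_commute _ _ (((Commute.refl A).smul_left s).smul_right t)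

lemma expA_transpose (t : ℝ) : expA A.transpose t = (expA A t).transpose := by
  unfold expA
  rw [← Matrix.transpose_smul, Matrix.exp_transpose]

lemma hasDerivAt_expA (t : ℝ) : HasDerivAt (expA A) (expA A t * A) t :=
  hasDerivAt_exp_smul_const A t

lemma hasDerivAt_expA' (t : ℝ) : HasDerivAt (expA A) (A * expA A t) t :=
  hasDerivAt_exp_smul_const' A t

lemma expA_commute (t : ℝ) : expA A t * A = A * expA A t :=
  (hasDerivAt_expA A t).unique (hasDerivAt_expA' A t)

lemma hasDerivAt_expA_apply (t : ℝ) (i j : Fin p) :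
    HasDerivAt (fun t => expA A t i j) ((A * expA A t) i j) t := by
  have h := hasDerivAt_expA' A t
  have h1 := hasDerivAt_pi.1 h i
  exact hasDerivAt_pi.1 h1 j

end MatrixExponential

/-- The scalar function `x' e^{At} y`. -/
noncomputable def expForm {p : ℕ} (A : Matrix (Fin p) (Fin p) ℝ) (x y : Fin p → ℝ) (t : ℝ) : ℝ :=
  dotProduct x ((expA A t).mulVec y)

/-- The scalar function `x' e^{At} y` for complex vectors `x`, `y`. -/
noncomputable def expFormC {p : ℕ} (A : Matrix (Fin p) (Fin p) ℝ) (x y : Fin p → ℂ) (t : ℝ) : ℂ :=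
  ∑ i, ∑ j, x i * (expA A t i j : ℂ) * y j

section Forms

variable {p : ℕ} (A : Matrix (Fin p) (Fin p) ℝ)

lemma expForm_zero (x y : Fin p → ℝ) : expForm A x y 0 = dotProduct x y := by
  simp [expForm, expA_zero]

lemma expForm_eq_sum (x y : Fin p → ℝ) (t : ℝ) :
    expForm A x y t = ∑ i, ∑ j, x i * expA A t i j * y j := by
  simp only [expForm, dotProduct, Matrix.mulVec, Finset.mul_sum, mul_assoc]

lemma expFormC_ofReal (x y : Fin p → ℝ) (t : ℝ) :
    expFormC A (fun i => (x i : ℂ)) (fun i => (y i : ℂ)) t = (expForm A x y t : ℂ) := by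
  simp [expForm_eq_sum, expFormC]

lemma expForm_single (i j : Fin p) (t : ℝ) :
    expForm A (Pi.single i 1) (Pi.single j 1) t = expA A t i j := by
  simp [expForm]

lemma hasDerivAt_expForm (x y : Fin p → ℝ) (t : ℝ) :
    HasDerivAt (expForm A x y) (expForm A x (A.mulVec y) t) t := by
  have h1 : expForm A x y = fun t => ∑ i, ∑ j, x i * expA A t i j * y j := by
    funext t; exact expForm_eq_sum A x y t
  have h2 : expForm A x (A.mulVec y) t = ∑ i, ∑ j, x i * (A * expA A t) i j * y j := by
    rw [expForm, Matrix.mulVec_mulVec, expA_commute]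
    simp only [dotProduct, Matrix.mulVec, Finset.mul_sum, mul_assoc]
  rw [h1, h2]
  refine HasDerivAt.fun_sum fun i _ => HasDerivAt.fun_sum fun j _ => ?_
  exact ((hasDerivAt_expA_apply A t i j).const_mul _).mul_const _

lemma continuous_expForm (x y : Fin p → ℝ) : Continuous (expForm A x y) :=
  continuous_iff_continuousAt.2 fun t => (hasDerivAt_expForm A x y t).continuousAt

lemma hasDerivAt_expFormC (x y : Fin p → ℂ) (t : ℝ) :
    HasDerivAt (expFormC A x y) (expFormC A x ((A.map Complex.ofReal).mulVec y) t) t := by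
  have h2 : expFormC A x ((A.map Complex.ofReal).mulVec y) t =
      ∑ i, ∑ j, x i * ((A * expA A t) i j : ℂ) * y j := by
    rw [← expA_commute]
    simp only [expFormC, Matrix.mul_apply, Complex.ofReal_sum, Complex.ofReal_mul, Finset.mul_sum,
      Finset.sum_mul, Matrix.mulVec, dotProduct, Matrix.map_apply]
    refine Finset.sum_congr rfl fun i _ => ?_
    rw [Finset.sum_comm]
    refine Finset.sum_congr rfl fun i _ => Finset.sum_congr rfl fun j _ => ?_
    ring
  rw [h2]
  unfold expFormC
  refine HasDerivAt.fun_sum fun i _ => HasDerivAt.fun_sum fun j _ => ?_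
  exact (((hasDerivAt_expA_apply A t i j).ofReal_comp).const_mul _).mul_const _

lemma expFormC_add_right (x y z : Fin p → ℂ) (t : ℝ) :
    expFormC A x (y + z) t = expFormC A x y t + expFormC A x z t := by
  simp [expFormC, mul_add, Finset.sum_add_distrib]

lemma expFormC_smul_right (x y : Fin p → ℂ) (c : ℂ) (t : ℝ) :
    expFormC A x (c • y) t = c * expFormC A x y t := by
  simp only [expFormC, Pi.smul_apply, smul_eq_mul, Finset.mul_sum]
  refine Finset.sum_congr rfl fun i _ => Finset.sum_congr rfl fun j _ => ?_
  ring

lemma expFormC_sum_right {ι : Type*} (s : Finset ι) (x : Fin p → ℂ) (y : ι → Fin p → ℂ) (t : ℝ) :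
    expFormC A x (∑ k ∈ s, y k) t = ∑ k ∈ s, expFormC A x (y k) t := by
  classical
  induction s using Finset.induction_on with
  | empty => simp [expFormC]
  | insert a s ha ih => rw [Finset.sum_insert ha, Finset.sum_insert ha, expFormC_add_right, ih]

lemma expFormC_zero (x y : Fin p → ℂ) : expFormC A x y 0 = dotProduct x y := by
  simp only [expFormC, expA_zero, dotProduct, Matrix.one_apply]
  refine Finset.sum_congr rfl fun i _ => ?_
  rw [Finset.sum_eq_single i] <;> simp +contextual [eq_comm]

/-- On an eigenvector the exponential acts as a scalar. -/
lemma expFormC_eigenvector (x y : Fin p → ℂ) (l : ℂ)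
    (hy : (A.map Complex.ofReal).mulVec y = l • y) (t : ℝ) :
    expFormC A x y t = Complex.exp (l * t) * dotProduct x y := by
  have hd : ∀ t : ℝ, HasDerivAt (fun t : ℝ => Complex.exp (-(l * t)) * expFormC A x y t) 0 t := by
    intro t
    have h1 := hasDerivAt_expFormC A x y t
    rw [hy, expFormC_smul_right] at h1
    have h2 : HasDerivAt (fun t : ℝ => Complex.exp (-(l * t)))
        (Complex.exp (-(l * t)) * (-(l * 1))) t := by
      have h3 : HasDerivAt (fun t : ℝ => (t : ℂ)) 1 t := Complex.ofRealCLM.hasDerivAt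
      exact ((h3.const_mul l).neg).cexp
    convert! h2.mul h1 using 1
    ring
  have hc := is_const_of_deriv_eq_zero (fun t => (hd t).differentiableAt)
    (fun t => (hd t).deriv) t 0
  simp only [Complex.ofReal_zero, mul_zero, neg_zero, Complex.exp_zero, one_mul,
    expFormC_zero] at hc
  rw [← hc, ← mul_assoc, ← Complex.exp_add]
  simp

end Forms

/-! ### Exponential decay -/

/-- A linear ODE `f' = l f + k` with `Re l < -ε` and `k = O(e^{-εt})` has `f = O(e^{-εt})`. -/
lemma norm_le_of_linear_ode {f k : ℝ → ℂ} {l : ℂ} {ε C : ℝ} (hl : l.re < -ε)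
    (hf : ∀ t, HasDerivAt f (l * f t + k t) t) (hk : ∀ t, 0 ≤ t → ‖k t‖ ≤ C * Real.exp (-ε * t)) :
    ∃ C', ∀ t, 0 ≤ t → ‖f t‖ ≤ C' * Real.exp (-ε * t) := by
  set a : ℝ := -l.re - ε with ha
  have ha0 : 0 < a := by linarith
  have hC : 0 ≤ C := by
    have := (norm_nonneg _).trans (hk 0 le_rfl)
    simpa using this
  have hexp : ∀ t : ℝ, ‖Complex.exp (-(l * t))‖ = Real.exp (-l.re * t) := by
    intro t; rw [Complex.norm_exp]; simp
  have hd : ∀ t : ℝ, HasDerivAt (fun t : ℝ => Complex.exp (-(l * t)) * f t)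
      (Complex.exp (-(l * t)) * k t) t := by
    intro t
    have h2 : HasDerivAt (fun t : ℝ => Complex.exp (-(l * t)))
        (Complex.exp (-(l * t)) * (-(l * 1))) t := by
      have h3 : HasDerivAt (fun t : ℝ => (t : ℂ)) 1 t := Complex.ofRealCLM.hasDerivAt
      exact ((h3.const_mul l).neg).cexp
    convert! h2.mul (hf t) using 1
    ring
  refine ⟨‖f 0‖ + C / a, fun t ht => ?_⟩
  have hB : ∀ x : ℝ, HasDerivAt (fun x => ‖f 0‖ + C / a * Real.exp (a * x))
      (C * Real.exp (a * x)) x := by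
    intro x
    have h4 : HasDerivAt (fun x => Real.exp (a * x)) (Real.exp (a * x) * (a * 1)) x :=
      ((hasDerivAt_id x).const_mul a).exp
    convert! (h4.const_mul (C / a)).const_add ‖f 0‖ using 1
    field_simp
  have key := image_norm_le_of_norm_deriv_right_le_deriv_boundary (a := 0) (b := t)
    (f := fun t : ℝ => Complex.exp (-(l * t)) * f t)
    (fun x _ => (hd x).continuousAt.continuousWithinAt)
    (fun x _ => (hd x).hasDerivWithinAt)
    (B := fun x => ‖f 0‖ + C / a * Real.exp (a * x)) (B' := fun x => C * Real.exp (a * x))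
    (by simp; positivity) hB
    (by
      intro x hx
      rw [norm_mul, hexp]
      calc Real.exp (-l.re * x) * ‖k x‖
          ≤ Real.exp (-l.re * x) * (C * Real.exp (-ε * x)) := by gcongr; exact hk x hx.1
        _ = C * Real.exp (a * x) := by
          rw [mul_left_comm, ← Real.exp_add]; congr 2; rw [ha]; ring)
    (x := t) ⟨ht, le_rfl⟩
  rw [norm_mul, hexp] at key
  have e1 : ‖f t‖ = Real.exp (l.re * t) * (Real.exp (-l.re * t) * ‖f t‖) := by
    rw [← mul_assoc, ← Real.exp_add]; simp
  rw [e1]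
  calc Real.exp (l.re * t) * (Real.exp (-l.re * t) * ‖f t‖)
      ≤ Real.exp (l.re * t) * (‖f 0‖ + C / a * Real.exp (a * t)) := by gcongr
    _ = ‖f 0‖ * Real.exp (l.re * t) + C / a * Real.exp (-ε * t) := by
      rw [mul_add, mul_left_comm, ← Real.exp_add]
      have : l.re * t + a * t = -ε * t := by rw [ha]; ring
      rw [this]; ring
    _ ≤ ‖f 0‖ * Real.exp (-ε * t) + C / a * Real.exp (-ε * t) := by
      gcongr
    _ = _ := by ring

/-- The exponential of a stable matrix decays exponentially. -/
lemma exists_expForm_le {p : ℕ} (A : Matrix (Fin p) (Fin p) ℝ)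
    (hA : ∀ z ∈ spectrum ℂ (A.map Complex.ofReal), z.re < 0) :
    ∃ ε > 0, ∀ x y : Fin p → ℂ, ∃ C, ∀ t, 0 ≤ t →
      ‖expFormC A x y t‖ ≤ C * Real.exp (-ε * t) := by
  have hfin : (spectrum ℂ (A.map Complex.ofReal)).Finite := Matrix.finite_spectrum _
  obtain ⟨ε, hε, hlt⟩ : ∃ ε > 0, ∀ z ∈ spectrum ℂ (A.map Complex.ofReal), z.re < -ε := by
    rcases (spectrum ℂ (A.map Complex.ofReal)).eq_empty_or_nonempty with h | h
    · exact ⟨1, one_pos, by simp [h]⟩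
    · obtain ⟨z, hz, hm⟩ := hfin.exists_maximalFor Complex.re _ h
      refine ⟨-z.re / 2, by have := hA z hz; linarith, fun w hw => ?_⟩
      have h1 : w.re ≤ z.re := by
        by_contra hcon
        exact absurd (hm hw (by simpa using (not_le.1 hcon).le)) hcon
      have := hA z hz
      linarith
  refine ⟨ε, hε, fun x => ?_⟩
  let S : Submodule ℂ (Fin p → ℂ) :=
    { carrier := {y | ∃ C, ∀ t, 0 ≤ t → ‖expFormC A x y t‖ ≤ C * Real.exp (-ε * t)}
      zero_mem' := ⟨0, by simp [expFormC]⟩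
      add_mem' := by
        rintro y z ⟨C, hC⟩ ⟨D, hD⟩
        refine ⟨C + D, fun t ht => ?_⟩
        rw [expFormC_add_right, add_mul]
        exact (norm_add_le _ _).trans (add_le_add (hC t ht) (hD t ht))
      smul_mem' := by
        rintro c y ⟨C, hC⟩
        refine ⟨‖c‖ * C, fun t ht => ?_⟩
        rw [expFormC_smul_right, norm_mul, mul_assoc]
        gcongr
        exact hC t ht }
  suffices hS : S = ⊤ by
    intro y
    have : y ∈ S := by rw [hS]; trivial
    exact this
  let T : Module.End ℂ (Fin p → ℂ) := Matrix.toLin' (A.map Complex.ofReal)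
  rw [eq_top_iff, ← Module.End.iSup_maxGenEigenspace_eq_top T, iSup_le_iff]
  intro μ y hy
  rw [Module.End.mem_maxGenEigenspace] at hy
  obtain ⟨k, hk⟩ := hy
  by_cases hμ : T.HasEigenvalue μ
  · have hμ' : μ.re < -ε := by
      apply hlt
      have := hμ.mem_spectrum
      rwa [Matrix.spectrum_toLin'] at this
    induction k generalizing y with
    | zero =>
      have : y = 0 := by simpa using hk
      rw [this]; exact S.zero_mem
    | succ k ih =>
      rw [pow_succ, Module.End.mul_apply] at hk
      obtain ⟨C, hC⟩ := ih hk
      refine norm_le_of_linear_ode (k := expFormC A x ((T - μ • 1) y)) hμ' (fun t => ?_) hC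
      have h1 := hasDerivAt_expFormC A x y t
      have h2 : (A.map Complex.ofReal).mulVec y = μ • y + (T - μ • 1) y := by
        simp [T]
      rwa [h2, expFormC_add_right, expFormC_smul_right] at h1
  · have hinj : Function.Injective (T - μ • (1 : Module.End ℂ (Fin p → ℂ))) := by
      rw [← LinearMap.ker_eq_bot]
      by_contra hne
      apply hμ
      rw [Module.End.hasEigenvalue_iff, Module.End.eigenspace_def]
      convert! hne using 2
    have hinj' : Function.Injective ((T - μ • (1 : Module.End ℂ (Fin p → ℂ))) ^ k) := by
      rw [Module.End.coe_pow]; exact hinj.iterate k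
    have : y = 0 := hinj' (by rw [hk, map_zero])
    rw [this]; exact S.zero_mem

/-- Continuous functions on the line that decay exponentially at `+∞`. -/
structure ExpDecay (f : ℝ → ℝ) : Prop where
  continuous : Continuous f
  bound : ∃ C ε, 0 < ε ∧ ∀ t, 0 ≤ t → |f t| ≤ C * Real.exp (-ε * t)

lemma expDecay_expForm {p : ℕ} {A : Matrix (Fin p) (Fin p) ℝ}
    (hA : ∀ z ∈ spectrum ℂ (A.map Complex.ofReal), z.re < 0) (x y : Fin p → ℝ) :
    ExpDecay (expForm A x y) := by
  refine ⟨continuous_expForm A x y, ?_⟩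
  obtain ⟨ε, hε, h⟩ := exists_expForm_le A hA
  obtain ⟨C, hC⟩ := h (fun i => (x i : ℂ)) (fun i => (y i : ℂ))
  refine ⟨C, ε, hε, fun t ht => ?_⟩
  have := hC t ht
  rwa [expFormC_ofReal, Complex.norm_real] at this

namespace ExpDecay

variable {f g : ℝ → ℝ}

lemma exists_nonneg_bound (hf : ExpDecay f) :
    ∃ C ε, 0 ≤ C ∧ 0 < ε ∧ ∀ t, 0 ≤ t → |f t| ≤ C * Real.exp (-ε * t) := by
  obtain ⟨C, ε, hε, h⟩ := hf.bound
  refine ⟨C, ε, ?_, hε, h⟩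
  simpa using (abs_nonneg _).trans (h 0 le_rfl)

lemma integrableOn (hf : ExpDecay f) : IntegrableOn f (Set.Ioi 0) := by
  obtain ⟨C, ε, hε, h⟩ := hf.bound
  have hi : IntegrableOn (fun t => C * Real.exp (-ε * t)) (Set.Ioi 0) :=
    (integrableOn_exp_mul_Ioi (neg_lt_zero.2 hε) 0).const_mul C
  refine hi.mono' hf.continuous.aestronglyMeasurable ?_
  filter_upwards [ae_restrict_mem measurableSet_Ioi] with t ht
  exact h t (le_of_lt ht)

lemma tendsto_zero (hf : ExpDecay f) : Tendsto f atTop (𝓝 0) := by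
  obtain ⟨C, ε, hε, h⟩ := hf.bound
  have h1 : Tendsto (fun t : ℝ => C * Real.exp (-ε * t)) atTop (𝓝 (C * 0)) := by
    refine Tendsto.const_mul C (Real.tendsto_exp_atBot.comp ?_)
    exact tendsto_id.const_mul_atTop_of_neg (neg_lt_zero.2 hε)
  rw [mul_zero] at h1
  refine squeeze_zero_norm' ?_ h1
  filter_upwards [eventually_ge_atTop 0] with t ht using h t ht

lemma const_mul (hf : ExpDecay f) (c : ℝ) : ExpDecay (fun t => c * f t) := by
  obtain ⟨C, ε, hε, h⟩ := hf.bound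
  refine ⟨hf.continuous.const_mul c, |c| * C, ε, hε, fun t ht => ?_⟩
  rw [abs_mul, mul_assoc]
  gcongr
  exact h t ht

/-- Polynomial factors do not affect exponential decay. -/
lemma one_add_abs_pow_mul (hf : ExpDecay f) (n : ℕ) :
    ExpDecay (fun t => (1 + |t|) ^ n * f t) := by
  obtain ⟨C, ε, hC, hε, h⟩ := hf.exists_nonneg_bound
  refine ⟨by have := hf.continuous; fun_prop, n.factorial * (2 / ε) ^ n * Real.exp (ε / 2) * C,
    ε / 2, by positivity, fun t ht => ?_⟩
  have h1 : (1 + t) ^ n ≤ n.factorial * (2 / ε) ^ n * Real.exp (ε / 2 * (1 + t)) := by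
    have h2 := Real.pow_div_factorial_le_exp (x := ε / 2 * (1 + t)) (by positivity) n
    rw [div_le_iff₀ (by positivity), mul_pow] at h2
    calc (1 + t) ^ n = (2 / ε) ^ n * ((ε / 2) ^ n * (1 + t) ^ n) := by
          rw [← mul_assoc, ← mul_pow, div_mul_div_cancel₀ hε.ne', div_self two_ne_zero, one_pow,
            one_mul]
      _ ≤ (2 / ε) ^ n * (Real.exp (ε / 2 * (1 + t)) * n.factorial) := by gcongr
      _ = _ := by ring
  rw [abs_mul, abs_of_nonneg (by positivity), abs_of_nonneg ht]
  calc (1 + t) ^ n * |f t|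
      ≤ (n.factorial * (2 / ε) ^ n * Real.exp (ε / 2 * (1 + t))) * (C * Real.exp (-ε * t)) := by
        gcongr
        exact h t ht
    _ = n.factorial * (2 / ε) ^ n * C * (Real.exp (ε / 2 * (1 + t)) * Real.exp (-ε * t)) := by ring
    _ = n.factorial * (2 / ε) ^ n * C * (Real.exp (ε / 2) * Real.exp (-(ε / 2) * t)) := by
      rw [← Real.exp_add, ← Real.exp_add]; congr 2; ring
    _ = _ := by ring

/-- A product with a function of polynomial growth decays exponentially. -/
lemma mul_of_growth (hf : ExpDecay f) (hg : Continuous g) {M : ℝ} {n : ℕ}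
    (hM : ∀ t, 0 ≤ t → |g t| ≤ M * (1 + |t|) ^ n) : ExpDecay (fun t => g t * f t) := by
  obtain ⟨C, ε, hε, h⟩ := (hf.one_add_abs_pow_mul n).bound
  have hM0 : 0 ≤ M := by simpa using (abs_nonneg _).trans (hM 0 le_rfl)
  refine ⟨hg.mul hf.continuous, M * C, ε, hε, fun t ht => ?_⟩
  rw [abs_mul]
  calc |g t| * |f t| ≤ M * (1 + |t|) ^ n * |f t| := by gcongr; exact hM t ht
    _ = M * |(1 + |t|) ^ n * f t| := by
      rw [abs_mul, abs_of_nonneg (by positivity : 0 ≤ (1 + |t|) ^ n)]; ring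
    _ ≤ M * (C * Real.exp (-ε * t)) := by gcongr; exact h t ht
    _ = _ := by ring

lemma mul (hf : ExpDecay f) (hg : ExpDecay g) : ExpDecay (fun t => f t * g t) := by
  obtain ⟨C, ε, hC, hε, h⟩ := hf.exists_nonneg_bound
  refine hg.mul_of_growth hf.continuous (M := C) (n := 0) fun t ht => ?_
  rw [pow_zero]
  refine (h t ht).trans ?_
  gcongr
  rw [Real.exp_le_one_iff]
  nlinarith

lemma pow_mul (hf : ExpDecay f) (n : ℕ) : ExpDecay (fun t => t ^ n * f t) := by
  refine hf.mul_of_growth (by fun_prop) (M := 1) (n := n) fun t ht => ?_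
  rw [abs_pow, one_mul]
  gcongr
  linarith

lemma comp_add (hf : ExpDecay f) (w : ℝ) : ExpDecay (fun t => f (t + w)) := by
  obtain ⟨C, ε, hC, hε, h⟩ := hf.exists_nonneg_bound
  have hc : Continuous fun t => f (t + w) := by have := hf.continuous; fun_prop
  obtain ⟨M, hM⟩ := (isCompact_Icc (a := (0 : ℝ)) (b := |w|)).exists_bound_of_continuousOn
    hc.continuousOn
  have hM0 : 0 ≤ M := (norm_nonneg _).trans (hM 0 ⟨le_rfl, abs_nonneg w⟩)
  refine ⟨hc, C * Real.exp (-ε * w) + M * Real.exp (ε * |w|), ε, hε, fun t ht => ?_⟩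
  rw [add_mul, mul_assoc, mul_assoc, ← Real.exp_add, ← Real.exp_add]
  rcases le_total t |w| with htw | htw
  · have h1 : 1 ≤ Real.exp (ε * |w| + -ε * t) := by
      rw [Real.one_le_exp_iff]; nlinarith
    have h2 := hM t ⟨ht, htw⟩
    have h3 : M * 1 ≤ M * Real.exp (ε * |w| + -ε * t) := by gcongr
    have h4 : 0 ≤ C * Real.exp (-ε * w + -ε * t) := by positivity
    rw [Real.norm_eq_abs] at h2
    linarith
  · have h1 := h (t + w) (by linarith [neg_abs_le w])
    have h2 : -ε * (t + w) = -ε * w + -ε * t := by ring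
    rw [h2] at h1
    have h4 : 0 ≤ M * Real.exp (ε * |w| + -ε * t) := by positivity
    linarith

/-- Integrability against powers `t ^ s`, `s > -1`. -/
lemma integrableOn_rpow_mul (hf : ExpDecay f) {s : ℝ} (hs : -1 < s) :
    IntegrableOn (fun t => t ^ s * f t) (Set.Ioi 0) := by
  obtain ⟨C, ε, hε, h⟩ := hf.bound
  have hi : IntegrableOn (fun t : ℝ => C * (t ^ s * Real.exp (-ε * t ^ (1 : ℝ)))) (Set.Ioi 0) :=
    (integrableOn_rpow_mul_exp_neg_mul_rpow hs one_pos hε).const_mul C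
  refine hi.mono' (by have := hf.continuous; fun_prop) ?_
  filter_upwards [ae_restrict_mem measurableSet_Ioi] with t ht
  have ht' : 0 ≤ t := le_of_lt ht
  rw [Real.norm_eq_abs, abs_mul, abs_of_nonneg (Real.rpow_nonneg ht' s), Real.rpow_one]
  calc t ^ s * |f t| ≤ t ^ s * (C * Real.exp (-ε * t)) := by
        gcongr
        exact h t ht'
    _ = _ := by ring

/-- The fundamental theorem of calculus on the half line for a decaying function. -/
lemma integral_deriv {f' : ℝ → ℝ} (hf : ExpDecay f) (hf' : ExpDecay f')
    (hd : ∀ t, HasDerivAt f (f' t) t) : ∫ t in Set.Ioi (0 : ℝ), f' t = -f 0 := by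
  rw [integral_Ioi_of_hasDerivAt_of_tendsto' (fun t _ => hd t) hf'.integrableOn hf.tendsto_zero]
  simp

end ExpDecay

lemma abs_rpow_le_one_add_abs_sq {a : ℝ} (ha0 : 0 ≤ a) (ha : a ≤ 2) (x : ℝ) :
    |x| ^ a ≤ (1 + |x|) ^ 2 := by
  calc |x| ^ a ≤ (1 + |x|) ^ a := by gcongr; linarith
    _ ≤ (1 + |x|) ^ (2 : ℝ) := by
      apply Real.rpow_le_rpow_of_exponent_le _ ha
      linarith [abs_nonneg x]
    _ = _ := by norm_cast

lemma setIntegral_Ioi_comp_add {E : Type*} [NormedAddCommGroup E] [NormedSpace ℝ E] (f : ℝ → E)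
    (a c : ℝ) : ∫ x in Set.Ioi a, f (x + c) = ∫ x in Set.Ioi (a + c), f x := by
  have := (measurePreserving_add_right volume c).setIntegral_preimage_emb
    (MeasurableEquiv.addRight c).measurableEmbedding f (Set.Ioi (a + c))
  rw [← this]
  congr 2
  simp

lemma integral_eq_setIntegral_Ioi_add_neg {f : ℝ → ℝ} (hf : Integrable f) :
    ∫ x, f x = ∫ x in Set.Ioi (0 : ℝ), (f x + f (-x)) := by
  have h1 : IntegrableOn (fun x => f (-x)) (Set.Ioi 0) := hf.comp_neg.integrableOn
  rw [integral_add hf.integrableOn h1, integral_comp_neg_Ioi, neg_zero, add_comm,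
    intervalIntegral.integral_Iic_add_Ioi hf.integrableOn hf.integrableOn]

section Quadrant

/-- Lebesgue measure on the half line `(0, ∞)`. -/
noncomputable abbrev halfLine : Measure ℝ := volume.restrict (Set.Ioi (0 : ℝ))

variable {g k Φ : ℝ → ℝ}

/-- Integrability on the quadrant of a kernel of polynomial growth against decaying functions. -/
lemma integrable_quadrant (hg : ExpDecay g) (hk : ExpDecay k) {Q : ℝ → ℝ → ℝ}
    (hQ : Continuous (Function.uncurry Q)) {M : ℝ} {n : ℕ}
    (hM : ∀ u v, 0 ≤ u → 0 ≤ v → |Q u v| ≤ M * ((1 + |u|) ^ n * (1 + |v|) ^ n)) :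
    Integrable (fun z : ℝ × ℝ => g z.1 * k z.2 * Q z.1 z.2) (halfLine.prod halfLine) := by
  have h1 : Integrable (fun u => (1 + |u|) ^ n * g u) halfLine :=
    (hg.one_add_abs_pow_mul n).integrableOn
  have h2 : Integrable (fun u => (1 + |u|) ^ n * k u) halfLine :=
    (hk.one_add_abs_pow_mul n).integrableOn
  refine ((h1.mul_prod h2).norm.const_mul M).mono' ?_ ?_
  · have := hg.continuous
    have := hk.continuous
    have hQ' : Continuous fun z : ℝ × ℝ => Q z.1 z.2 := hQ
    exact Continuous.aestronglyMeasurable (by fun_prop)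
  · rw [Measure.prod_restrict]
    filter_upwards [ae_restrict_mem (measurableSet_Ioi.prod measurableSet_Ioi)] with z hz
    rw [norm_mul, norm_mul, norm_mul, norm_mul, norm_mul, Real.norm_eq_abs (Q _ _)]
    have h3 := hM z.1 z.2 (le_of_lt hz.1) (le_of_lt hz.2)
    rw [Real.norm_of_nonneg (by positivity : 0 ≤ (1 + |z.1|) ^ n),
      Real.norm_of_nonneg (by positivity : 0 ≤ (1 + |z.2|) ^ n)]
    calc ‖g z.1‖ * ‖k z.2‖ * |Q z.1 z.2|
        ≤ ‖g z.1‖ * ‖k z.2‖ * (M * ((1 + |z.1|) ^ n * (1 + |z.2|) ^ n)) := by gcongr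
      _ = _ := by ring

/-- A convolution kernel on the quadrant, integrated along the diagonals. -/
lemma integral_quadrant_sub
    (hinteg : Integrable (fun z : ℝ × ℝ => g z.1 * g z.2 * Φ (z.1 - z.2))
      (halfLine.prod halfLine)) :
    ∫ z, g z.1 * g z.2 * Φ (z.1 - z.2) ∂(halfLine.prod halfLine) =
      ∫ w in Set.Ioi (0 : ℝ), (∫ v in Set.Ioi (0 : ℝ), g v * g (v + w)) * (Φ w + Φ (-w)) := by
  set G : ℝ → ℝ := (Set.Ioi 0).indicator g with hG
  set F : ℝ × ℝ → ℝ := fun z => G z.1 * G z.2 * Φ (z.1 - z.2) with hF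
  have hFi : F = (Set.Ioi (0 : ℝ) ×ˢ Set.Ioi (0 : ℝ)).indicator
      (fun z => g z.1 * g z.2 * Φ (z.1 - z.2)) := by
    funext z
    by_cases h1 : z.1 ∈ Set.Ioi (0 : ℝ) <;> by_cases h2 : z.2 ∈ Set.Ioi (0 : ℝ) <;>
      simp only [hF, hG, Set.indicator_apply, Set.mem_prod, h1, h2, if_true, if_false, mul_zero,
        zero_mul, and_self, and_true, and_false]
  have hms : MeasurableSet (Set.Ioi (0 : ℝ) ×ˢ Set.Ioi (0 : ℝ)) :=
    measurableSet_Ioi.prod measurableSet_Ioi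
  rw [Measure.prod_restrict] at hinteg ⊢
  have hFint : Integrable F (volume.prod volume) := by
    rw [hFi]; exact (integrable_indicator_iff hms).2 hinteg
  rw [← integral_indicator hms, ← hFi]
  have hmp : MeasurePreserving (fun z : ℝ × ℝ => (z.2 + z.1, z.2)) (volume.prod volume)
      (volume.prod volume) :=
    Measure.measurePreserving_swap.comp ((measurePreserving_prod_add volume volume).comp
      Measure.measurePreserving_swap)
  have hsh : Integrable (fun z : ℝ × ℝ => F (z.2 + z.1, z.2)) (volume.prod volume) :=
    hmp.integrable_comp_of_integrable hFint
  have hshi : ∫ z, F z ∂(volume.prod volume) =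
      ∫ z : ℝ × ℝ, F (z.2 + z.1, z.2) ∂(volume.prod volume) := by
    rw [← hmp.map_eq, integral_map hmp.aemeasurable]
    · rw [hmp.map_eq]
    · rw [hmp.map_eq]; exact hFint.aestronglyMeasurable
  have hc : ∀ w v, F (v + w, v) = G v * G (v + w) * Φ w := by
    intro w v; simp only [hF, add_sub_cancel_left]; ring
  simp only [hc] at hsh hshi
  rw [hshi, integral_prod _ hsh]
  have hint2 := hsh.integral_prod_left
  simp only [integral_mul_const] at hint2 ⊢
  rw [integral_eq_setIntegral_Ioi_add_neg hint2]
  refine setIntegral_congr_fun measurableSet_Ioi fun w hw => ?_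
  have hw' : (0 : ℝ) < w := hw
  have e1 : ∫ v, G v * G (v + w) = ∫ v in Set.Ioi (0 : ℝ), g v * g (v + w) := by
    rw [← integral_indicator measurableSet_Ioi]
    congr 1; funext v
    by_cases hv : 0 < v
    · have : 0 < v + w := by linarith
      simp [hG, hv, this]
    · simp [hG, hv]
  have e2 : ∫ v, G v * G (v + -w) = ∫ v, G v * G (v + w) := by
    rw [← integral_add_right_eq_self (fun v => G v * G (v + -w)) w]
    congr 1; funext v
    rw [add_neg_cancel_right, mul_comm]
  simp only [e2, e1]
  ring

end Quadrant

/-- The second difference `|h - w|^a + |h + w|^a - 2 |h|^a`. -/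
noncomputable def secondDiff (a h w : ℝ) : ℝ := |h - w| ^ a + |h + w| ^ a - 2 * |h| ^ a

/-- The covariance function attached to the second derivative `k` of a kernel. -/
noncomputable def kernelCov (a : ℝ) (k : ℝ → ℝ) (h : ℝ) : ℝ :=
  1 / 2 * ∫ w in Set.Ioi (0 : ℝ), k w * secondDiff a h w

section Power

variable {a : ℝ}

lemma continuous_abs_rpow (ha : 0 < a) : Continuous fun x : ℝ => |x| ^ a :=
  continuous_abs.rpow_const fun _ => Or.inr ha.le

lemma one_add_abs_mul (h w : ℝ) : 1 + |h + w| ≤ (1 + |h|) * (1 + |w|) := by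
  have := abs_add_le h w
  nlinarith [mul_nonneg (abs_nonneg h) (abs_nonneg w)]

lemma abs_add_rpow_le (ha0 : 0 ≤ a) (ha : a ≤ 2) (h w : ℝ) :
    |h + w| ^ a ≤ (1 + |h|) ^ 2 * (1 + |w|) ^ 2 := by
  refine (abs_rpow_le_one_add_abs_sq ha0 ha _).trans ?_
  rw [← mul_pow]
  gcongr
  exact one_add_abs_mul h w

lemma abs_sub_rpow_le (ha0 : 0 ≤ a) (ha : a ≤ 2) (h w : ℝ) :
    |h - w| ^ a ≤ (1 + |h|) ^ 2 * (1 + |w|) ^ 2 := by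
  simpa [sub_eq_add_neg] using abs_add_rpow_le ha0 ha h (-w)

lemma abs_secondDiff_le (ha0 : 0 ≤ a) (ha : a ≤ 2) (h w : ℝ) :
    |secondDiff a h w| ≤ 4 * (1 + |h|) ^ 2 * (1 + |w|) ^ 2 := by
  have h1 := abs_sub_rpow_le ha0 ha h w
  have h2 := abs_add_rpow_le ha0 ha h w
  have h3 : |h| ^ a ≤ (1 + |h|) ^ 2 * (1 + |w|) ^ 2 := by
    refine (abs_rpow_le_one_add_abs_sq ha0 ha h).trans ?_
    refine le_mul_of_one_le_right (by positivity) (one_le_pow₀ ?_)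
    linarith [abs_nonneg w]
  have p1 : 0 ≤ |h - w| ^ a := by positivity
  have p2 : 0 ≤ |h + w| ^ a := by positivity
  have p3 : 0 ≤ |h| ^ a := by positivity
  unfold secondDiff
  rw [abs_le]
  constructor <;> linarith

lemma continuous_secondDiff (ha : 0 < a) :
    Continuous fun z : ℝ × ℝ => secondDiff a z.1 z.2 := by
  have := continuous_abs_rpow ha
  unfold secondDiff
  have h1 : Continuous fun z : ℝ × ℝ => |z.1 - z.2| ^ a := this.comp (by fun_prop)
  have h2 : Continuous fun z : ℝ × ℝ => |z.1 + z.2| ^ a := this.comp (by fun_prop)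
  have h3 : Continuous fun z : ℝ × ℝ => |z.1| ^ a := this.comp (by fun_prop)
  fun_prop

end Power

/-- Integration of a kernel of fractional Brownian type over the quadrant. -/
lemma integral_quadrant_eq_kernelCov {a : ℝ} (ha0 : 0 < a) (ha : a ≤ 2) {g k : ℝ → ℝ} {c : ℝ}
    (hg : ExpDecay g) (hk : ExpDecay k) (hgc : ∫ u in Set.Ioi (0 : ℝ), g u = -c)
    (hkc : 2 * ∫ w in Set.Ioi (0 : ℝ), k w = c ^ 2)
    (hgk : ∀ w, 0 < w → ∫ v in Set.Ioi (0 : ℝ), g v * g (v + w) = -(c * g w) - k w) (h : ℝ) :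
    ∫ z, g z.1 * g z.2 * (1 / 2 *
        (|h - z.1| ^ a + |h + z.2| ^ a - |h - z.1 + z.2| ^ a - |h| ^ a))
          ∂(halfLine.prod halfLine) = kernelCov a k h := by
  have hφ := continuous_abs_rpow ha0
  set φ : ℝ → ℝ := fun x => |h - x| ^ a with hφdef
  have hφc : Continuous φ := hφ.comp (by fun_prop : Continuous fun x : ℝ => h - x)
  have hφb : ∀ x, |φ x| ≤ (1 + |h|) ^ 2 * (1 + |x|) ^ 2 := by
    intro x
    rw [abs_of_nonneg (by positivity)]
    exact abs_sub_rpow_le ha0.le ha h x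
  have hone : ∀ x : ℝ, 1 ≤ (1 + |x|) ^ 2 := fun x => one_le_pow₀ (by linarith [abs_nonneg x])
  have i1 : Integrable (fun z : ℝ × ℝ => g z.1 * g z.2 * φ z.1) (halfLine.prod halfLine) := by
    refine integrable_quadrant hg hg (Q := fun u _ => φ u) (hφc.comp continuous_fst)
      (M := (1 + |h|) ^ 2) (n := 2) fun u v _ _ => (hφb u).trans ?_
    gcongr
    exact le_mul_of_one_le_right (by positivity) (hone v)
  have i2 : Integrable (fun z : ℝ × ℝ => g z.1 * g z.2 * φ (-z.2)) (halfLine.prod halfLine) := by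
    refine integrable_quadrant hg hg (Q := fun _ v => φ (-v)) (hφc.comp continuous_snd.neg)
      (M := (1 + |h|) ^ 2) (n := 2) fun u v _ _ => (hφb _).trans ?_
    rw [abs_neg]
    gcongr
    exact le_mul_of_one_le_left (by positivity) (hone u)
  have i3 : Integrable (fun z : ℝ × ℝ => g z.1 * g z.2 * φ (z.1 - z.2))
      (halfLine.prod halfLine) := by
    refine integrable_quadrant hg hg (Q := fun u v => φ (u - v))
      (hφc.comp (continuous_fst.sub continuous_snd))
      (M := (1 + |h|) ^ 2) (n := 2) fun u v _ _ => (hφb _).trans ?_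
    rw [← mul_pow (1 + |u|)]
    gcongr
    simpa [sub_eq_add_neg] using one_add_abs_mul u (-v)
  have i4 : Integrable (fun z : ℝ × ℝ => g z.1 * g z.2 * φ 0) (halfLine.prod halfLine) :=
    (Integrable.mul_prod (μ := halfLine) (ν := halfLine) hg.integrableOn
      hg.integrableOn).mul_const _
  have e0 : (fun z : ℝ × ℝ => g z.1 * g z.2 * (1 / 2 *
        (|h - z.1| ^ a + |h + z.2| ^ a - |h - z.1 + z.2| ^ a - |h| ^ a))) =
      fun z => 1 / 2 * (g z.1 * g z.2 * φ z.1 + g z.1 * g z.2 * φ (-z.2)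
        - g z.1 * g z.2 * φ (z.1 - z.2) - g z.1 * g z.2 * φ 0) := by
    funext z
    simp only [hφdef, sub_neg_eq_add, sub_zero, sub_sub_eq_add_sub, sub_add_eq_add_sub]
    ring
  have i12 : Integrable (fun z : ℝ × ℝ => g z.1 * g z.2 * φ z.1 + g z.1 * g z.2 * φ (-z.2))
      (halfLine.prod halfLine) := i1.add i2
  have i123 : Integrable (fun z : ℝ × ℝ => g z.1 * g z.2 * φ z.1 + g z.1 * g z.2 * φ (-z.2)
      - g z.1 * g z.2 * φ (z.1 - z.2)) (halfLine.prod halfLine) := i12.sub i3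
  rw [e0, integral_const_mul, integral_sub i123 i4, integral_sub i12 i3, integral_add i1 i2,
    integral_quadrant_sub i3]
  have e1 : ∫ z : ℝ × ℝ, g z.1 * g z.2 * φ z.1 ∂(halfLine.prod halfLine) =
      (∫ u in Set.Ioi (0 : ℝ), g u * φ u) * -c := by
    rw [← hgc, ← integral_prod_mul]
    congr 1; funext z; ring
  have e2 : ∫ z : ℝ × ℝ, g z.1 * g z.2 * φ (-z.2) ∂(halfLine.prod halfLine) =
      -c * (∫ u in Set.Ioi (0 : ℝ), g u * φ (-u)) := by
    rw [← hgc, ← integral_prod_mul]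
    congr 1; funext z; ring
  have e4 : ∫ z : ℝ × ℝ, g z.1 * g z.2 * φ 0 ∂(halfLine.prod halfLine) = c ^ 2 * φ 0 := by
    rw [integral_mul_const, integral_prod_mul, hgc]; ring
  have e3 : ∫ w in Set.Ioi (0 : ℝ), (∫ v in Set.Ioi (0 : ℝ), g v * g (v + w)) * (φ w + φ (-w)) =
      ∫ w in Set.Ioi (0 : ℝ), (-c * (g w * φ w) - c * (g w * φ (-w)) -
        (k w * secondDiff a h w + k w * (2 * φ 0))) := by
    refine setIntegral_congr_fun measurableSet_Ioi fun w hw => ?_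
    simp only [hgk w hw, secondDiff, hφdef, sub_neg_eq_add, sub_zero]
    ring
  have j1 : IntegrableOn (fun w => g w * φ w) (Set.Ioi 0) := by
    simpa only [mul_comm] using (hg.mul_of_growth hφc fun t _ => hφb t).integrableOn
  have j2 : IntegrableOn (fun w => g w * φ (-w)) (Set.Ioi 0) := by
    simpa only [mul_comm, Function.comp_apply] using (hg.mul_of_growth (hφc.comp continuous_neg)
      fun t _ => by simpa using hφb (-t)).integrableOn
  have hsc : Continuous fun w => secondDiff a h w :=
    (continuous_secondDiff ha0).comp (Continuous.prodMk_right h)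
  have j3 : IntegrableOn (fun w => k w * secondDiff a h w) (Set.Ioi 0) := by
    simpa only [mul_comm] using (hk.mul_of_growth hsc
      fun t _ => abs_secondDiff_le ha0.le ha h t).integrableOn
  have j4 : IntegrableOn (fun w => k w * (2 * φ 0)) (Set.Ioi 0) := hk.integrableOn.mul_const _
  have j12 : IntegrableOn (fun w => -c * (g w * φ w) - c * (g w * φ (-w))) (Set.Ioi 0) :=
    (j1.const_mul _).sub (j2.const_mul _)
  have j34 : IntegrableOn (fun w => k w * secondDiff a h w + k w * (2 * φ 0)) (Set.Ioi 0) :=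
    j3.add j4
  rw [e1, e2, e3, e4, integral_sub j12 j34, integral_sub (j1.const_mul _) (j2.const_mul _),
    integral_add j3 j4, integral_const_mul,
    integral_const_mul, integral_mul_const, kernelCov]
  linear_combination (1 / 2 * φ 0) * hkc

/-- Integration by parts in the covariance function. -/
lemma kernelCov_eq_sub_sub {a : ℝ} (ha0 : 0 < a) (ha : a ≤ 2) {k θ : ℝ → ℝ} (hk : ExpDecay k)
    (hθ : ExpDecay θ) (hd : ∀ t, HasDerivAt θ (k t) t) {h : ℝ} (hh : 0 ≤ h) :
    kernelCov a k h =
      a / 2 * (∫ u in Set.Ioc 0 h, u ^ (a - 1) * θ (h - u))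
      - a / 2 * (∫ u in Set.Ioi h, u ^ (a - 1) * θ (u - h))
      - a / 2 * ∫ u in Set.Ioi (0 : ℝ), u ^ (a - 1) * θ (u + h) := by
  have hφ := continuous_abs_rpow ha0
  have ha1 : -1 < a - 1 := by linarith
  have hrp : ∀ u : ℝ, 0 < u → HasDerivAt (fun u => u ^ a) (a * u ^ (a - 1)) u := fun u hu =>
    Real.hasDerivAt_rpow_const (Or.inl hu.ne')
  have hrc : Continuous fun u : ℝ => u ^ a := Real.continuous_rpow_const ha0.le
  have hgr : ∀ t : ℝ, 0 ≤ t → |t ^ a| ≤ 1 * (1 + |t|) ^ 2 := by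
    intro t ht
    rw [abs_of_nonneg (Real.rpow_nonneg ht a), one_mul]
    simpa [abs_of_nonneg ht] using abs_rpow_le_one_add_abs_sq ha0.le ha t
  -- the part beyond `h` of the first kernel
  have p1 : ∫ u in Set.Ioi (0 : ℝ), (k (u + h) * u ^ a + a * (u ^ (a - 1) * θ (u + h))) = 0 := by
    have hD := (hθ.comp_add h).mul_of_growth hrc hgr
    have hI1 := ((hk.comp_add h).mul_of_growth hrc hgr).integrableOn
    have hI2 := (hθ.comp_add h).integrableOn_rpow_mul ha1
    rw [integral_Ioi_of_hasDerivAt_of_tendsto (f := fun u => u ^ a * θ (u + h)) (m := 0)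
      hD.continuous.continuousWithinAt _ _ hD.tendsto_zero]
    · simp [Real.zero_rpow ha0.ne']
    · intro u hu
      have h1 : HasDerivAt (fun u => θ (u + h)) (k (u + h)) u :=
        HasDerivAt.comp_add_const u h (hd (u + h))
      convert! (hrp u hu).mul h1 using 1
      ring
    · refine Integrable.add (f := fun u => k (u + h) * u ^ a) ?_ (hI2.const_mul a)
      simpa only [mul_comm] using hI1.integrable
  have p2 : ∫ u in Set.Ioi h, (k (u - h) * u ^ a + a * (u ^ (a - 1) * θ (u - h))) =
      -(h ^ a * θ 0) := by
    have hD := (hθ.comp_add (-h)).mul_of_growth hrc hgr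
    have hI1 := ((hk.comp_add (-h)).mul_of_growth hrc hgr).integrableOn
    have hI2 := (hθ.comp_add (-h)).integrableOn_rpow_mul ha1
    have hsub : Set.Ioi h ⊆ Set.Ioi 0 := Set.Ioi_subset_Ioi hh
    simp only [← sub_eq_add_neg] at hD hI1 hI2
    rw [integral_Ioi_of_hasDerivAt_of_tendsto (f := fun u => u ^ a * θ (u - h)) (m := 0)
      hD.continuous.continuousWithinAt _ _ hD.tendsto_zero]
    · simp
    · intro u hu
      have h1 : HasDerivAt (fun u => θ (u - h)) (k (u - h)) u :=
        HasDerivAt.comp_sub_const u h (hd (u - h))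
      convert! (hrp u (hh.trans_lt hu)).mul h1 using 1
      ring
    · refine Integrable.add (f := fun u => k (u - h) * u ^ a) ?_
        ((hI2.mono_set hsub).const_mul a)
      simpa only [mul_comm] using (hI1.mono_set hsub).integrable
  have hθc := hθ.continuous
  have hkc := hk.continuous
  have iI : IntervalIntegrable (fun u : ℝ => u ^ (a - 1) * θ (h - u)) volume 0 h :=
    (intervalIntegral.intervalIntegrable_rpow' ha1).mul_continuousOn (by fun_prop)
  have iK : IntervalIntegrable (fun u : ℝ => k (h - u) * u ^ a) volume 0 h :=
    Continuous.intervalIntegrable (by fun_prop) _ _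
  have p3 : ∫ u in (0 : ℝ)..h, (k (h - u) * u ^ a - a * (u ^ (a - 1) * θ (h - u))) =
      -(h ^ a * θ 0) := by
    rw [intervalIntegral.integral_eq_sub_of_hasDerivAt_of_le hh
      (f := fun u => -(u ^ a * θ (h - u))) (by fun_prop)]
    · simp [Real.zero_rpow ha0.ne']
    · intro u hu
      have h1 : HasDerivAt (fun u => θ (h - u)) (-k (h - u)) u :=
        HasDerivAt.comp_const_sub h u (hd (h - u))
      convert! ((hrp u hu.1).mul h1).neg using 1
      ring
    · exact iK.sub (iI.const_mul a)
  have q1 : IntegrableOn (fun w => k w * |h - w| ^ a) (Set.Ioi 0) := by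
    simpa only [mul_comm, Function.comp_apply] using (hk.mul_of_growth
      (hφ.comp (by fun_prop : Continuous fun w => h - w))
      fun t _ => (abs_of_nonneg (Real.rpow_nonneg (abs_nonneg (h - t)) a)).trans_le
        (abs_sub_rpow_le ha0.le ha h t)).integrableOn
  have q2 : IntegrableOn (fun w => k w * |h + w| ^ a) (Set.Ioi 0) := by
    simpa only [mul_comm, Function.comp_apply] using (hk.mul_of_growth
      (hφ.comp (by fun_prop : Continuous fun w => h + w))
      fun t _ => (abs_of_nonneg (Real.rpow_nonneg (abs_nonneg (h + t)) a)).trans_le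
        (abs_add_rpow_le ha0.le ha h t)).integrableOn
  have r1 : ∫ w in Set.Ioi (0 : ℝ), k w * |h - w| ^ a =
      (∫ u in (0 : ℝ)..h, k (h - u) * u ^ a) + ∫ u in Set.Ioi (0 : ℝ), k (u + h) * u ^ a := by
    rw [← Set.Ioc_union_Ioi_eq_Ioi hh, setIntegral_union Set.Ioc_disjoint_Ioi_same measurableSet_Ioi
      (q1.mono_set Set.Ioc_subset_Ioi_self) (q1.mono_set (Set.Ioi_subset_Ioi hh))]
    congr 1
    · rw [← intervalIntegral.integral_of_le hh]
      have := intervalIntegral.integral_comp_sub_left (a := 0) (b := h)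
        (fun w => k w * |h - w| ^ a) h
      simp only [sub_self, sub_zero] at this
      rw [← this]
      refine intervalIntegral.integral_congr fun u hu => ?_
      rw [Set.uIcc_of_le hh] at hu
      simp [abs_of_nonneg hu.1]
    · have := setIntegral_Ioi_comp_add (fun w => k w * |h - w| ^ a) 0 h
      rw [zero_add] at this
      rw [Set.Ioc_union_Ioi_eq_Ioi hh, ← this]
      refine setIntegral_congr_fun measurableSet_Ioi fun u hu => ?_
      have hu' : (0 : ℝ) < u := hu
      simp [abs_of_pos hu']
  have r2 : ∫ w in Set.Ioi (0 : ℝ), k w * |h + w| ^ a = ∫ u in Set.Ioi h, k (u - h) * u ^ a := by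
    have := setIntegral_Ioi_comp_add (fun w => k (w - h) * w ^ a) 0 h
    rw [zero_add] at this
    rw [← this]
    refine setIntegral_congr_fun measurableSet_Ioi fun u hu => ?_
    have hu' : (0 : ℝ) < u := hu
    rw [abs_of_pos (by positivity)]
    simp [add_comm]
  have hI1 : IntegrableOn (fun u => k (u + h) * u ^ a) (Set.Ioi 0) := by
    simpa only [mul_comm] using ((hk.comp_add h).mul_of_growth hrc hgr).integrableOn
  have hI2 : IntegrableOn (fun u => k (u - h) * u ^ a) (Set.Ioi h) := by
    have := ((hk.comp_add (-h)).mul_of_growth hrc hgr).integrableOn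
    simpa only [mul_comm, ← sub_eq_add_neg] using this.mono_set (Set.Ioi_subset_Ioi hh)
  have hJ1 := (hθ.comp_add h).integrableOn_rpow_mul ha1
  have hJ2 : IntegrableOn (fun u => u ^ (a - 1) * θ (u - h)) (Set.Ioi h) := by
    have := (hθ.comp_add (-h)).integrableOn_rpow_mul ha1
    simpa only [← sub_eq_add_neg] using this.mono_set (Set.Ioi_subset_Ioi hh)
  rw [integral_add hI1 (hJ1.const_mul a), integral_const_mul] at p1
  rw [integral_add hI2 (hJ2.const_mul a), integral_const_mul] at p2
  rw [intervalIntegral.integral_sub iK (iI.const_mul a), intervalIntegral.integral_const_mul] at p3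
  have e : ∀ w, k w * secondDiff a h w =
      k w * |h - w| ^ a + k w * |h + w| ^ a - 2 * |h| ^ a * k w := by
    intro w; unfold secondDiff; ring
  simp only [kernelCov, e]
  have q12 : IntegrableOn (fun w => k w * |h - w| ^ a + k w * |h + w| ^ a) (Set.Ioi 0) :=
    q1.add q2
  rw [integral_sub q12 (hk.integrableOn.const_mul _), integral_add q1 q2,
    integral_const_mul, hθ.integral_deriv hk hd, r1, r2, abs_of_nonneg hh,
    ← intervalIntegral.integral_of_le hh]
  linear_combination 1 / 2 * p1 + 1 / 2 * p2 + 1 / 2 * p3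

/-- The symmetric second difference quotient of `x ^ a` at `1`. -/
lemma tendsto_secondDiff_quotient (a : ℝ) :
    Tendsto (fun x : ℝ => ((1 - x) ^ a + (1 + x) ^ a - 2) / x ^ 2) (𝓝[>] 0) (𝓝 (a * (a - 1))) := by
  have hm : Set.Ioo (0 : ℝ) 1 ∈ 𝓝[>] (0 : ℝ) := Ioo_mem_nhdsGT one_pos
  have hp : ∀ (b x : ℝ), x ∈ Set.Ioo (-1 : ℝ) 1 →
      HasDerivAt (fun x : ℝ => (1 + x) ^ b) (b * (1 + x) ^ (b - 1)) x := by
    intro b x hx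
    have h1 : HasDerivAt (fun x : ℝ => 1 + x) 1 x := (hasDerivAt_id x).const_add 1
    simpa using h1.rpow_const (p := b) (Or.inl (by linarith [hx.1]))
  have hn : ∀ (b x : ℝ), x ∈ Set.Ioo (-1 : ℝ) 1 →
      HasDerivAt (fun x : ℝ => (1 - x) ^ b) (-(b * (1 - x) ^ (b - 1))) x := by
    intro b x hx
    have h1 : HasDerivAt (fun x : ℝ => 1 - x) (-1) x := (hasDerivAt_id x).const_sub 1
    simpa using h1.rpow_const (p := b) (Or.inl (by linarith [hx.2]))
  have hsub : Set.Ioo (0 : ℝ) 1 ⊆ Set.Ioo (-1) 1 := Set.Ioo_subset_Ioo_left (by norm_num)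
  have h0 : (0 : ℝ) ∈ Set.Ioo (-1 : ℝ) 1 := by norm_num
  refine HasDerivAt.lhopital_zero_nhdsGT
    (f' := fun x => -(a * (1 - x) ^ (a - 1)) + a * (1 + x) ^ (a - 1)) (g' := fun x => 2 * x)
    ?_ ?_ ?_ ?_ ?_ ?_
  · filter_upwards [hm] with x hx
    exact ((hn a x (hsub hx)).add (hp a x (hsub hx))).sub_const 2
  · filter_upwards with x
    simpa using hasDerivAt_pow 2 x
  · filter_upwards [hm] with x hx
    have := hx.1
    positivity
  · have h1 : ContinuousAt (fun x : ℝ => (1 - x) ^ a + (1 + x) ^ a - 2) 0 :=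
      (((hn a 0 h0).add (hp a 0 h0)).sub_const 2).continuousAt
    have h2 := h1.tendsto
    norm_num at h2
    exact h2.mono_left nhdsWithin_le_nhds
  · have h1 : Tendsto (fun x : ℝ => x ^ 2) (𝓝 0) (𝓝 (0 ^ 2)) := (continuous_pow 2).tendsto 0
    norm_num at h1
    exact h1.mono_left nhdsWithin_le_nhds
  · have hd : HasDerivAt (fun x : ℝ => -(a * (1 - x) ^ (a - 1)) + a * (1 + x) ^ (a - 1))
        (2 * (a * (a - 1))) 0 := by
      convert! ((hn (a - 1) 0 h0).const_mul a).neg.add ((hp (a - 1) 0 h0).const_mul a) using 1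
      simp
      ring
    have h1 := hd.tendsto_slope_zero_right
    simp only [zero_add, sub_zero, add_zero, Real.one_rpow, mul_one, neg_add_cancel,
      smul_eq_mul] at h1
    have h2 := h1.const_mul (1 / 2)
    have e : 1 / 2 * (2 * (a * (a - 1))) = a * (a - 1) := by ring
    rw [e] at h2
    refine h2.congr' ?_
    filter_upwards [hm] with x hx
    have := hx.1.ne'
    field_simp

lemma exists_le_sq_of_tendsto {f : ℝ → ℝ} {L D : ℝ}
    (hf : Tendsto (fun x => f x / x ^ 2) (𝓝[>] 0) (𝓝 L))
    (hD : ∀ x, 0 < x → |f x| ≤ D * (1 + x) ^ 2) :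
    ∃ C, 0 ≤ C ∧ ∀ x, 0 < x → |f x| ≤ C * x ^ 2 := by
  have h1 : ∀ᶠ x in 𝓝[>] (0 : ℝ), |f x / x ^ 2| ≤ |L| + 1 := by
    have := hf.abs.eventually (gt_mem_nhds (lt_add_one |L|))
    filter_upwards [this] with x hx using hx.le
  obtain ⟨d, hd, hsub⟩ := mem_nhdsGT_iff_exists_Ioc_subset.1 h1
  have hd0 : (0 : ℝ) < d := hd
  have hD0 : 0 ≤ D := by
    have := (abs_nonneg _).trans (hD 1 one_pos)
    linarith
  refine ⟨|L| + 1 + D * (1 / d + 1) ^ 2, by positivity, fun x hx => ?_⟩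
  rcases le_total x d with hxd | hxd
  · have h2 : |f x / x ^ 2| ≤ |L| + 1 := hsub ⟨hx, hxd⟩
    rw [abs_div, abs_of_pos (by positivity : 0 < x ^ 2), div_le_iff₀ (by positivity)] at h2
    refine h2.trans ?_
    refine mul_le_mul_of_nonneg_right ?_ (by positivity)
    have : 0 ≤ D * (1 / d + 1) ^ 2 := by positivity
    linarith
  · have h2 : 1 + x ≤ (1 / d + 1) * x := by
      have : 1 ≤ 1 / d * x := by rw [div_mul_eq_mul_div, one_mul, le_div_iff₀ hd0]; linarith
      linarith
    calc |f x| ≤ D * (1 + x) ^ 2 := hD x hx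
      _ ≤ D * ((1 / d + 1) * x) ^ 2 := by gcongr
      _ = (0 + D * (1 / d + 1) ^ 2) * x ^ 2 := by ring
      _ ≤ _ := by gcongr; positivity

lemma secondDiff_eq_mul {a h : ℝ} (hh : 0 < h) (w : ℝ) :
    secondDiff a h w = h ^ a * secondDiff a 1 (w / h) := by
  have e : ∀ x : ℝ, |h * x| ^ a = h ^ a * |x| ^ a := by
    intro x; rw [abs_mul, abs_of_pos hh, Real.mul_rpow hh.le (abs_nonneg x)]
  have e1 : h - w = h * (1 - w / h) := by field_simp
  have e2 : h + w = h * (1 + w / h) := by field_simp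
  simp only [secondDiff]
  rw [e1, e2, e, e, abs_of_pos hh]
  simp
  ring

lemma tendsto_secondDiff_div (a : ℝ) :
    Tendsto (fun x : ℝ => secondDiff a 1 x / x ^ 2) (𝓝[>] 0) (𝓝 (a * (a - 1))) := by
  refine (tendsto_secondDiff_quotient a).congr' ?_
  filter_upwards [Ioo_mem_nhdsGT one_pos] with x hx
  have h1 : 0 < 1 - x := by linarith [hx.2]
  have h2 : 0 < 1 + x := by linarith [hx.1]
  simp [secondDiff, abs_of_pos h1, abs_of_pos h2]

lemma exists_secondDiff_le {a : ℝ} (ha0 : 0 < a) (ha : a ≤ 2) :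
    ∃ C, 0 ≤ C ∧ ∀ x, 0 < x → |secondDiff a 1 x| ≤ C * x ^ 2 := by
  refine exists_le_sq_of_tendsto (tendsto_secondDiff_div a) (D := 16) fun x hx => ?_
  have := abs_secondDiff_le ha0.le ha 1 x
  rw [abs_of_pos hx] at this
  norm_num at this
  exact this

section Asymptotics

variable {a : ℝ} {k : ℝ → ℝ}

lemma rpow_two_sub_mul {a h : ℝ} (hh : 0 < h) : h ^ (2 - a) * h ^ a = h ^ 2 := by
  rw [← Real.rpow_add hh]
  norm_num

lemma tendsto_kernelCov (ha0 : 0 < a) (ha : a ≤ 2) (hk : ExpDecay k) :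
    Tendsto (fun h => h ^ (2 - a) * kernelCov a k h) atTop
      (𝓝 (1 / 2 * (a * (a - 1)) * ∫ w in Set.Ioi (0 : ℝ), w ^ 2 * k w)) := by
  obtain ⟨C, hC0, hC⟩ := exists_secondDiff_le ha0 ha
  have key : Tendsto (fun h => ∫ w in Set.Ioi (0 : ℝ), k w * (h ^ 2 * secondDiff a 1 (w / h))) atTop
      (𝓝 (∫ w in Set.Ioi (0 : ℝ), a * (a - 1) * (w ^ 2 * k w))) := by
    have hkc := hk.continuous
    refine tendsto_integral_filter_of_dominated_convergence (fun w => C * |w ^ 2 * k w|) ?_ ?_ ?_ ?_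
    · filter_upwards with h
      have hs : Continuous fun w => secondDiff a 1 (w / h) :=
        (continuous_secondDiff ha0).comp (by fun_prop : Continuous fun w : ℝ => ((1 : ℝ), w / h))
      exact Continuous.aestronglyMeasurable (by fun_prop)
    · filter_upwards [eventually_gt_atTop 0] with h hh
      filter_upwards [ae_restrict_mem measurableSet_Ioi] with w hw
      have hw' : (0 : ℝ) < w := hw
      rw [Real.norm_eq_abs, abs_mul, abs_mul, abs_mul, abs_of_pos (by positivity : 0 < h ^ 2),
        abs_of_pos (by positivity : 0 < w ^ 2)]
      calc |k w| * (h ^ 2 * |secondDiff a 1 (w / h)|)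
          ≤ |k w| * (h ^ 2 * (C * (w / h) ^ 2)) := by gcongr; exact hC _ (by positivity)
        _ = _ := by field_simp
    · exact ((hk.pow_mul 2).integrableOn.abs).const_mul C
    · filter_upwards [ae_restrict_mem measurableSet_Ioi] with w hw
      have hw' : (0 : ℝ) < w := hw
      have h1 : Tendsto (fun h : ℝ => w / h) atTop (𝓝[>] 0) := by
        rw [tendsto_nhdsWithin_iff]
        refine ⟨tendsto_const_nhds.div_atTop tendsto_id, ?_⟩
        filter_upwards [eventually_gt_atTop 0] with h hh
        exact div_pos hw' hh
      have h2 := ((tendsto_secondDiff_div a).comp h1).mul_const (w ^ 2 * k w)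
      refine h2.congr' ?_
      filter_upwards [eventually_gt_atTop 0] with h hh
      simp only [Function.comp_apply]
      field_simp
  rw [integral_const_mul] at key
  have h3 := key.const_mul (1 / 2)
  rw [← mul_assoc] at h3
  refine h3.congr' ?_
  filter_upwards [eventually_gt_atTop 0] with h hh
  rw [kernelCov, mul_left_comm (h ^ (2 - a)), ← integral_const_mul (h ^ (2 - a))]
  congr 2
  funext w
  rw [secondDiff_eq_mul hh, ← rpow_two_sub_mul (a := a) hh]
  ring

lemma aestronglyMeasurable_kernelCov (ha0 : 0 < a) (hk : ExpDecay k) (μ : Measure ℝ) :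
    AEStronglyMeasurable (kernelCov a k) μ := by
  have hc : Continuous fun z : ℝ × ℝ => k z.2 * secondDiff a z.1 z.2 :=
    (hk.continuous.comp continuous_snd).mul (continuous_secondDiff ha0)
  have h1 : StronglyMeasurable fun h => ∫ w in Set.Ioi (0 : ℝ), k w * secondDiff a h w :=
    hc.stronglyMeasurable.integral_prod_right
  exact (h1.const_mul (1 / 2)).aestronglyMeasurable

lemma exists_kernelCov_le (ha0 : 0 < a) (ha : a ≤ 2) (hk : ExpDecay k) :
    ∃ C, ∀ h, |kernelCov a k h| ≤ C * (1 + |h|) ^ 2 := by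
  refine ⟨2 * ∫ w in Set.Ioi (0 : ℝ), |(1 + |w|) ^ 2 * k w|, fun h => ?_⟩
  have hb : |∫ w in Set.Ioi (0 : ℝ), k w * secondDiff a h w| ≤
      ∫ w in Set.Ioi (0 : ℝ), 4 * (1 + |h|) ^ 2 * |(1 + |w|) ^ 2 * k w| := by
    rw [← Real.norm_eq_abs]
    refine norm_integral_le_of_norm_le
      ((hk.one_add_abs_pow_mul 2).integrableOn.abs.const_mul _) ?_
    filter_upwards with w
    rw [Real.norm_eq_abs, abs_mul, abs_mul, abs_of_nonneg (by positivity : 0 ≤ (1 + |w|) ^ 2)]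
    calc |k w| * |secondDiff a h w| ≤ |k w| * (4 * (1 + |h|) ^ 2 * (1 + |w|) ^ 2) := by
          gcongr; exact abs_secondDiff_le ha0.le ha h w
      _ = _ := by ring
  rw [integral_const_mul] at hb
  rw [kernelCov, abs_mul, abs_of_pos (by norm_num : (0 : ℝ) < 1 / 2)]
  linarith

lemma integrableOn_kernelCov_Ioc (ha0 : 0 < a) (ha : a ≤ 2) (hk : ExpDecay k) (T : ℝ) :
    IntegrableOn (kernelCov a k) (Set.Ioc 0 T) := by
  obtain ⟨C, hC⟩ := exists_kernelCov_le ha0 ha hk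
  have h1 : IntegrableOn (fun h : ℝ => C * (1 + |h|) ^ 2) (Set.Ioc 0 T) :=
    (Continuous.integrableOn_Icc (by fun_prop)).mono_set Set.Ioc_subset_Icc_self
  exact h1.mono' (aestronglyMeasurable_kernelCov ha0 hk _) (ae_of_all _ hC)

lemma exists_kernelCov_le_rpow (ha0 : 0 < a) (ha : a ≤ 2) (hk : ExpDecay k) :
    ∃ C, ∀ h, 0 < h → |kernelCov a k h| ≤ C * h ^ (a - 2) := by
  obtain ⟨C, hC0, hC⟩ := exists_secondDiff_le ha0 ha
  refine ⟨1 / 2 * (C * ∫ w in Set.Ioi (0 : ℝ), |w ^ 2 * k w|), fun h hh => ?_⟩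
  have hb : |∫ w in Set.Ioi (0 : ℝ), k w * secondDiff a h w| ≤
      ∫ w in Set.Ioi (0 : ℝ), C * h ^ (a - 2) * |w ^ 2 * k w| := by
    rw [← Real.norm_eq_abs]
    refine norm_integral_le_of_norm_le ((hk.pow_mul 2).integrableOn.abs.const_mul _) ?_
    filter_upwards [ae_restrict_mem measurableSet_Ioi] with w hw
    have hw' : (0 : ℝ) < w := hw
    rw [Real.norm_eq_abs, abs_mul, abs_mul, abs_of_nonneg (by positivity : 0 ≤ w ^ 2),
      secondDiff_eq_mul hh, abs_mul, abs_of_pos (Real.rpow_pos_of_pos hh a)]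
    calc |k w| * (h ^ a * |secondDiff a 1 (w / h)|) ≤ |k w| * (h ^ a * (C * (w / h) ^ 2)) := by
          gcongr; exact hC _ (by positivity)
      _ = _ := by
        rw [Real.rpow_sub hh, Real.rpow_two]; field_simp
  rw [integral_const_mul] at hb
  rw [kernelCov, abs_mul, abs_of_pos (by norm_num : (0 : ℝ) < 1 / 2)]
  linarith

lemma integral_abs_rpow (ha0 : 0 < a) (y : ℝ) :
    ∫ x in (0 : ℝ)..y, |x| ^ a = y * |y| ^ a / (a + 1) := by
  have hpos : ∀ y : ℝ, 0 ≤ y → ∫ x in (0 : ℝ)..y, |x| ^ a = y * |y| ^ a / (a + 1) := by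
    intro y hy
    have e : ∫ x in (0 : ℝ)..y, |x| ^ a = ∫ x in (0 : ℝ)..y, x ^ a := by
      refine intervalIntegral.integral_congr fun x hx => ?_
      rw [Set.uIcc_of_le hy] at hx
      simp [abs_of_nonneg hx.1]
    rw [e, integral_rpow (Or.inl (by linarith)), Real.zero_rpow (by linarith), sub_zero,
      abs_of_nonneg hy, Real.rpow_add_one' hy (by linarith), mul_comm]
  rcases le_total 0 y with hy | hy
  · exact hpos y hy
  · have h1 := hpos (-y) (by linarith)
    have h2 := intervalIntegral.integral_comp_neg (a := 0) (b := -y) (fun x : ℝ => |x| ^ a)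
    simp only [abs_neg, neg_neg, neg_zero] at h1 h2
    rw [h2, intervalIntegral.integral_symm] at h1
    linear_combination -h1

lemma integral_secondDiff (ha0 : 0 < a) {T : ℝ} (hT : 0 < T) (w : ℝ) :
    ∫ h in (0 : ℝ)..T, secondDiff a h w = T ^ (a + 1) / (a + 1) *
      ((1 - w / T) * |1 - w / T| ^ a + (1 + w / T) * |1 + w / T| ^ a - 2) := by
  have hφ := continuous_abs_rpow ha0
  have hii : ∀ x y : ℝ, IntervalIntegrable (fun x : ℝ => |x| ^ a) volume x y := fun x y =>
    hφ.intervalIntegrable _ _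
  have e1 : ∫ h in (0 : ℝ)..T, |h - w| ^ a =
      (T - w) * |T - w| ^ a / (a + 1) + w * |w| ^ a / (a + 1) := by
    rw [intervalIntegral.integral_comp_sub_right (fun x => |x| ^ a) w,
      ← intervalIntegral.integral_interval_sub_left (hii 0 _) (hii 0 _), integral_abs_rpow ha0,
      integral_abs_rpow ha0, zero_sub, abs_neg]
    ring
  have e2 : ∫ h in (0 : ℝ)..T, |h + w| ^ a =
      (T + w) * |T + w| ^ a / (a + 1) - w * |w| ^ a / (a + 1) := by
    rw [intervalIntegral.integral_comp_add_right (fun x => |x| ^ a) w,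
      ← intervalIntegral.integral_interval_sub_left (hii 0 _) (hii 0 _), integral_abs_rpow ha0,
      integral_abs_rpow ha0, zero_add]
  have i1 : IntervalIntegrable (fun h : ℝ => |h - w| ^ a) volume 0 T :=
    (hφ.comp (by fun_prop : Continuous fun h : ℝ => h - w)).intervalIntegrable _ _
  have i2 : IntervalIntegrable (fun h : ℝ => |h + w| ^ a) volume 0 T :=
    (hφ.comp (by fun_prop : Continuous fun h : ℝ => h + w)).intervalIntegrable _ _
  unfold secondDiff
  rw [intervalIntegral.integral_sub (i1.add i2) ((hii 0 T).const_mul 2),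
    intervalIntegral.integral_add i1 i2, intervalIntegral.integral_const_mul, e1, e2,
    integral_abs_rpow ha0, abs_of_pos hT]
  have e : ∀ x : ℝ, |T * x| ^ a = T ^ a * |x| ^ a := by
    intro x; rw [abs_mul, abs_of_pos hT, Real.mul_rpow hT.le (abs_nonneg x)]
  have f1 : T - w = T * (1 - w / T) := by field_simp
  have f2 : T + w = T * (1 + w / T) := by field_simp
  rw [f1, f2, e, e, Real.rpow_add_one hT.ne']
  ring

/-- The integral of the covariance function tends to zero when `a < 1`. -/
lemma tendsto_integral_kernelCov (ha0 : 0 < a) (ha : a < 1) (hk : ExpDecay k) :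
    Tendsto (fun T => ∫ h in (0 : ℝ)..T, kernelCov a k h) atTop (𝓝 0) := by
  set s : ℝ → ℝ := fun x => (1 - x) * |1 - x| ^ a + (1 + x) * |1 + x| ^ a - 2 with hs
  obtain ⟨C, hC0, hC⟩ : ∃ C, 0 ≤ C ∧ ∀ x, 0 < x → |s x| ≤ C * x ^ 2 := by
    refine exists_le_sq_of_tendsto (L := (a + 1) * (a + 1 - 1)) (D := 4) ?_ fun x hx => ?_
    · refine (tendsto_secondDiff_quotient (a + 1)).congr' ?_
      filter_upwards [Ioo_mem_nhdsGT one_pos] with x hx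
      have h1 : 0 < 1 - x := by linarith [hx.2]
      have h2 : 0 < 1 + x := by linarith [hx.1]
      simp only [hs]
      rw [Real.rpow_add_one h1.ne', Real.rpow_add_one h2.ne', abs_of_pos h1, abs_of_pos h2]
      ring
    · have h3 : ∀ y : ℝ, |y| ≤ 1 + x → |y * |y| ^ a| ≤ (1 + x) ^ 2 := by
        intro y hy
        rw [abs_mul, abs_of_nonneg (by positivity : 0 ≤ |y| ^ a), sq]
        gcongr
        calc |y| ^ a ≤ (1 + x) ^ a := by gcongr
          _ ≤ (1 + x) ^ (1 : ℝ) := by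
            apply Real.rpow_le_rpow_of_exponent_le _ ha.le
            linarith
          _ = 1 + x := Real.rpow_one _
      have h4 := h3 (1 - x) (by rw [abs_le]; constructor <;> linarith)
      have h5 := h3 (1 + x) (by rw [abs_of_pos]; linarith)
      have h6 : 1 ≤ (1 + x) ^ 2 := one_le_pow₀ (by linarith)
      rw [abs_le] at h4 h5 ⊢
      simp only [hs]
      constructor <;> linarith
  set I := ∫ w in Set.Ioi (0 : ℝ), |w ^ 2 * k w| with hI
  have hbound : ∀ T, 0 < T → ‖∫ h in (0 : ℝ)..T, kernelCov a k h‖ ≤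
      (1 / 2 * (C / (a + 1) * I)) * T ^ (a - 1) := by
    intro T hT
    have hswap : ∫ h in (0 : ℝ)..T, ∫ w in Set.Ioi (0 : ℝ), k w * secondDiff a h w =
        ∫ w in Set.Ioi (0 : ℝ), ∫ h in (0 : ℝ)..T, k w * secondDiff a h w := by
      refine intervalIntegral_integral_swap ?_
      rw [Set.uIoc_of_le hT.le]
      have hb : Integrable (fun z : ℝ × ℝ => (4 * (1 + |z.1|) ^ 2) * ((1 + |z.2|) ^ 2 * k z.2))
          ((volume.restrict (Set.Ioc 0 T)).prod (volume.restrict (Set.Ioi 0))) := by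
        refine Integrable.mul_prod (f := fun h : ℝ => 4 * (1 + |h|) ^ 2)
          (g := fun w => (1 + |w|) ^ 2 * k w) ?_ (hk.one_add_abs_pow_mul 2).integrableOn
        exact (Continuous.integrableOn_Icc (by fun_prop)).mono_set Set.Ioc_subset_Icc_self
      refine hb.mono ?_ (ae_of_all _ fun z => ?_)
      · have hc : Continuous fun z : ℝ × ℝ => k z.2 * secondDiff a z.1 z.2 :=
          (hk.continuous.comp continuous_snd).mul (continuous_secondDiff ha0)
        exact hc.aestronglyMeasurable
      · simp only [Function.uncurry, norm_mul, Real.norm_eq_abs (secondDiff _ _ _)]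
        have := abs_secondDiff_le ha0.le (by linarith : a ≤ 2) z.1 z.2
        rw [← norm_mul, Real.norm_of_nonneg (by positivity : 0 ≤ 4 * (1 + |z.1|) ^ 2),
          Real.norm_of_nonneg (by positivity : 0 ≤ (1 + |z.2|) ^ 2)]
        calc ‖k z.2‖ * |secondDiff a z.1 z.2|
            ≤ ‖k z.2‖ * (4 * (1 + |z.1|) ^ 2 * (1 + |z.2|) ^ 2) := by gcongr
          _ = _ := by ring
    unfold kernelCov
    rw [intervalIntegral.integral_const_mul, hswap, norm_mul,
      Real.norm_of_nonneg (by norm_num : (0 : ℝ) ≤ 1 / 2), mul_assoc]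
    gcongr
    have e : C / (a + 1) * I * T ^ (a - 1) =
        ∫ w in Set.Ioi (0 : ℝ), C / (a + 1) * T ^ (a - 1) * |w ^ 2 * k w| := by
      rw [integral_const_mul]; ring
    rw [e]
    refine norm_integral_le_of_norm_le ((hk.pow_mul 2).integrableOn.abs.const_mul _) ?_
    filter_upwards [ae_restrict_mem measurableSet_Ioi] with w hw
    have hw' : (0 : ℝ) < w := hw
    have hTa := Real.rpow_pos_of_pos hT (a + 1)
    rw [intervalIntegral.integral_const_mul, integral_secondDiff ha0 hT, Real.norm_eq_abs, abs_mul,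
      abs_mul, abs_mul, abs_of_nonneg (by positivity : 0 ≤ w ^ 2),
      abs_of_nonneg (by positivity : 0 ≤ T ^ (a + 1) / (a + 1))]
    calc |k w| * (T ^ (a + 1) / (a + 1) * |s (w / T)|)
        ≤ |k w| * (T ^ (a + 1) / (a + 1) * (C * (w / T) ^ 2)) := by
          gcongr; exact hC _ (by positivity)
      _ = _ := by
        have : T ^ (a + 1) = T ^ (a - 1) * T ^ 2 := by
          rw [← Real.rpow_two, ← Real.rpow_add hT]; ring_nf
        rw [this]; field_simp
  have hlim : Tendsto (fun T : ℝ => (1 / 2 * (C / (a + 1) * I)) * T ^ (a - 1)) atTop (𝓝 0) := by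
    have := (tendsto_rpow_neg_atTop (y := 1 - a) (by linarith)).const_mul
      (1 / 2 * (C / (a + 1) * I))
    simpa using this
  refine squeeze_zero_norm' ?_ hlim
  filter_upwards [eventually_gt_atTop 0] with T hT using hbound T hT

/-- The sign of the covariance function at large lags. -/
lemma eventually_mul_kernelCov_pos (ha0 : 0 < a) (ha : a ≤ 2) (hk : ExpDecay k) {L : ℝ}
    (hL : 1 / 2 * (a * (a - 1)) * ∫ w in Set.Ioi (0 : ℝ), w ^ 2 * k w = L) (hL0 : 0 < L) :
    ∀ᶠ h in atTop, L / 2 * h ^ (a - 2) ≤ kernelCov a k h := by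
  have h1 := tendsto_kernelCov ha0 ha hk
  rw [hL] at h1
  filter_upwards [h1.eventually (lt_mem_nhds (half_lt_self hL0)), eventually_gt_atTop 0]
    with h hh hpos
  have h2 := Real.rpow_pos_of_pos hpos (a - 2)
  have h3 : h ^ (a - 2) * h ^ (2 - a) = 1 := by rw [← Real.rpow_add hpos]; simp
  calc L / 2 * h ^ (a - 2) ≤ h ^ (2 - a) * kernelCov a k h * h ^ (a - 2) := by gcongr
    _ = (h ^ (a - 2) * h ^ (2 - a)) * kernelCov a k h := by ring
    _ = _ := by rw [h3, one_mul]

lemma isAntipersistent_kernelCov (ha0 : 0 < a) (ha : a < 1) (hk : ExpDecay k)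
    (hpos : 0 < ∫ w in Set.Ioi (0 : ℝ), w ^ 2 * k w) : IsAntipersistent (kernelCov a k) := by
  have hinteg : IntegrableOn (kernelCov a k) (Set.Ioi 0) := by
    rw [← Set.Ioc_union_Ioi_eq_Ioi zero_le_one]
    refine (integrableOn_kernelCov_Ioc ha0 (by linarith) hk 1).union ?_
    obtain ⟨C, hC⟩ := exists_kernelCov_le_rpow ha0 (by linarith) hk
    have h1 : IntegrableOn (fun h : ℝ => C * h ^ (a - 2)) (Set.Ioi 1) :=
      (integrableOn_Ioi_rpow_of_lt (by linarith) one_pos).const_mul C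
    refine h1.mono' (aestronglyMeasurable_kernelCov ha0 hk _) ?_
    filter_upwards [ae_restrict_mem measurableSet_Ioi] with h hh
    exact hC h (one_pos.trans hh)
  refine ⟨hinteg, ?_, ?_⟩
  · exact tendsto_nhds_unique (intervalIntegral_tendsto_integral_Ioi 0 hinteg tendsto_id)
      (tendsto_integral_kernelCov ha0 ha hk)
  · have h1 := tendsto_kernelCov ha0 (by linarith) hk
    have h2 : 1 / 2 * (a * (a - 1)) * ∫ w in Set.Ioi (0 : ℝ), w ^ 2 * k w < 0 := by
      refine mul_neg_of_neg_of_pos ?_ hpos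
      nlinarith
    filter_upwards [h1.eventually (gt_mem_nhds h2), eventually_gt_atTop 0] with h hh hpos
    have := Real.rpow_pos_of_pos hpos (2 - a)
    exact neg_of_mul_neg_right hh this.le

lemma isLongMemory_kernelCov (ha1 : 1 < a) (ha : a ≤ 2) (hk : ExpDecay k)
    (hpos : 0 < ∫ w in Set.Ioi (0 : ℝ), w ^ 2 * k w) : IsLongMemory (kernelCov a k) := by
  have ha0 : 0 < a := by linarith
  set L := 1 / 2 * (a * (a - 1)) * ∫ w in Set.Ioi (0 : ℝ), w ^ 2 * k w with hL
  have hL0 : 0 < L := by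
    have : 0 < a - 1 := by linarith
    positivity
  have hev := eventually_mul_kernelCov_pos ha0 ha hk hL.symm hL0
  constructor
  · filter_upwards [hev, eventually_gt_atTop 0] with h hh hpos
    have := Real.rpow_pos_of_pos hpos (a - 2)
    exact lt_of_lt_of_le (by positivity) hh
  · obtain ⟨T₀, hT₀⟩ := eventually_atTop.1 (hev.and (eventually_ge_atTop 1))
    set T₁ := max T₀ 1 with hT₁
    have h1 : 1 ≤ T₁ := le_max_right _ _
    have hii : ∀ T, 0 ≤ T → IntervalIntegrable (kernelCov a k) volume 0 T := fun T hT =>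
      (intervalIntegrable_iff_integrableOn_Ioc_of_le hT).2
        (integrableOn_kernelCov_Ioc ha0 ha hk T)
    have hlow : ∀ T, T₁ ≤ T → (∫ h in (0 : ℝ)..T₁, kernelCov a k h) +
        L / 2 * (Real.log T - Real.log T₁) ≤ ∫ h in (0 : ℝ)..T, kernelCov a k h := by
      intro T hT
      have hi1 := hii T₁ (by linarith)
      have hi2 : IntervalIntegrable (kernelCov a k) volume T₁ T := hi1.symm.trans
        (hii T (by linarith))
      rw [← intervalIntegral.integral_add_adjacent_intervals hi1 hi2]
      gcongr
      have hlog : ∫ h in T₁..T, L / 2 * h⁻¹ = L / 2 * (Real.log T - Real.log T₁) := by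
        rw [intervalIntegral.integral_const_mul, integral_inv_of_pos (by linarith) (by linarith),
          Real.log_div (by linarith) (by linarith)]
      rw [← hlog]
      refine intervalIntegral.integral_mono_on hT ?_ hi2 fun h hh => ?_
      · refine IntervalIntegrable.const_mul ?_ _
        refine intervalIntegral.intervalIntegrable_inv (fun x hx => ?_) continuousOn_id
        rw [Set.uIcc_of_le hT] at hx
        exact ne_of_gt (by linarith [hx.1])
      · have h2 : 1 ≤ h := h1.trans hh.1
        refine le_trans ?_ (hT₀ h ((le_max_left _ _).trans hh.1)).1
        gcongr
        rw [← Real.rpow_neg_one]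
        exact Real.rpow_le_rpow_of_exponent_le h2 (by linarith)
    refine tendsto_atTop_mono' atTop
      ((eventually_ge_atTop T₁).mono fun T hT => hlow T hT) ?_
    refine tendsto_atTop_add_const_left _ _ (Tendsto.const_mul_atTop (by positivity) ?_)
    exact tendsto_atTop_add_const_right _ _ Real.tendsto_log_atTop

end Asymptotics

section MatrixIntegral

variable {p : ℕ}

lemma dotProduct_matIntegral_mulVec {F : ℝ → Matrix (Fin p) (Fin p) ℝ} {S : Set ℝ}
    (hF : MatIntegrableOn F S) (x y : Fin p → ℝ) :
    dotProduct x ((matIntegral F S).mulVec y) = ∫ u in S, dotProduct x ((F u).mulVec y) := by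
  have hi : ∀ i j, IntegrableOn (fun u => x i * (F u i j * y j)) S := fun i j =>
    ((hF i j).mul_const _).const_mul _
  simp only [dotProduct, Matrix.mulVec, Finset.mul_sum, matIntegral, Matrix.of_apply]
  rw [integral_finsetSum _ fun i _ => integrable_finsetSum _ fun j _ => hi i j]
  refine Finset.sum_congr rfl fun i _ => ?_
  rw [integral_finsetSum _ fun j _ => hi i j]
  refine Finset.sum_congr rfl fun j _ => ?_
  rw [integral_const_mul, integral_mul_const]

lemma dotProduct_mul_matIntegral_mul_mulVec {F : ℝ → Matrix (Fin p) (Fin p) ℝ} {S : Set ℝ}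
    (hF : MatIntegrableOn F S) (x y : Fin p → ℝ) (M N : Matrix (Fin p) (Fin p) ℝ) :
    dotProduct x ((M * matIntegral F S * N).mulVec y) =
      ∫ u in S, dotProduct x ((M * F u * N).mulVec y) := by
  simp only [← Matrix.mulVec_mulVec, Matrix.dotProduct_mulVec x M]
  exact dotProduct_matIntegral_mulVec hF _ _

end MatrixIntegral

section Kernel

variable {p : ℕ} {A : Matrix (Fin p) (Fin p) ℝ}

/-- Stability: all eigenvalues have negative real part. -/
def IsStable (A : Matrix (Fin p) (Fin p) ℝ) : Prop :=
  ∀ z ∈ spectrum ℂ (A.map Complex.ofReal), z.re < 0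

lemma IsStable.isUnit_det (hA : IsStable A) : IsUnit A.det := by
  have h0 : (0 : ℂ) ∉ spectrum ℂ (A.map Complex.ofReal) := fun h => by simpa using hA 0 h
  rw [spectrum.zero_notMem_iff, Matrix.isUnit_iff_isUnit_det, isUnit_iff_ne_zero] at h0
  rw [isUnit_iff_ne_zero]
  intro h
  apply h0
  have := (Complex.ofRealHom.map_det A).symm
  rw [h, map_zero] at this
  exact this

lemma vStarIntegrand_apply (A : Matrix (Fin p) (Fin p) ℝ) (σ u : ℝ) (i j : Fin p) :
    vStarIntegrand A σ u i j =
      σ ^ 2 * (expForm A (Pi.single i 1) (delta p) u * expForm A (Pi.single j 1) (delta p) u) := by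
  rw [vStarIntegrand, expA_transpose, Matrix.mul_vecMulVec, Matrix.vecMulVec_mul,
    Matrix.vecMul_transpose]
  simp [expForm, Matrix.vecMulVec_apply]

lemma matIntegrableOn_vStarIntegrand (hA : IsStable A) (σ : ℝ) :
    MatIntegrableOn (vStarIntegrand A σ) (Set.Ioi 0) := by
  intro i j
  simp only [vStarIntegrand_apply]
  exact (((expDecay_expForm hA _ _).mul (expDecay_expForm hA _ _)).const_mul _).integrableOn

lemma dotProduct_vStar_mulVec (hA : IsStable A) (σ : ℝ) (x y : Fin p → ℝ) :
    dotProduct x ((vStar A σ).mulVec y) =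
      σ ^ 2 * ∫ u in Set.Ioi (0 : ℝ), expForm A x (delta p) u * expForm A y (delta p) u := by
  rw [vStar, dotProduct_matIntegral_mulVec (matIntegrableOn_vStarIntegrand hA σ),
    ← integral_const_mul]
  congr 1
  funext u
  rw [vStarIntegrand, expA_transpose, Matrix.mul_vecMulVec, Matrix.vecMulVec_mul,
    Matrix.vecMul_transpose, Matrix.smul_mulVec, Matrix.vecMulVec_mulVec, dotProduct_smul,
    dotProduct_smul, expForm, expForm, dotProduct_comm y]
  simp only [smul_eq_mul, MulOpposite.smul_eq_mul_unop, MulOpposite.unop_op]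

/-- The kernel `b' e^{Aw} M V* b` as a correlation integral, for `M` commuting with `A`. -/
lemma expForm_mul_vStar (hA : IsStable A) (σ : ℝ) (b : Fin p → ℝ)
    {M : Matrix (Fin p) (Fin p) ℝ} (hM : ∀ t, M * expA A t = expA A t * M) (w : ℝ) :
    expForm A b (M.mulVec ((vStar A σ).mulVec b)) w =
      σ ^ 2 * ∫ u in Set.Ioi (0 : ℝ),
        expForm A b (M.mulVec (delta p)) (u + w) * expForm A b (delta p) u := by
  rw [expForm, Matrix.mulVec_mulVec, Matrix.dotProduct_mulVec, dotProduct_vStar_mulVec hA]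
  congr 2
  funext u
  congr 1
  rw [add_comm u w, expForm, expForm, expA_add, Matrix.dotProduct_mulVec, Matrix.dotProduct_mulVec,
    Matrix.vecMul_vecMul, mul_assoc, hM, Matrix.dotProduct_mulVec, Matrix.vecMul_vecMul, mul_assoc]

/-- The second derivative of the kernel `b' e^{Aw} V* b`. -/
noncomputable def kernelDeriv2 (A : Matrix (Fin p) (Fin p) ℝ) (σ : ℝ) (b : Fin p → ℝ) : ℝ → ℝ :=
  expForm A b (A.mulVec (A.mulVec ((vStar A σ).mulVec b)))

lemma expDecay_kernelDeriv2 (hA : IsStable A) (σ : ℝ) (b : Fin p → ℝ) :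
    ExpDecay (kernelDeriv2 A σ b) :=
  expDecay_expForm hA _ _

lemma integral_expForm_mul_deriv (hA : IsStable A) (b x : Fin p → ℝ) :
    ∫ u in Set.Ioi (0 : ℝ), expForm A b x u * expForm A b (A.mulVec x) u =
      -(dotProduct b x ^ 2 / 2) := by
  have h0 := expDecay_expForm hA b x
  have h1 := expDecay_expForm hA b (A.mulVec x)
  rw [((h0.mul h0).const_mul (1 / 2)).integral_deriv (h0.mul h1), expForm_zero]
  · ring
  · intro t
    have hd := hasDerivAt_expForm A b x t
    convert! (hd.mul hd).const_mul (1 / 2) using 1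
    ring

/-- The covariance integral over the quadrant for the moving average kernel. -/
lemma integral_quadrant_expForm (hA : IsStable A) (σ : ℝ) (b : Fin p → ℝ) {a : ℝ}
    (ha0 : 0 < a) (ha : a ≤ 2) (h : ℝ) :
    ∫ z, σ * expForm A b (A.mulVec (delta p)) z.1 * (σ * expForm A b (A.mulVec (delta p)) z.2) *
        (1 / 2 * (|h - z.1| ^ a + |h + z.2| ^ a - |h - z.1 + z.2| ^ a - |h| ^ a))
          ∂(halfLine.prod halfLine) = kernelCov a (kernelDeriv2 A σ b) h := by
  have hk := expDecay_kernelDeriv2 hA σ b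
  have h0 := expDecay_expForm hA b (delta p)
  have h1 := expDecay_expForm hA b (A.mulVec (delta p))
  have h2 := expDecay_expForm hA b (A.mulVec (A.mulVec (delta p)))
  have hc : ∀ t, A * expA A t = expA A t * A := fun t => (expA_commute A t).symm
  refine integral_quadrant_eq_kernelCov ha0 ha
    (g := fun u => σ * expForm A b (A.mulVec (delta p)) u)
    (c := σ * dotProduct b (delta p)) (h1.const_mul σ) hk ?_ ?_ ?_ h
  · rw [integral_const_mul, h0.integral_deriv h1 (hasDerivAt_expForm A b _), expForm_zero]
    ring
  · have e := expForm_mul_vStar hA σ b hc 0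
    have hθ := expDecay_expForm hA b (A.mulVec ((vStar A σ).mulVec b))
    simp only [add_zero, mul_comm (expForm A b (A.mulVec (delta p)) _)] at e
    rw [integral_expForm_mul_deriv hA b (delta p)] at e
    rw [hθ.integral_deriv hk (hasDerivAt_expForm A b _), e]
    ring
  · intro w hw
    have hcc : ∀ t, A * A * expA A t = expA A t * (A * A) := fun t => by
      rw [mul_assoc, hc, ← mul_assoc, hc, mul_assoc]
    have e := expForm_mul_vStar hA σ b hcc w
    simp only [← Matrix.mulVec_mulVec] at e
    have hparts : ∫ u in Set.Ioi (0 : ℝ),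
        (expForm A b (A.mulVec (A.mulVec (delta p))) (u + w) * expForm A b (delta p) u +
          expForm A b (A.mulVec (delta p)) u * expForm A b (A.mulVec (delta p)) (u + w)) =
        -(expForm A b (A.mulVec (delta p)) w * dotProduct b (delta p)) := by
      have hi : IntegrableOn (fun u =>
          (expForm A b (A.mulVec (A.mulVec (delta p))) (u + w) * expForm A b (delta p) u +
          expForm A b (A.mulVec (delta p)) u * expForm A b (A.mulVec (delta p)) (u + w)))
          (Set.Ioi 0) :=
        (((h2.comp_add w).mul h0).integrableOn).add ((h1.mul (h1.comp_add w)).integrableOn)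
      rw [integral_Ioi_of_hasDerivAt_of_tendsto' (m := 0)
        (f := fun u => expForm A b (A.mulVec (delta p)) (u + w) * expForm A b (delta p) u)
        (fun u _ => ?_) hi ((h1.comp_add w).mul h0).tendsto_zero]
      · simp [expForm_zero]
      · have d1 : HasDerivAt (fun u => expForm A b (A.mulVec (delta p)) (u + w))
            (expForm A b (A.mulVec (A.mulVec (delta p))) (u + w)) u :=
          HasDerivAt.comp_add_const u w (hasDerivAt_expForm A b _ _)
        convert! d1.mul (hasDerivAt_expForm A b (delta p) u) using 1
        ring
    rw [integral_add ((h2.comp_add w).mul h0).integrableOn (h1.mul (h1.comp_add w)).integrableOn]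
      at hparts
    have e3 : ∫ v in Set.Ioi (0 : ℝ), σ * expForm A b (A.mulVec (delta p)) v *
        (σ * expForm A b (A.mulVec (delta p)) (v + w)) = σ ^ 2 * ∫ v in Set.Ioi (0 : ℝ),
          expForm A b (A.mulVec (delta p)) v * expForm A b (A.mulVec (delta p)) (v + w) := by
      rw [← integral_const_mul]
      congr 1; funext v; ring
    rw [e3, kernelDeriv2, e]
    linear_combination σ ^ 2 * hparts

/-- The second moment of the second derivative of the kernel. -/
lemma integral_sq_mul_kernelDeriv2 (hA : IsStable A) (σ : ℝ) (b : Fin p → ℝ) :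
    ∫ w in Set.Ioi (0 : ℝ), w ^ 2 * kernelDeriv2 A σ b w =
      σ ^ 2 * dotProduct b (A⁻¹.mulVec (delta p)) ^ 2 := by
  have hu := hA.isUnit_det
  set y := (vStar A σ).mulVec b with hy
  have hAy : A.mulVec (A⁻¹.mulVec y) = y := by
    rw [Matrix.mulVec_mulVec, Matrix.mul_nonsing_inv A hu, Matrix.one_mulVec]
  have hAd : A.mulVec (A⁻¹.mulVec (delta p)) = delta p := by
    rw [Matrix.mulVec_mulVec, Matrix.mul_nonsing_inv A hu, Matrix.one_mulVec]
  have dθ := hasDerivAt_expForm A b (A.mulVec y)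
  have dκ := hasDerivAt_expForm A b y
  have dK := hasDerivAt_expForm A b (A⁻¹.mulVec y)
  simp only [hAy] at dK
  have hK := expDecay_expForm hA b (A⁻¹.mulVec y)
  have hκ := expDecay_expForm hA b y
  have hθ := expDecay_expForm hA b (A.mulVec y)
  have hcomm : ∀ t, A⁻¹ * expA A t = expA A t * A⁻¹ := by
    intro t
    have h1 : A⁻¹ * (expA A t * A) * A⁻¹ = A⁻¹ * (A * expA A t) * A⁻¹ := by rw [expA_commute]
    rw [mul_assoc, mul_assoc, Matrix.mul_nonsing_inv A hu, mul_one, ← mul_assoc A⁻¹,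
      Matrix.nonsing_inv_mul A hu, one_mul] at h1
    exact h1
  have hlim : Tendsto (fun w => w ^ 2 * expForm A b (A.mulVec y) w - 2 * (w ^ 1 * expForm A b y w) +
      2 * expForm A b (A⁻¹.mulVec y) w) atTop (𝓝 (0 - 2 * 0 + 2 * 0)) :=
    (((hθ.pow_mul 2).tendsto_zero).sub ((hκ.pow_mul 1).tendsto_zero.const_mul 2)).add
      (hK.tendsto_zero.const_mul 2)
  have e := expForm_mul_vStar hA σ b hcomm 0
  have hG := integral_expForm_mul_deriv hA b (A⁻¹.mulVec (delta p))
  rw [hAd] at hG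
  simp only [add_zero, ← hy] at e
  rw [hG] at e
  rw [integral_Ioi_of_hasDerivAt_of_tendsto' (fun w _ => ?_)
    ((expDecay_kernelDeriv2 hA σ b).pow_mul 2).integrableOn hlim]
  · simp only [e]
    ring
  · have hw2 : HasDerivAt (fun w : ℝ => w ^ 2) (2 * w) w := by simpa using hasDerivAt_pow 2 w
    have hw1 : HasDerivAt (fun w : ℝ => w ^ 1) 1 w := by simpa using hasDerivAt_pow 1 w
    convert! ((hw2.mul (dθ w)).sub ((hw1.mul (dκ w)).const_mul 2)).add ((dK w).const_mul 2) using 1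
    rw [kernelDeriv2, ← hy]
    ring

lemma matIntegrableOn_rpow_smul_expA_neg {s : ℝ} (hs : -1 < s) (h : ℝ) :
    MatIntegrableOn (fun u => u ^ s • expA A (-u)) (Set.Ioc 0 h) := by
  intro i j
  rcases le_total 0 h with hh | hh
  · have hc : Continuous fun u => expA A (-u) i j := by
      have := continuous_expForm A (Pi.single i 1) (Pi.single j 1)
      have h2 : expForm A (Pi.single i 1) (Pi.single j 1) = fun t => expA A t i j := by
        funext t; exact expForm_single A i j t
      rw [h2] at this
      exact this.comp continuous_neg
    have := (intervalIntegral.intervalIntegrable_rpow' (a := 0) (b := h) hs).mul_continuousOn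
      hc.continuousOn
    rw [intervalIntegrable_iff_integrableOn_Ioc_of_le hh] at this
    exact this
  · rw [Set.Ioc_eq_empty (not_lt.2 hh)]
    exact integrableOn_empty

lemma matIntegrableOn_rpow_smul_expA (hA : IsStable A) {s : ℝ} (hs : -1 < s) :
    MatIntegrableOn (fun u => u ^ s • expA A u) (Set.Ioi 0) := by
  intro i j
  have := (expDecay_expForm hA (Pi.single i 1) (Pi.single j 1)).integrableOn_rpow_mul hs
  simp only [expForm_single] at this
  exact this

/-- The covariance function in terms of matrix integrals. -/
lemma kernelCov_eq_matIntegral (hA : IsStable A) (σ : ℝ) (b : Fin p → ℝ)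
    {H : ℝ} (hH0 : 0 < H) (hH1 : H < 1) {h : ℝ} (hh : 0 ≤ h) :
    kernelCov (2 * H) (kernelDeriv2 A σ b) h =
      H * dotProduct b ((A * expA A h *
        matIntegral (fun u => u ^ (2 * H - 1) • expA A (-u)) (Set.Ioc 0 h) *
        vStar A σ).mulVec b)
      - H * dotProduct b ((A * expA A (-h) *
        matIntegral (fun u => u ^ (2 * H - 1) • expA A u) (Set.Ioi h) * vStar A σ).mulVec b)
      - H * dotProduct b ((A * expA A h *
        matIntegral (fun u => u ^ (2 * H - 1) • expA A u) (Set.Ioi 0) *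
        vStar A σ).mulVec b) := by
  have hs : -1 < 2 * H - 1 := by linarith
  have e : ∀ c s t : ℝ, dotProduct b ((A * expA A s * (c • expA A t) * vStar A σ).mulVec b) =
      c * expForm A b (A.mulVec ((vStar A σ).mulVec b)) (s + t) := by
    intro c s t
    rw [expForm, Matrix.mulVec_mulVec, Matrix.mulVec_mulVec, Matrix.mul_smul, Matrix.smul_mul,
      Matrix.smul_mulVec, dotProduct_smul, mul_assoc A, ← expA_add, ← expA_commute, smul_eq_mul]
  have hi := matIntegrableOn_rpow_smul_expA hA hs
  have hi2 : MatIntegrableOn (fun u => u ^ (2 * H - 1) • expA A u) (Set.Ioi h) := fun i j =>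
    (hi i j).mono_set (Set.Ioi_subset_Ioi hh)
  rw [kernelCov_eq_sub_sub (by linarith) (by linarith) (expDecay_kernelDeriv2 hA σ b)
    (expDecay_expForm hA b (A.mulVec ((vStar A σ).mulVec b))) (hasDerivAt_expForm A b _) hh,
    dotProduct_mul_matIntegral_mul_mulVec (matIntegrableOn_rpow_smul_expA_neg hs h),
    dotProduct_mul_matIntegral_mul_mulVec hi, dotProduct_mul_matIntegral_mul_mulVec hi2]
  simp only [e, mul_div_cancel_left₀ H (two_ne_zero' ℝ), sub_eq_add_neg, add_comm h, add_comm (-h)]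

end Kernel

section PathIntegrals

variable {Ω : Type*} [MeasurableSpace Ω] {P : Measure Ω}

/-- A process on `[0, ∞)` with almost surely continuous paths has a modification that is jointly
measurable and continuous everywhere, with indistinguishable paths. -/
lemma exists_continuous_modification {B : ℝ → Ω → ℝ}
    (hm : ∀ t, 0 ≤ t → AEMeasurable (B t) P)
    (hc : ∀ᵐ ω ∂P, ContinuousOn (fun t => B t ω) (Set.Ici 0)) :
    ∃ B' : ℝ → Ω → ℝ, (∀ t, Measurable (B' t)) ∧ (∀ ω, Continuous fun t => B' t ω) ∧
      ∀ᵐ ω ∂P, ∀ t, 0 ≤ t → B' t ω = B t ω := by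
  classical
  have hae : ∀ᵐ ω ∂P, ContinuousOn (fun t => B t ω) (Set.Ici 0) ∧
      ∀ q : ℚ, ∀ hq : (0 : ℝ) ≤ q, B q ω = (hm q hq).mk (B q) ω := by
    refine hc.and (ae_all_iff.2 fun q => ?_)
    by_cases hq : (0 : ℝ) ≤ q
    · filter_upwards [(hm q hq).ae_eq_mk] with ω hω _ using hω
    · exact ae_of_all _ fun ω h => absurd h hq
  obtain ⟨N, hNsub, hNm, hN0⟩ := exists_measurable_superset_of_null hae
  have hN : ∀ ω ∉ N, ContinuousOn (fun t => B t ω) (Set.Ici 0) ∧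
      ∀ q : ℚ, ∀ hq : (0 : ℝ) ≤ q, B q ω = (hm q hq).mk (B q) ω := by
    intro ω hω
    by_contra hcon
    exact hω (hNsub hcon)
  refine ⟨fun t ω => if ω ∈ N then 0 else B (max t 0) ω, ?_, ?_, ?_⟩
  · intro t
    have hmax : ∀ q : ℚ, (0 : ℝ) ≤ ((max q 0 : ℚ) : ℝ) := fun q => by simp
    have hq : ∀ q : ℚ, Measurable fun ω => if ω ∈ N then 0 else B ((max q 0 : ℚ) : ℝ) ω := by
      intro q
      have : (fun ω => if ω ∈ N then 0 else B ((max q 0 : ℚ) : ℝ) ω) =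
          fun ω => if ω ∈ N then 0 else (hm _ (hmax q)).mk (B ((max q 0 : ℚ) : ℝ)) ω := by
        funext ω
        by_cases hω : ω ∈ N
        · simp [hω]
        · simp only [hω, if_false]
          exact (hN ω hω).2 _ (hmax q)
      rw [this]
      exact Measurable.ite hNm measurable_const (hm _ (hmax q)).measurable_mk
    obtain ⟨s, hs⟩ : ∃ s : ℕ → ℚ, Tendsto (fun n => (s n : ℝ)) atTop (𝓝 t) := by
      obtain ⟨s, _, _, hs⟩ := Rat.denseRange_cast (𝕜 := ℝ) |>.exists_seq_strictMono_tendsto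
        Rat.cast_mono t
      exact ⟨s, hs⟩
    refine measurable_of_tendsto_metrizable (fun n => hq (s n)) ?_
    rw [tendsto_pi_nhds]
    intro ω
    by_cases hω : ω ∈ N
    · simp [hω]
    · simp only [hω, if_false]
      have h1 : Tendsto (fun n => max (s n : ℝ) 0) atTop (𝓝[Set.Ici 0] (max t 0)) := by
        rw [tendsto_nhdsWithin_iff]
        exact ⟨hs.max tendsto_const_nhds,
          Eventually.of_forall fun n => Set.mem_Ici.2 (le_max_right _ _)⟩
      have h2 := ((hN ω hω).1 (max t 0) (Set.mem_Ici.2 (le_max_right _ _))).tendsto.comp h1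
      simpa [Function.comp_def] using h2
  · intro ω
    by_cases hω : ω ∈ N
    · simp [hω, continuous_const]
    · simp only [hω, if_false]
      exact (hN ω hω).1.comp_continuous (by fun_prop) fun t => Set.mem_Ici.2 (le_max_right _ _)
  · have : ∀ᵐ ω ∂P, ω ∉ N := measure_eq_zero_iff_ae_notMem.1 hN0
    filter_upwards [this] with ω hω t ht
    simp [hω, max_eq_left ht]

/-- Cauchy–Schwarz on a finite interval. -/
lemma sq_setIntegral_le {T : ℝ} (hT : 0 ≤ T) {φ : ℝ → ℝ}
    (hφ2 : IntegrableOn (fun u => φ u ^ 2) (Set.Ioc 0 T)) :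
    (∫ u in Set.Ioc 0 T, φ u) ^ 2 ≤ T * ∫ u in Set.Ioc 0 T, φ u ^ 2 := by
  have hnn : 0 ≤ ∫ u in Set.Ioc 0 T, φ u ^ 2 := integral_nonneg fun u => sq_nonneg _
  by_cases hφ : IntegrableOn φ (Set.Ioc 0 T)
  · rcases hT.eq_or_lt with rfl | hT
    · simp
    set I := ∫ u in Set.Ioc 0 T, φ u
    have h1 : ∫ u in Set.Ioc 0 T, (2 * (I / T)) * φ u ≤
        ∫ u in Set.Ioc 0 T, ((I / T) ^ 2 + φ u ^ 2) := by
      refine integral_mono (hφ.const_mul _) ((integrable_const _).add hφ2) fun u => ?_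
      nlinarith [sq_nonneg (I / T - φ u)]
    rw [integral_const_mul, integral_add (integrable_const _) hφ2, setIntegral_const] at h1
    simp only [Real.volume_real_Ioc_of_le hT.le, sub_zero, smul_eq_mul] at h1
    have h2 : T * (I / T) ^ 2 = I ^ 2 / T := by field_simp
    have h3 : 2 * (I / T) * I = 2 * (I ^ 2 / T) := by ring
    rw [h2] at h1
    have h4 : I ^ 2 / T ≤ ∫ u in Set.Ioc 0 T, φ u ^ 2 := by linarith
    rw [div_le_iff₀ hT] at h4
    linarith
  · rw [integral_undef hφ, zero_pow two_ne_zero]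
    exact mul_nonneg hT hnn

variable [IsProbabilityMeasure P] {D : ℝ → Ω → ℝ} {f : ℝ → ℝ} {T K : ℝ}

lemma integrable_prod_sq (hD : Measurable (Function.uncurry D)) (hf : Continuous f)
    (hL2 : ∀ u ∈ Set.Ioc 0 T, MemLp (D u) 2 P) (hK : ∀ u ∈ Set.Ioc 0 T, ∫ ω, D u ω ^ 2 ∂P ≤ K) :
    Integrable (fun z : ℝ × Ω => (f z.1 * D z.1 z.2) ^ 2)
      ((volume.restrict (Set.Ioc 0 T)).prod P) := by
  have hmeas : Measurable fun z : ℝ × Ω => (f z.1 * D z.1 z.2) ^ 2 :=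
    ((hf.measurable.comp measurable_fst).mul hD).pow_const 2
  rw [integrable_prod_iff hmeas.aestronglyMeasurable]
  constructor
  · filter_upwards [ae_restrict_mem measurableSet_Ioc] with u hu
    simp only [mul_pow]
    exact (hL2 u hu).integrable_sq.const_mul _
  · have hb : IntegrableOn (fun u => f u ^ 2 * K) (Set.Ioc 0 T) :=
      (Continuous.integrableOn_Icc (by fun_prop)).mono_set Set.Ioc_subset_Icc_self
    refine hb.mono' hmeas.stronglyMeasurable.norm.integral_prod_right.aestronglyMeasurable ?_
    filter_upwards [ae_restrict_mem measurableSet_Ioc] with u hu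
    rw [Real.norm_of_nonneg (integral_nonneg fun _ => norm_nonneg _)]
    have : ∀ ω, ‖(f u * D u ω) ^ 2‖ = f u ^ 2 * D u ω ^ 2 := fun ω => by
      rw [Real.norm_of_nonneg (sq_nonneg _), mul_pow]
    simp only [this]
    rw [integral_const_mul]
    gcongr
    exact hK u hu

lemma memLp_setIntegral_process (hT : 0 ≤ T) (hD : Measurable (Function.uncurry D))
    (hf : Continuous f) (hL2 : ∀ u ∈ Set.Ioc 0 T, MemLp (D u) 2 P)
    (hK : ∀ u ∈ Set.Ioc 0 T, ∫ ω, D u ω ^ 2 ∂P ≤ K) :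
    MemLp (fun ω => ∫ u in Set.Ioc 0 T, f u * D u ω) 2 P := by
  have hi := integrable_prod_sq hD hf hL2 hK
  have hmeas : Measurable fun z : Ω × ℝ => f z.2 * D z.2 z.1 :=
    (hf.measurable.comp measurable_snd).mul (hD.comp measurable_swap)
  have hm : AEStronglyMeasurable (fun ω => ∫ u in Set.Ioc 0 T, f u * D u ω) P :=
    hmeas.stronglyMeasurable.integral_prod_right.aestronglyMeasurable
  rw [memLp_two_iff_integrable_sq hm]
  refine (hi.integral_prod_right.const_mul T).mono' (hm.pow 2) ?_
  filter_upwards [hi.prod_left_ae] with ω hω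
  rw [Real.norm_of_nonneg (sq_nonneg _)]
  exact sq_setIntegral_le hT hω

/-- Expectations of integrated processes. -/
lemma integral_setIntegral_process_mul (hD : Measurable (Function.uncurry D))
    (hf : Continuous f) (hL2 : ∀ u ∈ Set.Ioc 0 T, MemLp (D u) 2 P)
    (hK : ∀ u ∈ Set.Ioc 0 T, ∫ ω, D u ω ^ 2 ∂P ≤ K) {W : Ω → ℝ} (hW : MemLp W 2 P) :
    ∫ ω, (∫ u in Set.Ioc 0 T, f u * D u ω) * W ω ∂P =
      ∫ u in Set.Ioc 0 T, f u * ∫ ω, D u ω * W ω ∂P := by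
  have hi := integrable_prod_sq hD hf hL2 hK
  have hW2 : Integrable (fun z : ℝ × Ω => W z.2 ^ 2) ((volume.restrict (Set.Ioc 0 T)).prod P) :=
    hW.integrable_sq.comp_snd _
  have hmeas : Measurable fun z : ℝ × Ω => f z.1 * D z.1 z.2 :=
    (hf.measurable.comp measurable_fst).mul hD
  have hprod : Integrable (fun z : ℝ × Ω => f z.1 * D z.1 z.2 * W z.2)
      ((volume.restrict (Set.Ioc 0 T)).prod P) := by
    refine (hi.add hW2).mono' (hmeas.aestronglyMeasurable.mul hW.aestronglyMeasurable.comp_snd)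
      (ae_of_all _ fun z => ?_)
    simp only [Pi.add_apply]
    rw [Real.norm_eq_abs, abs_le]
    constructor <;> nlinarith [sq_nonneg (f z.1 * D z.1 z.2 + W z.2),
      sq_nonneg (f z.1 * D z.1 z.2 - W z.2), sq_nonneg (f z.1 * D z.1 z.2), sq_nonneg (W z.2)]
  have h1 : ∀ ω, (∫ u in Set.Ioc 0 T, f u * D u ω) * W ω =
      ∫ u in Set.Ioc 0 T, f u * D u ω * W ω := fun ω => (integral_mul_const _ _).symm
  simp only [h1]
  rw [← integral_integral_swap (f := fun u ω => f u * D u ω * W ω) hprod]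
  refine integral_congr_ae (ae_of_all _ fun u => ?_)
  simp only [mul_assoc]
  exact integral_const_mul _ _

end PathIntegrals

section Covariance

variable {Ω : Type*} [MeasurableSpace Ω] {P : Measure Ω}

lemma covariance_congr_ae {U U' W W' : Ω → ℝ} (hU : U =ᵐ[P] U') (hW : W =ᵐ[P] W') :
    covariance U W P = covariance U' W' P := by
  unfold covariance
  rw [integral_congr_ae hU, integral_congr_ae hW]
  refine integral_congr_ae ?_
  filter_upwards [hU, hW] with ω h1 h2
  rw [h1, h2]

variable [IsProbabilityMeasure P]

lemma sq_covariance_le {U W : Ω → ℝ} (hU : MemLp U 2 P) (hW : MemLp W 2 P) :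
    covariance U W P ^ 2 ≤ variance U P * variance W P := by
  have h : ∀ x : ℝ, 0 ≤ variance W P * (x * x) + 2 * covariance U W P * x + variance U P := by
    intro x
    have h1 := variance_nonneg (U + x • W) P
    rw [variance_add hU (hW.const_smul x), variance_smul, covariance_smul_right] at h1
    nlinarith
  have := discrim_le_zero h
  rw [discrim] at this
  nlinarith

variable {ι : Type*} {l : Filter ι}

lemma tendsto_covariance_zero {U W : ι → Ω → ℝ} (hU : ∀ᶠ t in l, MemLp (U t) 2 P)
    (hW : ∀ᶠ t in l, MemLp (W t) 2 P) {L : ℝ}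
    (hUv : Tendsto (fun t => variance (U t) P) l (𝓝 L))
    (hWv : Tendsto (fun t => variance (W t) P) l (𝓝 0)) :
    Tendsto (fun t => covariance (U t) (W t) P) l (𝓝 0) := by
  have h1 := hUv.mul hWv
  rw [mul_zero] at h1
  have h2 : Tendsto (fun t => covariance (U t) (W t) P ^ 2) l (𝓝 0) := by
    refine squeeze_zero' (Eventually.of_forall fun t => sq_nonneg _) ?_ h1
    filter_upwards [hU, hW] with t hu hw using sq_covariance_le hu hw
  have h3 := h2.sqrt
  simp only [Real.sqrt_sq_eq_abs, Real.sqrt_zero] at h3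
  exact (tendsto_zero_iff_abs_tendsto_zero _).2 h3

lemma tendsto_variance_add_zero {U W : ι → Ω → ℝ} (hU : ∀ᶠ t in l, MemLp (U t) 2 P)
    (hW : ∀ᶠ t in l, MemLp (W t) 2 P)
    (hUv : Tendsto (fun t => variance (U t) P) l (𝓝 0))
    (hWv : Tendsto (fun t => variance (W t) P) l (𝓝 0)) :
    Tendsto (fun t => variance (U t + W t) P) l (𝓝 0) := by
  have h := (hUv.add ((tendsto_covariance_zero hU hW hUv hWv).const_mul 2)).add hWv
  simp only [mul_zero, add_zero] at h
  refine h.congr' ?_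
  filter_upwards [hU, hW] with t hu hw
  rw [variance_add hu hw]

/-- Perturbations that vanish in mean square do not affect the limit of a covariance. -/
lemma tendsto_covariance_add {U₁ U₂ R₁ R₂ : ι → Ω → ℝ} {L₁ L₂ c : ℝ}
    (hU₁ : ∀ᶠ t in l, MemLp (U₁ t) 2 P) (hU₂ : ∀ᶠ t in l, MemLp (U₂ t) 2 P)
    (hR₁ : ∀ᶠ t in l, MemLp (R₁ t) 2 P) (hR₂ : ∀ᶠ t in l, MemLp (R₂ t) 2 P)
    (hv₁ : Tendsto (fun t => variance (U₁ t) P) l (𝓝 L₁))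
    (hv₂ : Tendsto (fun t => variance (U₂ t) P) l (𝓝 L₂))
    (hr₁ : Tendsto (fun t => variance (R₁ t) P) l (𝓝 0))
    (hr₂ : Tendsto (fun t => variance (R₂ t) P) l (𝓝 0))
    (hc : Tendsto (fun t => covariance (U₁ t) (U₂ t) P) l (𝓝 c)) :
    Tendsto (fun t => covariance (U₁ t + R₁ t) (U₂ t + R₂ t) P) l (𝓝 c) := by
  have h1 := tendsto_covariance_zero hU₁ hR₂ hv₁ hr₂
  have h2 := tendsto_covariance_zero hU₂ hR₁ hv₂ hr₁
  have h3 := tendsto_covariance_zero hR₁ hR₂ hr₁ hr₂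
  have h := ((hc.add h1).add h2).add h3
  simp only [add_zero] at h
  refine h.congr' ?_
  filter_upwards [hU₁, hU₂, hR₁, hR₂] with t u1 u2 r1 r2
  rw [covariance_add_left u1 r1 (u2.add r2), covariance_add_right u1 u2 r2,
    covariance_add_right r1 u2 r2, covariance_comm (U₂ t) (R₁ t)]
  ring

/-- If `x t → 0` in a finite-dimensional space and the linear statistics `x t · ξ` have finite
variance, then these variances tend to zero, without any moment condition on `ξ` itself. -/
lemma tendsto_variance_dotProduct {p : ℕ} {ξ : Ω → Fin p → ℝ} {x : ι → Fin p → ℝ}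
    (hx : Tendsto x l (𝓝 0)) (hL2 : ∀ᶠ t in l, MemLp (fun ω => dotProduct (x t) (ξ ω)) 2 P) :
    Tendsto (fun t => variance (fun ω => dotProduct (x t) (ξ ω)) P) l (𝓝 0) := by
  classical
  let S : Submodule ℝ (Fin p → ℝ) :=
    { carrier := {y | MemLp (fun ω => dotProduct y (ξ ω)) 2 P}
      zero_mem' := by simp
      add_mem' := by
        intro y z hy hz
        simp only [Set.mem_ofPred_eq, add_dotProduct] at *
        exact hy.add hz
      smul_mem' := by
        intro c y hy
        simp only [Set.mem_ofPred_eq, smul_dotProduct] at *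
        exact hy.const_smul c }
  let bs := Module.finBasis ℝ S
  let y : ι → S := fun t => if h : x t ∈ S then ⟨x t, h⟩ else 0
  have hy : Tendsto y l (𝓝 0) := by
    rw [tendsto_subtype_rng]
    refine Tendsto.congr' ?_ hx
    filter_upwards [hL2] with t ht
    have : x t ∈ S := ht
    simp [y, this]
  have hcoef : ∀ k, Tendsto (fun t => bs.repr (y t) k) l (𝓝 0) := by
    intro k
    have hcont : Continuous (bs.coord k) := (bs.coord k).continuous_of_finiteDimensional
    have := (hcont.tendsto 0).comp hy
    rw [map_zero] at this
    exact this
  have hmem : ∀ k, MemLp (fun ω => dotProduct (bs k : Fin p → ℝ) (ξ ω)) 2 P := fun k => (bs k).2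
  have hsum : Tendsto (fun t => ∑ k, ∑ m, bs.repr (y t) k * (bs.repr (y t) m *
      covariance (fun ω => dotProduct (bs k : Fin p → ℝ) (ξ ω))
        (fun ω => dotProduct (bs m : Fin p → ℝ) (ξ ω)) P)) l (𝓝 0) := by
    have : Tendsto (fun t => ∑ k, ∑ m, bs.repr (y t) k * (bs.repr (y t) m *
      covariance (fun ω => dotProduct (bs k : Fin p → ℝ) (ξ ω))
        (fun ω => dotProduct (bs m : Fin p → ℝ) (ξ ω)) P)) l
        (𝓝 (∑ k, ∑ m, 0 * (0 * covariance (fun ω => dotProduct (bs k : Fin p → ℝ) (ξ ω))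
        (fun ω => dotProduct (bs m : Fin p → ℝ) (ξ ω)) P))) :=
      tendsto_finsetSum _ fun k _ => tendsto_finsetSum _ fun m _ =>
        (hcoef k).mul ((hcoef m).mul_const _)
    simpa using this
  refine hsum.congr' ?_
  filter_upwards [hL2] with t ht
  have hxS : x t ∈ S := ht
  have hyx : (y t : Fin p → ℝ) = x t := by simp [y, hxS]
  have hexp : (fun ω => dotProduct (x t) (ξ ω)) = fun ω => ∑ k, bs.repr (y t) k *
      dotProduct (bs k : Fin p → ℝ) (ξ ω) := by
    funext ω
    have h1 := congrArg (Subtype.val) (bs.sum_repr (y t))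
    rw [hyx] at h1
    rw [← h1]
    simp only [Submodule.coe_sum, Submodule.coe_smul, sum_dotProduct, smul_dotProduct, smul_eq_mul]
  rw [hexp, variance_fun_sum fun k => (hmem k).const_mul _]
  simp only [covariance_const_mul_left, covariance_const_mul_right]
  exact Finset.sum_congr rfl fun k _ => Finset.sum_congr rfl fun m _ => mul_left_comm _ _ _

end Covariance

section VariationOfConstants

variable {p : ℕ} (A : Matrix (Fin p) (Fin p) ℝ) (b : Fin p → ℝ)

lemma expForm_sum_single (M : Matrix (Fin p) (Fin p) ℝ) (z : Fin p → ℝ) (t : ℝ) :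
    ∑ i, expForm A b (M.mulVec (Pi.single i 1)) t * z i = expForm A b (M.mulVec z) t := by
  simp only [expForm, Matrix.dotProduct_mulVec, Matrix.vecMul_vecMul]
  simp only [dotProduct_single_one]
  rfl

lemma expForm_add_right (x y : Fin p → ℝ) (t : ℝ) :
    expForm A b (x + y) t = expForm A b x t + expForm A b y t := by
  simp [expForm, Matrix.mulVec_add]

lemma expForm_smul_right (c : ℝ) (x : Fin p → ℝ) (t : ℝ) :
    expForm A b (c • x) t = c * expForm A b x t := by
  simp [expForm, Matrix.mulVec_smul]

/-- Variation of constants for a linear equation with a continuous additive forcing. -/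
lemma dotProduct_solution_eq {x : ℝ → Fin p → ℝ} {B : ℝ → ℝ} {d : Fin p → ℝ} {c σ : ℝ}
    (hx : ContinuousOn x (Set.Ici 0)) (hB : ContinuousOn B (Set.Ici 0)) (hB0 : B 0 = 0)
    (heq : ∀ t, 0 ≤ t → ∀ i, x t i = x 0 i + (∫ s in (0 : ℝ)..t, (A.mulVec (x s) i + c * d i))
      + σ * d i * (B t - B 0)) {t : ℝ} (ht : 0 ≤ t) :
    dotProduct b (x t) = dotProduct (Matrix.vecMul b (expA A t)) (x 0)
      + c * (∫ s in (0 : ℝ)..t, expForm A b d (t - s)) + σ * expForm A b d t * B t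
      + ∫ u in Set.Ioc 0 t, σ * expForm A b (A.mulVec d) u * (B (t - u) - B t) := by
  have hIcc : Set.Icc 0 t ⊆ Set.Ici 0 := Set.Icc_subset_Ici_self
  have hAx : ∀ i, ContinuousOn (fun s => A.mulVec (x s) i + c * d i) (Set.Ici 0) := by
    intro i
    have hxi : ∀ j, ContinuousOn (fun s => x s j) (Set.Ici 0) := fun j =>
      (continuous_apply j).comp_continuousOn hx
    refine ContinuousOn.add ?_ continuousOn_const
    simp only [Matrix.mulVec, dotProduct]
    exact continuousOn_finsetSum _ fun j _ => continuousOn_const.mul (hxi j)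
  have hinteg : ∀ i s, 0 ≤ s →
      IntervalIntegrable (fun s => A.mulVec (x s) i + c * d i) volume 0 s := by
    intro i s hs
    refine ((hAx i).mono ?_).intervalIntegrable
    rw [Set.uIcc_of_le hs]; exact Set.Icc_subset_Ici_self
  -- the smooth part of the solution
  set D : ℝ → Fin p → ℝ := fun s i => x s i - σ * d i * B s with hD
  have hDcont : ∀ i, ContinuousOn (fun s => D s i) (Set.Ici 0) := fun i =>
    ((continuous_apply i).comp_continuousOn hx).sub (continuousOn_const.mul hB)
  have hDder : ∀ i s, 0 < s → HasDerivAt (fun s => D s i) (A.mulVec (x s) i + c * d i) s := by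
    intro i s hs
    have hFTC : HasDerivAt (fun s => ∫ r in (0 : ℝ)..s, (A.mulVec (x r) i + c * d i))
        (A.mulVec (x s) i + c * d i) s :=
      intervalIntegral.integral_hasDerivAt_right (hinteg i s hs.le)
        ((hAx i).mono Set.Ioi_subset_Ici_self |>.stronglyMeasurableAtFilter isOpen_Ioi s hs)
        ((hAx i).continuousAt (Ici_mem_nhds hs))
    refine (hFTC.const_add (x 0 i)).congr_of_eventuallyEq ?_
    filter_upwards [lt_mem_nhds hs] with r hr
    simp only [hD, heq r hr.le i, hB0]
    ring
  have hr : ∀ (i : Fin p) (s : ℝ), HasDerivAt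
      (fun s => expForm A b ((1 : Matrix (Fin p) (Fin p) ℝ).mulVec (Pi.single i 1)) (t - s))
      (-expForm A b (A.mulVec (Pi.single i 1)) (t - s)) s := by
    intro i s
    simp only [Matrix.one_mulVec]
    exact HasDerivAt.comp_const_sub t s (hasDerivAt_expForm A b (Pi.single i 1) (t - s))
  have hcont : ∀ y, Continuous fun s => expForm A b y (t - s) := fun y =>
    (continuous_expForm A b y).comp (by fun_prop)
  have hsc : ContinuousOn
      (fun s => σ * B s * expForm A b (A.mulVec d) (t - s) + c * expForm A b d (t - s))
      (Set.Icc 0 t) :=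
    ((continuousOn_const.mul (hB.mono hIcc)).mul (hcont _).continuousOn).add
      (continuousOn_const.mul (hcont _).continuousOn)
  have hkey := intervalIntegral.integral_eq_sub_of_hasDerivAt_of_le ht
    (f := fun s => ∑ i,
      expForm A b ((1 : Matrix (Fin p) (Fin p) ℝ).mulVec (Pi.single i 1)) (t - s) * D s i)
    (f' := fun s => σ * B s * expForm A b (A.mulVec d) (t - s) + c * expForm A b d (t - s))
    (continuousOn_finsetSum _ fun i _ => (hcont _).continuousOn.mul ((hDcont i).mono hIcc))
    (by
      intro s hs
      convert! HasDerivAt.fun_sum fun i (_ : i ∈ Finset.univ) => (hr i s).mul (hDder i s hs.1)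
        using 1
      have e1 : ∑ i, (-expForm A b (A.mulVec (Pi.single i 1)) (t - s) * D s i +
          expForm A b ((1 : Matrix (Fin p) (Fin p) ℝ).mulVec (Pi.single i 1)) (t - s) *
            (A.mulVec (x s) i + c * d i)) =
          -expForm A b (A.mulVec (D s)) (t - s) +
            expForm A b ((1 : Matrix (Fin p) (Fin p) ℝ).mulVec (A.mulVec (x s) + c • d))
              (t - s) := by
        rw [← expForm_sum_single A b A, ← expForm_sum_single A b 1, ← Finset.sum_neg_distrib,
          ← Finset.sum_add_distrib]
        refine Finset.sum_congr rfl fun i _ => ?_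
        simp only [Pi.add_apply, Pi.smul_apply, smul_eq_mul]
        ring
      rw [e1, Matrix.one_mulVec]
      have e2 : x s = D s + (σ * B s) • d := by
        funext i
        simp only [hD, Pi.add_apply, Pi.smul_apply, smul_eq_mul]
        ring
      rw [e2, Matrix.mulVec_add, Matrix.mulVec_smul, expForm_add_right, expForm_add_right,
        expForm_smul_right, expForm_smul_right]
      ring)
    (by
      refine ContinuousOn.intervalIntegrable ?_
      rwa [Set.uIcc_of_le ht])
  simp only [expForm_sum_single A b 1, sub_self, sub_zero] at hkey
  simp only [Matrix.one_mulVec, expForm_zero] at hkey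
  have hD0 : D 0 = x 0 := by funext i; simp [hD, hB0]
  have hDt : dotProduct b (D t) = dotProduct b (x t) - σ * B t * dotProduct b d := by
    have : D t = x t - (σ * B t) • d := by
      funext i; simp only [hD, Pi.sub_apply, Pi.smul_apply, smul_eq_mul]; ring
    rw [this, dotProduct_sub, dotProduct_smul, smul_eq_mul]
  have h0 : expForm A b (x 0) t = dotProduct (Matrix.vecMul b (expA A t)) (x 0) := by
    rw [expForm, Matrix.dotProduct_mulVec]
  have i1 : IntervalIntegrable (fun s => σ * B s * expForm A b (A.mulVec d) (t - s))
      volume 0 t := by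
    refine ContinuousOn.intervalIntegrable ?_
    rw [Set.uIcc_of_le ht]
    exact (continuousOn_const.mul (hB.mono hIcc)).mul (hcont _).continuousOn
  have i2 : IntervalIntegrable (fun s => c * expForm A b d (t - s)) volume 0 t :=
    ((hcont d).const_mul c).intervalIntegrable _ _
  rw [intervalIntegral.integral_add i1 i2, intervalIntegral.integral_const_mul, hDt, hD0, h0]
    at hkey
  have hsub : ∫ s in (0 : ℝ)..t, σ * B s * expForm A b (A.mulVec d) (t - s) =
      ∫ u in (0 : ℝ)..t, σ * B (t - u) * expForm A b (A.mulVec d) u := by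
    have := intervalIntegral.integral_comp_sub_left (a := 0) (b := t)
      (fun s => σ * B s * expForm A b (A.mulVec d) (t - s)) t
    simp only [sub_self, sub_zero, sub_sub_cancel] at this
    exact this.symm
  have i3 : IntervalIntegrable (fun u => σ * B (t - u) * expForm A b (A.mulVec d) u)
      volume 0 t := by
    refine ContinuousOn.intervalIntegrable ?_
    rw [Set.uIcc_of_le ht]
    refine (continuousOn_const.mul (hB.comp (by fun_prop) fun u hu => ?_)).mul
      (continuous_expForm A b _).continuousOn
    exact Set.mem_Ici.2 (sub_nonneg.2 hu.2)
  have i4 : IntervalIntegrable (fun u => σ * B t * expForm A b (A.mulVec d) u) volume 0 t :=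
    ((continuous_expForm A b _).const_mul _).intervalIntegrable _ _
  have hlast : ∫ u in (0 : ℝ)..t, σ * B t * expForm A b (A.mulVec d) u =
      σ * B t * (expForm A b d t - dotProduct b d) := by
    rw [intervalIntegral.integral_const_mul, intervalIntegral.integral_eq_sub_of_hasDerivAt
      (fun u _ => hasDerivAt_expForm A b d u) ((continuous_expForm A b _).intervalIntegrable _ _),
      expForm_zero]
  have hfin : ∫ u in Set.Ioc 0 t, σ * expForm A b (A.mulVec d) u * (B (t - u) - B t) =
      (∫ u in (0 : ℝ)..t, σ * B (t - u) * expForm A b (A.mulVec d) u) -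
        σ * B t * (expForm A b d t - dotProduct b d) := by
    rw [← hlast, ← intervalIntegral.integral_sub i3 i4, intervalIntegral.integral_of_le ht]
    congr 1; funext u; ring
  rw [hfin, ← hsub]
  linear_combination -hkey

end VariationOfConstants

section FractionalBrownianMotion

variable {Ω : Type*} [MeasurableSpace Ω] {P : Measure Ω} {H : ℝ} {B : ℝ → Ω → ℝ}

lemma IsFractionalBrownianMotion.aemeasurable (hB : IsFractionalBrownianMotion H B P) {t : ℝ}
    (ht : 0 ≤ t) : AEMeasurable (B t) P :=
  hB.gaussian.aemeasurable ⟨t, ht⟩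

lemma IsFractionalBrownianMotion.memLp (hB : IsFractionalBrownianMotion H B P) {t : ℝ}
    (ht : 0 ≤ t) : MemLp (B t) 2 P :=
  (hB.gaussian.hasGaussianLaw_eval ⟨t, ht⟩).memLp_two

/-- The covariance of two backward increments. -/
lemma IsFractionalBrownianMotion.integral_increments (hB : IsFractionalBrownianMotion H B P)
    {s h u v : ℝ} (hs : 0 ≤ s) (hsh : 0 ≤ s + h) (hu : u ≤ s + h) (hv : v ≤ s) :
    ∫ ω, (B (s + h - u) ω - B (s + h) ω) * (B (s - v) ω - B s ω) ∂P =
      1 / 2 * (|h - u| ^ (2 * H) + |h + v| ^ (2 * H) - |h - u + v| ^ (2 * H) - |h| ^ (2 * H)) := by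
  have hu' : 0 ≤ s + h - u := by linarith
  have hv' : 0 ≤ s - v := by linarith
  have hi : ∀ {x y : ℝ}, 0 ≤ x → 0 ≤ y → Integrable (fun ω => B x ω * B y ω) P := fun hx hy =>
    (hB.memLp hx).integrable_mul (hB.memLp hy)
  have e : (fun ω => (B (s + h - u) ω - B (s + h) ω) * (B (s - v) ω - B s ω)) =
      fun ω => (B (s + h - u) ω * B (s - v) ω - B (s + h - u) ω * B s ω) -
        (B (s + h) ω * B (s - v) ω - B (s + h) ω * B s ω) := by
    funext ω; ring
  have j1 : Integrable (fun ω => B (s + h - u) ω * B (s - v) ω - B (s + h - u) ω * B s ω) P :=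
    (hi hu' hv').sub (hi hu' hs)
  have j2 : Integrable (fun ω => B (s + h) ω * B (s - v) ω - B (s + h) ω * B s ω) P :=
    (hi hsh hv').sub (hi hsh hs)
  rw [e, integral_sub j1 j2, integral_sub (hi hu' hv') (hi hu' hs),
    integral_sub (hi hsh hv') (hi hsh hs), hB.kernel _ _ hv' hu', hB.kernel _ _ hs hu',
    hB.kernel _ _ hv' hsh, hB.kernel _ _ hs hsh]
  have e1 : s + h - u - (s - v) = h - u + v := by ring
  have e2 : s + h - u - s = h - u := by ring
  have e3 : s + h - (s - v) = h + v := by ring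
  have e4 : s + h - s = h := by ring
  rw [e1, e2, e3, e4]
  ring

lemma IsFractionalBrownianMotion.congr {B' : ℝ → Ω → ℝ} (hB : IsFractionalBrownianMotion H B P)
    (h : ∀ᵐ ω ∂P, ∀ t, 0 ≤ t → B' t ω = B t ω) : IsFractionalBrownianMotion H B' P := by
  have ht : ∀ t, 0 ≤ t → B t =ᵐ[P] B' t := fun t ht => by
    filter_upwards [h] with ω hω using (hω t ht).symm
  refine ⟨hB.gaussian.congr fun t => ht t t.2, ?_, ?_, ?_, ?_⟩
  · filter_upwards [hB.start, h] with ω h1 h2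
    rw [h2 0 le_rfl, h1]
  · intro t h0
    rw [← hB.mean t h0]
    exact integral_congr_ae (ht t h0).symm
  · intro s t hs h0
    rw [← hB.kernel s t hs h0]
    exact integral_congr_ae ((ht t h0).symm.mul (ht s hs).symm)
  · filter_upwards [hB.paths, h] with ω h1 h2
    exact h1.congr fun t ht => h2 t ht

/-- The weighted integral of the backward increments of a process. -/
noncomputable def backwardIntegral (f : ℝ → ℝ) (B : ℝ → Ω → ℝ) (s : ℝ) (ω : Ω) : ℝ :=
  ∫ u in Set.Ioc 0 s, f u * (B (s - u) ω - B s ω)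

variable {f : ℝ → ℝ}

lemma measurable_backwardIncrement (hBm : ∀ t, Measurable (B t))
    (hBc : ∀ ω, Continuous fun t => B t ω) (s : ℝ) :
    Measurable (Function.uncurry fun u ω => B (s - u) ω - B s ω) :=
  measurable_uncurry_of_continuous_of_measurable
    (fun ω => ((hBc ω).comp (by fun_prop : Continuous fun u : ℝ => s - u)).sub continuous_const)
    (fun u => (hBm (s - u)).sub (hBm s))

lemma IsFractionalBrownianMotion.integral_increment_sq (hB : IsFractionalBrownianMotion H B P)
    (hH : 0 < H) {s : ℝ} (hs : 0 ≤ s) :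
    ∀ u ∈ Set.Ioc 0 s, ∫ ω, (B (s - u) ω - B s ω) ^ 2 ∂P ≤ s ^ (2 * H) := by
  intro u hu
  have h1 := hB.integral_increments (h := 0) (u := u) hs (by linarith) (by linarith [hu.2]) hu.2
  simp only [add_zero, zero_sub, zero_add, abs_neg, neg_add_cancel, abs_zero,
    Real.zero_rpow (by linarith : 2 * H ≠ 0), ← sq, abs_of_pos hu.1] at h1
  rw [h1]
  have h2 : u ^ (2 * H) ≤ s ^ (2 * H) := Real.rpow_le_rpow hu.1.le hu.2 (by linarith)
  linarith

lemma IsFractionalBrownianMotion.memLp_increment (hB : IsFractionalBrownianMotion H B P)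
    {s : ℝ} (hs : 0 ≤ s) : ∀ u ∈ Set.Ioc 0 s, MemLp (fun ω => B (s - u) ω - B s ω) 2 P :=
  fun _ hu => (hB.memLp (by linarith [hu.2])).sub (hB.memLp hs)

variable [IsProbabilityMeasure P]

lemma IsFractionalBrownianMotion.memLp_backwardIntegral (hB : IsFractionalBrownianMotion H B P)
    (hH : 0 < H) (hBm : ∀ t, Measurable (B t)) (hBc : ∀ ω, Continuous fun t => B t ω)
    (hf : Continuous f) {s : ℝ} (hs : 0 ≤ s) : MemLp (backwardIntegral f B s) 2 P :=
  memLp_setIntegral_process hs (measurable_backwardIncrement hBm hBc s) hf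
    (hB.memLp_increment hs) (hB.integral_increment_sq hH hs)

lemma IsFractionalBrownianMotion.integral_backwardIntegral (hB : IsFractionalBrownianMotion H B P)
    (hH : 0 < H) (hBm : ∀ t, Measurable (B t)) (hBc : ∀ ω, Continuous fun t => B t ω)
    (hf : Continuous f) {s : ℝ} (hs : 0 ≤ s) : ∫ ω, backwardIntegral f B s ω ∂P = 0 := by
  have h1 := integral_setIntegral_process_mul (measurable_backwardIncrement hBm hBc s) hf
    (hB.memLp_increment hs) (hB.integral_increment_sq hH hs) (W := fun _ => 1) (memLp_const 1)
  simp only [mul_one] at h1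
  unfold backwardIntegral
  rw [h1]
  rw [setIntegral_congr_fun (g := fun _ => (0 : ℝ)) measurableSet_Ioc, integral_zero]
  intro u hu
  have hu' : 0 ≤ s - u := by linarith [hu.2]
  simp only
  rw [integral_sub ((hB.memLp hu').integrable one_le_two) ((hB.memLp hs).integrable one_le_two),
    hB.mean _ hu', hB.mean _ hs]
  simp

/-- The covariance of two backward integrals as a double integral. -/
lemma IsFractionalBrownianMotion.covariance_backwardIntegral
    (hB : IsFractionalBrownianMotion H B P)
    (hH : 0 < H) (hBm : ∀ t, Measurable (B t)) (hBc : ∀ ω, Continuous fun t => B t ω)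
    (hf : Continuous f) {s h : ℝ} (hs : 0 ≤ s) (hh : 0 ≤ h) :
    covariance (backwardIntegral f B (s + h)) (backwardIntegral f B s) P =
      ∫ u in Set.Ioc 0 (s + h), ∫ v in Set.Ioc 0 s, f u * f v *
        (1 / 2 * (|h - u| ^ (2 * H) + |h + v| ^ (2 * H) - |h - u + v| ^ (2 * H)
          - |h| ^ (2 * H))) := by
  have hsh : 0 ≤ s + h := by linarith
  have hJ := hB.memLp_backwardIntegral hH hBm hBc hf hs
  rw [covariance_eq_sub (hB.memLp_backwardIntegral hH hBm hBc hf hsh) hJ,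
    hB.integral_backwardIntegral hH hBm hBc hf hs, mul_zero, sub_zero]
  have h1 := integral_setIntegral_process_mul (measurable_backwardIncrement hBm hBc (s + h)) hf
    (hB.memLp_increment hsh) (hB.integral_increment_sq hH hsh) hJ
  refine h1.trans (setIntegral_congr_fun measurableSet_Ioc fun u hu => ?_)
  have hu' : 0 ≤ s + h - u := by linarith [hu.2]
  have h2 := integral_setIntegral_process_mul (measurable_backwardIncrement hBm hBc s) hf
    (hB.memLp_increment hs) (hB.integral_increment_sq hH hs) (hB.memLp_increment hsh u hu)
  have h3 : ∫ ω, (B (s + h - u) ω - B (s + h) ω) * backwardIntegral f B s ω ∂P =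
      ∫ v in Set.Ioc 0 s, f v * ∫ ω, (B (s - v) ω - B s ω) *
        (B (s + h - u) ω - B (s + h) ω) ∂P := by
    rw [← h2]
    refine integral_congr_ae (ae_of_all _ fun ω => ?_)
    simp only [backwardIntegral]
    ring
  rw [h3, ← integral_const_mul]
  refine setIntegral_congr_fun measurableSet_Ioc fun v hv => ?_
  rw [← hB.integral_increments hs hsh hu.2 hv.2]
  simp only [mul_comm (B (s - v) _ - B s _)]
  ring

/-- The limit of the covariances of the backward integrals. -/
lemma IsFractionalBrownianMotion.tendsto_covariance_backwardIntegral
    (hB : IsFractionalBrownianMotion H B P) (hH : 0 < H) (hH1 : H < 1)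
    (hBm : ∀ t, Measurable (B t)) (hBc : ∀ ω, Continuous fun t => B t ω)
    (hf : ExpDecay f) {h : ℝ} (hh : 0 ≤ h) :
    Tendsto (fun s => covariance (backwardIntegral f B (s + h)) (backwardIntegral f B s) P) atTop
      (𝓝 (∫ z, f z.1 * f z.2 *
        (1 / 2 * (|h - z.1| ^ (2 * H) + |h + z.2| ^ (2 * H) - |h - z.1 + z.2| ^ (2 * H)
          - |h| ^ (2 * H))) ∂(halfLine.prod halfLine))) := by
  have ha0 : 0 < 2 * H := by linarith
  have ha2 : 2 * H ≤ 2 := by linarith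
  have hφ := continuous_abs_rpow ha0
  have hone : ∀ x : ℝ, 1 ≤ (1 + |x|) ^ 2 := fun x => one_le_pow₀ (by linarith [abs_nonneg x])
  have hQ : Continuous (Function.uncurry fun u v : ℝ =>
      1 / 2 * (|h - u| ^ (2 * H) + |h + v| ^ (2 * H) - |h - u + v| ^ (2 * H) - |h| ^ (2 * H))) := by
    have c1 : Continuous fun z : ℝ × ℝ => |h - z.1| ^ (2 * H) := hφ.comp (by fun_prop)
    have c2 : Continuous fun z : ℝ × ℝ => |h + z.2| ^ (2 * H) := hφ.comp (by fun_prop)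
    have c3 : Continuous fun z : ℝ × ℝ => |h - z.1 + z.2| ^ (2 * H) := hφ.comp (by fun_prop)
    exact continuous_const.mul (((c1.add c2).sub c3).sub continuous_const)
  have hinteg := integrable_quadrant hf hf hQ (M := 2 * (1 + |h|) ^ 2) (n := 2) (by
    intro u v _ _
    set E := (1 + |h|) ^ 2 * ((1 + |u|) ^ 2 * (1 + |v|) ^ 2) with hE
    have b0 : |h| ^ (2 * H) ≤ E := by
      refine (abs_rpow_le_one_add_abs_sq ha0.le ha2 h).trans ?_
      exact le_mul_of_one_le_right (by positivity)
        (one_le_mul_of_one_le_of_one_le (hone u) (hone v))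
    have b1 : |h - u| ^ (2 * H) ≤ E := by
      refine (abs_sub_rpow_le ha0.le ha2 h u).trans ?_
      rw [hE]
      gcongr
      exact le_mul_of_one_le_right (by positivity) (hone v)
    have b2 : |h + v| ^ (2 * H) ≤ E := by
      refine (abs_add_rpow_le ha0.le ha2 h v).trans ?_
      rw [hE]
      gcongr
      exact le_mul_of_one_le_left (by positivity) (hone u)
    have b3 : |h - u + v| ^ (2 * H) ≤ E := by
      refine (abs_rpow_le_one_add_abs_sq ha0.le ha2 _).trans ?_
      rw [hE, ← mul_pow, ← mul_pow, ← mul_assoc]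
      gcongr
      refine (one_add_abs_mul (h - u) v).trans ?_
      gcongr
      simpa [sub_eq_add_neg] using one_add_abs_mul h (-u)
    have p0 : 0 ≤ |h| ^ (2 * H) := by positivity
    have p1 : 0 ≤ |h - u| ^ (2 * H) := by positivity
    have p2 : 0 ≤ |h + v| ^ (2 * H) := by positivity
    have p3 : 0 ≤ |h - u + v| ^ (2 * H) := by positivity
    rw [mul_assoc, ← hE, abs_le]
    constructor <;> linarith)
  rw [Measure.prod_restrict] at hinteg ⊢
  set F : ℝ × ℝ → ℝ := fun z => f z.1 * f z.2 *
        (1 / 2 * (|h - z.1| ^ (2 * H) + |h + z.2| ^ (2 * H) - |h - z.1 + z.2| ^ (2 * H)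
          - |h| ^ (2 * H))) with hF
  have hU : (⋃ s : ℝ, Set.Ioc (0 : ℝ) (s + h) ×ˢ Set.Ioc (0 : ℝ) s) =
      Set.Ioi (0 : ℝ) ×ˢ Set.Ioi (0 : ℝ) := by
    ext z
    simp only [Set.mem_iUnion, Set.mem_prod, Set.mem_Ioc, Set.mem_Ioi]
    constructor
    · rintro ⟨s, h1, h2⟩; exact ⟨h1.1, h2.1⟩
    · rintro ⟨h1, h2⟩
      exact ⟨max z.1 z.2, ⟨h1, by linarith [le_max_left z.1 z.2]⟩, h2, le_max_right _ _⟩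
  have hlim := tendsto_setIntegral_of_monotone (μ := (volume : Measure ℝ).prod volume) (f := F)
    (s := fun s : ℝ => Set.Ioc (0 : ℝ) (s + h) ×ˢ Set.Ioc (0 : ℝ) s)
    (fun s => measurableSet_Ioc.prod measurableSet_Ioc)
    (fun s s' hss => Set.prod_mono (Set.Ioc_subset_Ioc_right (by linarith))
      (Set.Ioc_subset_Ioc_right hss)) (by rw [hU]; exact hinteg)
  rw [hU] at hlim
  refine hlim.congr' ?_
  filter_upwards [eventually_ge_atTop 0] with s hs
  rw [hB.covariance_backwardIntegral hH hBm hBc hf.continuous hs hh, setIntegral_prod]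
  exact IntegrableOn.mono_set hinteg (Set.prod_mono Set.Ioc_subset_Ioi_self Set.Ioc_subset_Ioi_self)

end FractionalBrownianMotion

/-- The autocovariance function of a stationary CARFIMA process. -/
lemma autocov_eq_kernelCov {Ω : Type*} [MeasurableSpace Ω] {P : Measure Ω} [IsProbabilityMeasure P]
    {p q : ℕ} {α β : ℕ → ℝ} {σ H : ℝ} (hH0 : 0 < H) (hH1 : H < 1)
    (hA : IsStable (companion p α)) {B : ℝ → Ω → ℝ} (hB : IsFractionalBrownianMotion H B P)
    {Y : ℝ → Ω → ℝ} (hY : IsCarfima p q α β σ B P Y) (hstat : IsStationary Y P) {t h : ℝ}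
    (ht : 0 ≤ t) (hh : 0 ≤ h) :
    autocov P Y t h =
      kernelCov (2 * H) (kernelDeriv2 (companion p α) σ (maVec p q β)) h := by
  set A := companion p α with hAdef
  set b := maVec p q β with hb
  obtain ⟨X, hX, hYX⟩ := hY
  obtain ⟨B', hBm, hBc, hBB⟩ := exists_continuous_modification (fun t ht => hB.aemeasurable ht)
    hB.paths
  have hB' := hB.congr hBB
  set f : ℝ → ℝ := fun u => σ * expForm A b (A.mulVec (delta p)) u with hf
  have hfd : ExpDecay f := (expDecay_expForm hA _ _).const_mul σ
  have hgd : ExpDecay (fun s => σ * expForm A b (delta p) s) :=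
    (expDecay_expForm hA _ _).const_mul σ
  set J := backwardIntegral f B' with hJ
  set m : ℝ → ℝ := fun s => α 0 * ∫ r in (0 : ℝ)..s, expForm A b (delta p) (s - r) with hm
  set W : ℝ → Ω → ℝ := fun s ω => dotProduct (Matrix.vecMul b (expA A s)) (X 0 ω) with hW
  set Z : ℝ → Ω → ℝ := fun s ω => σ * expForm A b (delta p) s * B' s ω with hZ
  have hrep : ∀ s, 0 ≤ s → Y s =ᵐ[P] fun ω => (J s + (W s + Z s)) ω + m s := by
    intro s hs
    filter_upwards [hYX s hs, hX.paths, hX.equation, hBB, hB'.start] with ω h1 h2 h3 h4 h5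
    rw [h1, dotProduct_solution_eq A b (x := fun s => X s ω) (B := fun s => B' s ω) (c := α 0)
      (σ := σ) (d := delta p) h2 (hBc ω).continuousOn h5 (fun t ht i => ?_) hs]
    · simp only [Pi.add_apply, hJ, hW, hZ, hm, backwardIntegral, hf]
      ring
    · rw [h4 t ht, h4 0 le_rfl]
      exact h3 t ht i
  have hJ2 : ∀ s, 0 ≤ s → MemLp (J s) 2 P := fun s hs =>
    hB'.memLp_backwardIntegral hH0 hBm hBc hfd.continuous hs
  have hZ2 : ∀ s, 0 ≤ s → MemLp (Z s) 2 P := fun s hs => (hB'.memLp hs).const_mul _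
  have hW2 : ∀ s, 0 ≤ s → MemLp (W s) 2 P := by
    intro s hs
    refine ((((hstat.memLp s hs).sub (hJ2 s hs)).sub (hZ2 s hs)).sub (memLp_const (m s))).ae_eq ?_
    filter_upwards [hrep s hs] with ω hω
    simp only [Pi.sub_apply, hω, Pi.add_apply]
    ring
  have hWv : Tendsto (fun s => variance (W s) P) atTop (𝓝 0) := by
    refine tendsto_variance_dotProduct ?_ ((eventually_ge_atTop 0).mono hW2)
    rw [tendsto_pi_nhds]
    intro j
    have := (expDecay_expForm hA b (Pi.single j 1)).tendsto_zero
    refine this.congr fun s => ?_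
    rw [expForm, Matrix.dotProduct_mulVec, dotProduct_single_one]
  have hZv : Tendsto (fun s => variance (Z s) P) atTop (𝓝 0) := by
    have h1 := (hgd.one_add_abs_pow_mul 1).tendsto_zero.pow 2
    rw [zero_pow two_ne_zero] at h1
    refine squeeze_zero' (Eventually.of_forall fun s => variance_nonneg _ _) ?_ h1
    filter_upwards [eventually_ge_atTop 0] with s hs
    have h2 : variance (B' s) P = s ^ (2 * H) := by
      rw [variance_eq_sub (hB'.memLp hs), hB'.mean s hs]
      have := hB'.kernel s s hs hs
      simp only [sub_self, abs_zero, Real.zero_rpow (by linarith : 2 * H ≠ 0),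
        abs_of_nonneg hs] at this
      simp only [Pi.pow_apply, sq, this]
      ring
    have h3 : s ^ (2 * H) ≤ (1 + |s|) ^ 2 := by
      have := abs_rpow_le_one_add_abs_sq (by linarith : 0 ≤ 2 * H) (by linarith) s
      rwa [abs_of_nonneg hs] at this ⊢
    simp only [hZ]
    rw [variance_const_mul, h2, pow_one, mul_pow (1 + |s|), mul_comm]
    exact mul_le_mul_of_nonneg_right h3 (sq_nonneg _)
  have hR2 : ∀ s, 0 ≤ s → MemLp (W s + Z s) 2 P := fun s hs => (hW2 s hs).add (hZ2 s hs)
  have hRv : Tendsto (fun s => variance (W s + Z s) P) atTop (𝓝 0) :=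
    tendsto_variance_add_zero ((eventually_ge_atTop 0).mono hW2) ((eventually_ge_atTop 0).mono hZ2)
      hWv hZv
  have hJv : ∃ L, Tendsto (fun s => variance (J s) P) atTop (𝓝 L) := by
    have h1 := hB'.tendsto_covariance_backwardIntegral hH0 hH1 hBm hBc hfd (h := 0) le_rfl
    refine ⟨_, h1.congr' ?_⟩
    filter_upwards [eventually_ge_atTop 0] with s hs
    rw [add_zero, covariance_self (hJ2 s hs).aestronglyMeasurable.aemeasurable]
  obtain ⟨L, hL⟩ := hJv
  have hshift : Tendsto (fun s : ℝ => s + h) atTop atTop :=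
    tendsto_atTop_add_const_right _ _ tendsto_id
  have hlim := tendsto_covariance_add (U₁ := fun s => J (s + h)) (U₂ := J)
    (R₁ := fun s => W (s + h) + Z (s + h)) (R₂ := fun s => W s + Z s)
    ((eventually_ge_atTop 0).mono fun s hs => hJ2 _ (by linarith))
    ((eventually_ge_atTop 0).mono hJ2)
    ((eventually_ge_atTop 0).mono fun s hs => hR2 _ (by linarith))
    ((eventually_ge_atTop 0).mono hR2) (hL.comp hshift) hL (hRv.comp hshift) hRv
    (hB'.tendsto_covariance_backwardIntegral hH0 hH1 hBm hBc hfd hh)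
  rw [integral_quadrant_expForm hA σ b (by linarith) (by linarith) h] at hlim
  refine tendsto_nhds_unique (tendsto_const_nhds.congr' ?_) hlim
  filter_upwards [eventually_ge_atTop 0] with s hs
  have hsh : 0 ≤ s + h := by linarith
  rw [hstat.cov t h ht hh, ← hstat.cov s h hs hh, autocov,
    covariance_congr_ae (hrep (s + h) hsh) (hrep s hs),
    covariance_add_const_left (((hJ2 _ hsh).add (hR2 _ hsh)).integrable one_le_two),
    covariance_add_const_right (((hJ2 _ hs).add (hR2 _ hs)).integrable one_le_two)]

section GammaIntegral

lemma norm_rpow_mul_cexp {t : ℝ} (ht : 0 < t) (s : ℝ) (z : ℂ) :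
    ‖((t ^ s : ℝ) : ℂ) * Complex.exp (z * t)‖ = t ^ s * Real.exp (z.re * t) := by
  rw [norm_mul, Complex.norm_real, Complex.norm_exp, Real.norm_of_nonneg (Real.rpow_nonneg ht.le s)]
  simp

lemma integrableOn_rpow_mul_cexp {s : ℝ} (hs : -1 < s) {z : ℂ} (hz : z.re < 0) :
    IntegrableOn (fun t : ℝ => ((t ^ s : ℝ) : ℂ) * Complex.exp (z * t)) (Set.Ioi 0) := by
  have hi : IntegrableOn (fun t : ℝ => t ^ s * Real.exp (-(-z.re) * t ^ (1 : ℝ))) (Set.Ioi 0) :=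
    integrableOn_rpow_mul_exp_neg_mul_rpow hs one_pos (by linarith)
  refine hi.mono' ?_ ?_
  · exact Measurable.aestronglyMeasurable (by fun_prop)
  · filter_upwards [ae_restrict_mem measurableSet_Ioi] with t ht
    rw [norm_rpow_mul_cexp ht, Real.rpow_one, neg_neg]

lemma hasDerivAt_integral_rpow_mul_cexp {s : ℝ} (hs : -1 < s) {r : ℂ} (hr : 0 < r.re) :
    HasDerivAt (fun r : ℂ => ∫ t in Set.Ioi (0 : ℝ), ((t ^ s : ℝ) : ℂ) * Complex.exp (-r * t))
      (∫ t in Set.Ioi (0 : ℝ), ((t ^ s : ℝ) : ℂ) * (Complex.exp (-r * t) * (-1 * t))) r := by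
  have hopen : IsOpen {w : ℂ | r.re / 2 < w.re} := isOpen_lt continuous_const Complex.continuous_re
  have hi : IntegrableOn (fun t : ℝ => t ^ (s + 1) * Real.exp (-(r.re / 2) * t ^ (1 : ℝ)))
      (Set.Ioi 0) :=
    integrableOn_rpow_mul_exp_neg_mul_rpow (by linarith) one_pos (by linarith)
  refine (hasDerivAt_integral_of_dominated_loc_of_deriv_le (𝕜 := ℂ)
    (F := fun (r : ℂ) (t : ℝ) => ((t ^ s : ℝ) : ℂ) * Complex.exp (-r * t))
    (F' := fun (r : ℂ) (t : ℝ) => ((t ^ s : ℝ) : ℂ) * (Complex.exp (-r * t) * (-1 * t)))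
    (hopen.mem_nhds (show r.re / 2 < r.re by linarith)) ?_ ?_ ?_ ?_ hi ?_).2
  · filter_upwards with w
    exact Measurable.aestronglyMeasurable (by fun_prop)
  · exact integrableOn_rpow_mul_cexp hs (by simpa using hr)
  · exact Measurable.aestronglyMeasurable (by fun_prop)
  · filter_upwards [ae_restrict_mem measurableSet_Ioi] with t ht w hw
    have ht' : (0 : ℝ) < t := ht
    have hw' : r.re / 2 < w.re := hw
    rw [← mul_assoc, norm_mul, norm_rpow_mul_cexp ht', Real.rpow_one, Real.rpow_add_one ht'.ne']
    simp only [neg_mul, one_mul, norm_neg, Complex.norm_real, Real.norm_of_nonneg ht'.le,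
      Complex.neg_re]
    calc t ^ s * Real.exp (-(w.re * t)) * t ≤ t ^ s * Real.exp (-(r.re / 2 * t)) * t := by gcongr
      _ = _ := by ring
  · filter_upwards with t w _
    have h1 : HasDerivAt (fun w : ℂ => -w * (t : ℂ)) (-1 * t) w :=
      (hasDerivAt_id w).neg.mul_const (t : ℂ)
    exact (h1.cexp).const_mul _

/-- Euler's integral with a complex rate. -/
lemma integral_rpow_mul_cexp_neg {a : ℝ} (ha : 0 < a) {r : ℂ} (hr : 0 < r.re) :
    ∫ t in Set.Ioi (0 : ℝ), ((t ^ (a - 1) : ℝ) : ℂ) * Complex.exp (-r * t) =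
      r ^ (-(a : ℂ)) * (Real.Gamma a : ℂ) := by
  have hopen : IsOpen {w : ℂ | 0 < w.re} := isOpen_lt continuous_const Complex.continuous_re
  have hF : AnalyticOnNhd ℂ (fun r : ℂ => ∫ t in Set.Ioi (0 : ℝ),
      ((t ^ (a - 1) : ℝ) : ℂ) * Complex.exp (-r * t)) {w : ℂ | 0 < w.re} := by
    refine DifferentiableOn.analyticOnNhd (fun w hw => ?_) hopen
    exact (hasDerivAt_integral_rpow_mul_cexp
      (by linarith) hw).differentiableAt.differentiableWithinAt
  have hG : AnalyticOnNhd ℂ (fun r : ℂ => r ^ (-(a : ℂ)) * (Real.Gamma a : ℂ))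
      {w : ℂ | 0 < w.re} := by
    refine DifferentiableOn.analyticOnNhd (fun w hw => ?_) hopen
    refine DifferentiableAt.differentiableWithinAt ?_
    refine DifferentiableAt.mul_const ?_ _
    exact differentiableAt_id.cpow_const (Or.inl hw)
  have hreal : ∀ x : ℝ, 0 < x → ∫ t in Set.Ioi (0 : ℝ),
      ((t ^ (a - 1) : ℝ) : ℂ) * Complex.exp (-(x : ℂ) * t) =
      (x : ℂ) ^ (-(a : ℂ)) * (Real.Gamma a : ℂ) := by
    intro x hx
    have h1 := Real.integral_rpow_mul_exp_neg_mul_Ioi ha hx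
    have h2 : ∫ t in Set.Ioi (0 : ℝ), ((t ^ (a - 1) : ℝ) : ℂ) * Complex.exp (-(x : ℂ) * t) =
        ((∫ t in Set.Ioi (0 : ℝ), t ^ (a - 1) * Real.exp (-(x * t)) : ℝ) : ℂ) := by
      rw [← integral_complex_ofReal]
      congr 1; funext t
      push_cast
      simp
    rw [h2, h1, one_div, Real.inv_rpow hx.le, ← Real.rpow_neg hx.le]
    push_cast
    rw [Complex.ofReal_cpow hx.le]
    simp
  have hfreq : ∃ᶠ w in 𝓝[≠] (1 : ℂ), (∫ t in Set.Ioi (0 : ℝ),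
      ((t ^ (a - 1) : ℝ) : ℂ) * Complex.exp (-w * t)) = w ^ (-(a : ℂ)) * (Real.Gamma a : ℂ) := by
    have hu : Tendsto (fun n : ℕ => (((1 : ℝ) + 1 / ((n : ℝ) + 1) : ℝ) : ℂ)) atTop
        (𝓝[≠] (1 : ℂ)) := by
      rw [tendsto_nhdsWithin_iff]
      constructor
      · have h1 : Tendsto (fun n : ℕ => (1 : ℝ) + 1 / ((n : ℝ) + 1)) atTop (𝓝 (1 + 0)) :=
          tendsto_const_nhds.add tendsto_one_div_add_atTop_nhds_zero_nat
        rw [add_zero] at h1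
        have h2 := (Complex.continuous_ofReal.tendsto 1).comp h1
        simpa only [Complex.ofReal_one, Function.comp_def] using h2
      · filter_upwards with n
        have : (1 : ℝ) + 1 / ((n : ℝ) + 1) ≠ 1 := by
          have : (0 : ℝ) < 1 / ((n : ℝ) + 1) := by positivity
          linarith
        simp only [Set.mem_compl_iff, Set.mem_singleton_iff]
        exact_mod_cast this
    refine hu.frequently (Eventually.frequently ?_)
    filter_upwards with n
    exact hreal _ (by positivity)
  have hpre : IsPreconnected {w : ℂ | 0 < w.re} := (convex_halfSpace_re_gt 0).isPreconnected
  exact hF.eqOn_of_preconnected_of_frequently_eq hG hpre (z₀ := 1) (by simp) hfreq hr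

end GammaIntegral

lemma intervalIntegrable_rpow_mul_cexp {s : ℝ} (hs : -1 < s) (z : ℂ) (h : ℝ) :
    IntervalIntegrable (fun t : ℝ => ((t ^ s : ℝ) : ℂ) * Complex.exp (z * t)) volume 0 h := by
  have h1 : IntervalIntegrable (fun t : ℝ => ((t ^ s : ℝ) : ℂ)) volume 0 h :=
    ⟨(intervalIntegral.intervalIntegrable_rpow' hs).1.ofReal,
      (intervalIntegral.intervalIntegrable_rpow' hs).2.ofReal⟩
  exact h1.mul_continuousOn (by fun_prop)

/-- The incomplete gamma function on a ray, as an integral over a real interval. -/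
lemma incGammaP_mul (a : ℝ) {z : ℂ} (hz : z ≠ 0) {h : ℝ} (hh : 0 ≤ h) :
    incGammaP a (z * h) = z ^ (a : ℂ) *
      (∫ u in (0 : ℝ)..h, ((u ^ (a - 1) : ℝ) : ℂ) * Complex.exp (-z * u)) / (Real.Gamma a : ℂ) := by
  rw [incGammaP]
  congr 1
  rcases hh.eq_or_lt with rfl | hh
  · simp
  have e : ∀ u : ℝ, 0 < u → Complex.exp (-((u : ℂ) * z)) * ((u : ℂ) * z) ^ ((a : ℂ) - 1) * z =
      z ^ (a : ℂ) * (((u ^ (a - 1) : ℝ) : ℂ) * Complex.exp (-z * u)) := by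
    intro u hu
    have h1 : ((u : ℂ) * z) ^ ((a : ℂ) - 1) = ((u ^ (a - 1) : ℝ) : ℂ) * z ^ ((a : ℂ) - 1) := by
      rw [Complex.cpow_def_of_ne_zero (mul_ne_zero (by exact_mod_cast hu.ne') hz),
        Complex.log_ofReal_mul hu hz, add_mul, Complex.exp_add,
        Complex.cpow_def_of_ne_zero hz, Real.rpow_def_of_pos hu]
      push_cast
      rfl
    have h2 : z ^ (a : ℂ) = z ^ ((a : ℂ) - 1) * z := by
      rw [Complex.cpow_sub _ _ hz, Complex.cpow_one, div_mul_cancel₀ _ hz]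
    rw [h1, h2, neg_mul, mul_comm z (u : ℂ)]
    ring
  have hsub := intervalIntegral.smul_integral_comp_mul_right (a := 0) (b := 1)
    (fun u : ℝ => Complex.exp (-((u : ℂ) * z)) * ((u : ℂ) * z) ^ ((a : ℂ) - 1) * z) h
  rw [zero_mul, one_mul] at hsub
  have hl : (∫ s in (0 : ℝ)..1, Complex.exp (-((s : ℂ) * (z * h))) *
      ((s : ℂ) * (z * h)) ^ ((a : ℂ) - 1) * (z * h)) =
      h • ∫ s in (0 : ℝ)..1, Complex.exp (-(((s * h : ℝ) : ℂ) * z)) *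
        (((s * h : ℝ) : ℂ) * z) ^ ((a : ℂ) - 1) * z := by
    rw [← intervalIntegral.integral_smul]
    congr 1
    funext s
    have : (s : ℂ) * (z * h) = ((s * h : ℝ) : ℂ) * z := by push_cast; ring
    rw [this, Complex.real_smul]
    ring
  rw [hl, hsub, intervalIntegral.integral_of_le hh.le, intervalIntegral.integral_of_le hh.le,
    ← integral_const_mul]
  exact setIntegral_congr_fun measurableSet_Ioc fun u hu => e u hu.1

section Companion

variable {p q : ℕ} {α β : ℕ → ℝ}

/-- The vector `(1, z, …, z^{p-1})`. -/
def powVec (p : ℕ) (z : ℂ) : Fin p → ℂ := fun i => z ^ (i : ℕ)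

lemma aeval_arPoly (p : ℕ) (α : ℕ → ℝ) (z : ℂ) :
    Polynomial.aeval z (arPoly p α) = z ^ p - ∑ j : Fin p, (α ((j : ℕ) + 1) : ℂ) * z ^ (j : ℕ) := by
  rw [Fin.sum_univ_eq_sum_range (fun j => (α (j + 1) : ℂ) * z ^ j) p]
  simp [arPoly]

lemma dotProduct_maVec_powVec (hqp : q < p) (β : ℕ → ℝ) (z : ℂ) :
    dotProduct (fun i => (maVec p q β i : ℂ)) (powVec p z) =
      Polynomial.aeval z (maPoly q β) := by
  have h1 : dotProduct (fun i => (maVec p q β i : ℂ)) (powVec p z) =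
      ∑ j ∈ Finset.range p, (maCoeff q β j : ℂ) * z ^ j := by
    rw [dotProduct, ← Fin.sum_univ_eq_sum_range (fun j => (maCoeff q β j : ℂ) * z ^ j) p]
    rfl
  have h2 : Polynomial.aeval z (maPoly q β) =
      ∑ j ∈ Finset.range (q + 1), (maCoeff q β j : ℂ) * z ^ j := by
    simp [maPoly]
  rw [h1, h2]
  refine (Finset.sum_subset (Finset.range_mono hqp) fun j _ hj => ?_).symm
  have hj' : q < j := by simpa [Nat.lt_succ_iff] using hj
  have : maCoeff q β j = 0 := by
    rw [maCoeff, if_neg (by omega), if_neg (by omega)]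
  simp [this]

lemma companionC_mulVec_of_lt (α : ℕ → ℝ) (x : Fin p → ℂ) (i : Fin p) (hi : (i : ℕ) + 1 < p) :
    (companionC p α).mulVec x i = x ⟨i + 1, hi⟩ := by
  rw [Matrix.mulVec, dotProduct, Finset.sum_eq_single ⟨i + 1, hi⟩]
  · simp [companionC, companion, hi.ne]
  · intro j _ hj
    have : (j : ℕ) ≠ i + 1 := fun e => hj (Fin.ext e)
    simp [companionC, companion, hi.ne, this]
  · simp

lemma companionC_mulVec_of_eq (α : ℕ → ℝ) (x : Fin p → ℂ) (i : Fin p) (hi : (i : ℕ) + 1 = p) :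
    (companionC p α).mulVec x i = ∑ j : Fin p, (α ((j : ℕ) + 1) : ℂ) * x j := by
  simp [Matrix.mulVec, dotProduct, companionC, companion, hi]

lemma companionC_mulVec_powVec (α : ℕ → ℝ) (z : ℂ)
    (hz : Polynomial.aeval z (arPoly p α) = 0) :
    (companionC p α).mulVec (powVec p z) = z • powVec p z := by
  funext i
  rcases (Nat.succ_le_of_lt i.2).lt_or_eq with hi | hi
  · rw [companionC_mulVec_of_lt α _ i hi]
    simp [powVec, pow_succ']
  · rw [companionC_mulVec_of_eq α _ i hi]
    rw [aeval_arPoly, sub_eq_zero] at hz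
    simp only [powVec, Pi.smul_apply, smul_eq_mul, ← pow_succ']
    rw [← hz]
    congr 1
    exact hi.symm

/-- Eigenvalues of the companion matrix are roots of the autoregressive polynomial. -/
lemma aeval_arPoly_of_mem_spectrum {z : ℂ} (hz : z ∈ spectrum ℂ (companionC p α)) :
    Polynomial.aeval z (arPoly p α) = 0 := by
  rw [← Matrix.spectrum_toLin', ← Module.End.hasEigenvalue_iff_mem_spectrum] at hz
  obtain ⟨x, hx, hx0⟩ := hz.exists_hasEigenvector
  rw [Module.End.mem_eigenspace_iff, Matrix.toLin'_apply] at hx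
  have hp : 0 < p := by
    rcases Nat.eq_zero_or_pos p with rfl | hp
    · exact absurd (Subsingleton.elim x 0) hx0
    · exact hp
  have hpow : ∀ n (hn : n < p), x ⟨n, hn⟩ = z ^ n * x ⟨0, hp⟩ := by
    intro n
    induction n with
    | zero => intro _; simp
    | succ n ih =>
      intro hn
      have h1 := congrFun hx ⟨n, by omega⟩
      rw [companionC_mulVec_of_lt α x ⟨n, by omega⟩ hn] at h1
      rw [h1, Pi.smul_apply, ih (by omega), smul_eq_mul, pow_succ']
      ring
  have h0 : x ⟨0, hp⟩ ≠ 0 := by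
    intro h
    refine hx0 (funext fun i => ?_)
    have := hpow i i.2
    simpa [h] using this
  have hlast := congrFun hx ⟨p - 1, by omega⟩
  rw [companionC_mulVec_of_eq α x _ (Nat.sub_add_cancel hp), Pi.smul_apply, hpow,
    smul_eq_mul] at hlast
  refine (mul_eq_zero.1 (?_ : Polynomial.aeval z (arPoly p α) * x ⟨0, hp⟩ = 0)).resolve_right h0
  rw [aeval_arPoly, sub_mul, Finset.sum_mul, sub_eq_zero]
  calc z ^ p * x ⟨0, hp⟩ = z * (z ^ (p - 1) * x ⟨0, hp⟩) := by
        rw [← mul_assoc, ← pow_succ', Nat.sub_add_cancel hp]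
    _ = _ := by
        rw [← hlast]
        refine Finset.sum_congr rfl fun j _ => ?_
        rw [show x j = _ from hpow j j.2]
        ring

lemma degree_sum_C_mul_X_pow_lt (c : ℕ → ℝ) (n : ℕ) :
    (∑ j ∈ Finset.range n, Polynomial.C (c j) * Polynomial.X ^ j : Polynomial ℝ).degree < n := by
  rw [← Polynomial.mem_degreeLT]
  refine Submodule.sum_mem _ fun j hj => Polynomial.mem_degreeLT.2 ?_
  refine (Polynomial.degree_C_mul_X_pow_le j _).trans_lt ?_
  exact_mod_cast Finset.mem_range.1 hj

lemma map_arPoly_eq_nodal {l : Fin p → ℂ} (hl : Function.Injective l)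
    (hroot : ∀ i, Polynomial.aeval (l i) (arPoly p α) = 0) :
    (arPoly p α).map (algebraMap ℝ ℂ) = Lagrange.nodal Finset.univ l := by
  have hdeg : (∑ j ∈ Finset.range p, Polynomial.C (α (j + 1)) * Polynomial.X ^ j :
      Polynomial ℝ).degree < p :=
    degree_sum_C_mul_X_pow_lt (fun j => α (j + 1)) p
  have hmonic : ((arPoly p α).map (algebraMap ℝ ℂ)).Monic :=
    (Polynomial.monic_X_pow_sub hdeg).map _
  have hd : ((arPoly p α).map (algebraMap ℝ ℂ)).degree = p := by
    rw [Polynomial.degree_map, arPoly, Polynomial.degree_sub_eq_left_of_degree_lt,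
      Polynomial.degree_X_pow]
    rwa [Polynomial.degree_X_pow]
  have hn : (Lagrange.nodal Finset.univ l).degree = p := by
    rw [Lagrange.degree_nodal, Finset.card_univ, Fintype.card_fin]
  refine Polynomial.eq_of_degree_sub_lt_of_eval_index_eq Finset.univ hl.injOn ?_ ?_
  · rw [Finset.card_univ, Fintype.card_fin, ← hd]
    refine Polynomial.degree_sub_lt_left (hd.trans hn.symm) hmonic.ne_zero ?_
    rw [hmonic.leadingCoeff, Lagrange.nodal_monic.leadingCoeff]
  · intro i hi
    rw [Polynomial.eval_map_algebraMap, hroot, Lagrange.eval_nodal_at_node hi]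

lemma nodalWeight_eq {l : Fin p → ℂ} (hl : Function.Injective l)
    (hroot : ∀ i, Polynomial.aeval (l i) (arPoly p α) = 0) (i : Fin p) :
    Lagrange.nodalWeight Finset.univ l i =
      (Polynomial.aeval (l i) (Polynomial.derivative (arPoly p α)))⁻¹ := by
  rw [Lagrange.nodalWeight_eq_eval_derivative_nodal (Finset.mem_univ i),
    ← map_arPoly_eq_nodal hl hroot, Polynomial.derivative_map, Polynomial.eval_map_algebraMap]

lemma delta_eq_sum {l : Fin p → ℂ} (hl : Function.Injective l)
    (hroot : ∀ i, Polynomial.aeval (l i) (arPoly p α) = 0) :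
    (fun j => (delta p j : ℂ)) = ∑ i,
      (Polynomial.aeval (l i) (Polynomial.derivative (arPoly p α)))⁻¹ • powVec p (l i) := by
  funext j
  have h := Lagrange.coeff_eq_sum (s := Finset.univ) (v := l) hl.injOn
    (P := (Polynomial.X ^ (j : ℕ) : Polynomial ℂ)) (by
      rw [Polynomial.degree_X_pow, Finset.card_univ, Fintype.card_fin]
      exact_mod_cast j.2)
  rw [Finset.card_univ, Fintype.card_fin, Polynomial.coeff_X_pow] at h
  have hδ : (delta p j : ℂ) = if p - 1 = (j : ℕ) then 1 else 0 := by
    have : ((j : ℕ) + 1 = p) ↔ (p - 1 = (j : ℕ)) := by have := j.2; omega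
    simp only [delta, this]
    split_ifs <;> simp
  rw [hδ, h, Finset.sum_apply]
  refine Finset.sum_congr rfl fun i _ => ?_
  rw [← nodalWeight_eq hl hroot, Lagrange.nodalWeight, Finset.prod_inv_distrib]
  simp [powVec, div_eq_mul_inv, mul_comm]

/-- The partial fraction expansion of `β(z) / α(z)`. -/
lemma sum_div_eq_aeval_div (hqp : q < p) {l : Fin p → ℂ} (hl : Function.Injective l)
    (hroot : ∀ i, Polynomial.aeval (l i) (arPoly p α) = 0) {z : ℂ} (hz : ∀ i, z ≠ l i) :
    ∑ i, Polynomial.aeval (l i) (maPoly q β) /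
      Polynomial.aeval (l i) (Polynomial.derivative (arPoly p α)) / (z - l i) =
      Polynomial.aeval z (maPoly q β) / Polynomial.aeval z (arPoly p α) := by
  have hdeg : ((maPoly q β).map (algebraMap ℝ ℂ)).degree < (Finset.univ : Finset (Fin p)).card := by
    rw [Polynomial.degree_map, Finset.card_univ, Fintype.card_fin]
    exact (degree_sum_C_mul_X_pow_lt (maCoeff q β) (q + 1)).trans_le (by exact_mod_cast hqp)
  have h1 := congrArg (Polynomial.eval z) (Lagrange.eq_interpolate hl.injOn hdeg)
  rw [Lagrange.eval_interpolate_not_at_node _ (fun i _ => hz i), ← map_arPoly_eq_nodal hl hroot,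
    Polynomial.eval_map_algebraMap, Polynomial.eval_map_algebraMap] at h1
  have hne : Polynomial.aeval z (arPoly p α) ≠ 0 := by
    rw [← Polynomial.eval_map_algebraMap, map_arPoly_eq_nodal hl hroot, Lagrange.eval_nodal]
    exact Finset.prod_ne_zero_iff.2 fun i _ => sub_ne_zero.2 (hz i)
  rw [h1, mul_div_cancel_left₀ _ hne]
  refine Finset.sum_congr rfl fun i _ => ?_
  rw [nodalWeight_eq hl hroot, Polynomial.eval_map_algebraMap]
  ring

lemma eval_zero_maPoly (q : ℕ) (β : ℕ → ℝ) : (maPoly q β).eval 0 = 1 := by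
  rw [maPoly, Polynomial.eval_finsetSum, Finset.sum_range_succ']
  simp [maCoeff]

lemma eval_zero_arPoly (hp : 0 < p) : (arPoly p α).eval 0 = -α 1 := by
  obtain ⟨n, rfl⟩ : ∃ n, p = n + 1 := ⟨p - 1, by omega⟩
  rw [arPoly, Polynomial.eval_sub, Polynomial.eval_finsetSum, Finset.sum_range_succ']
  simp

/-- The coefficient `β(0) / α(0)` in terms of the companion matrix. -/
lemma dotProduct_inv_mulVec_delta (hp : 0 < p) (hα : α 1 ≠ 0)
    (hdet : IsUnit (companion p α).det) :
    dotProduct (maVec p q β) ((companion p α)⁻¹.mulVec (delta p)) ^ 2 =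
      (maPoly q β).eval 0 ^ 2 / (arPoly p α).eval 0 ^ 2 := by
  have h1 : (companion p α).mulVec (Pi.single ⟨0, hp⟩ 1) = α 1 • delta p := by
    funext i
    simp only [Matrix.mulVec_single_one, Matrix.col_apply, companion, Matrix.of_apply, delta,
      Pi.smul_apply, smul_eq_mul]
    split_ifs <;> simp_all
  have h2 : (companion p α)⁻¹.mulVec (delta p) = (α 1)⁻¹ • Pi.single ⟨0, hp⟩ (1 : ℝ) := by
    have h3 : delta p = (companion p α).mulVec ((α 1)⁻¹ • Pi.single ⟨0, hp⟩ (1 : ℝ)) := by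
      rw [Matrix.mulVec_smul, h1, smul_smul, inv_mul_cancel₀ hα, one_smul]
    rw [h3, Matrix.mulVec_mulVec, Matrix.nonsing_inv_mul _ hdet, Matrix.one_mulVec]
  rw [h2, eval_zero_maPoly, eval_zero_arPoly hp, dotProduct_smul, dotProduct_single_one]
  simp [maVec, maCoeff]

end Companion

section ExponentialSums

variable {p q : ℕ} {α β : ℕ → ℝ}

lemma expForm_delta_eq_sum (hqp : q < p) {l : Fin p → ℂ} (hl : Function.Injective l)
    (hroot : ∀ i, Polynomial.aeval (l i) (arPoly p α) = 0) (t : ℝ) :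
    (expForm (companion p α) (maVec p q β) (delta p) t : ℂ) =
      ∑ i, Polynomial.aeval (l i) (maPoly q β) /
        Polynomial.aeval (l i) (Polynomial.derivative (arPoly p α)) * Complex.exp (l i * t) := by
  rw [← expFormC_ofReal, delta_eq_sum hl hroot, expFormC_sum_right]
  refine Finset.sum_congr rfl fun i _ => ?_
  rw [expFormC_smul_right, expFormC_eigenvector _ _ _ (l i)
    (companionC_mulVec_powVec α _ (hroot i)), dotProduct_maVec_powVec hqp]
  ring

lemma expForm_mulVec_delta_eq_sum (hqp : q < p) {l : Fin p → ℂ} (hl : Function.Injective l)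
    (hroot : ∀ i, Polynomial.aeval (l i) (arPoly p α) = 0) (t : ℝ) :
    (expForm (companion p α) (maVec p q β) ((companion p α).mulVec (delta p)) t : ℂ) =
      ∑ i, Polynomial.aeval (l i) (maPoly q β) /
        Polynomial.aeval (l i) (Polynomial.derivative (arPoly p α)) *
          (Complex.exp (l i * t) * l i) := by
  have h1 := (hasDerivAt_expForm (companion p α) (maVec p q β) (delta p) t).ofReal_comp
  have h2 : HasDerivAt (fun t : ℝ => ∑ i, Polynomial.aeval (l i) (maPoly q β) /
        Polynomial.aeval (l i) (Polynomial.derivative (arPoly p α)) * Complex.exp (l i * t))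
      (∑ i, Polynomial.aeval (l i) (maPoly q β) /
        Polynomial.aeval (l i) (Polynomial.derivative (arPoly p α)) *
          (Complex.exp (l i * t) * l i)) t := by
    refine HasDerivAt.fun_sum fun i _ => HasDerivAt.const_mul _ ?_
    have h3 : HasDerivAt (fun t : ℝ => l i * (t : ℂ)) (l i) t := by
      simpa using (Complex.ofRealCLM.hasDerivAt (x := t)).const_mul (l i)
    exact h3.cexp
  simp only [expForm_delta_eq_sum hqp hl hroot] at h1
  exact h1.unique h2

/-- The antiderivative of the covariance kernel as a sum of exponentials. -/
lemma expForm_mulVec_vStar_eq_sum (hA : IsStable (companion p α)) (hqp : q < p) (σ : ℝ)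
    {l : Fin p → ℂ} (hl : Function.Injective l) (hre : ∀ i, (l i).re < 0)
    (hroot : ∀ i, Polynomial.aeval (l i) (arPoly p α) = 0) (w : ℝ) :
    (expForm (companion p α) (maVec p q β) ((companion p α).mulVec
        ((vStar (companion p α) σ).mulVec (maVec p q β))) w : ℂ) =
      ∑ i, (σ : ℂ) ^ 2 * (Polynomial.aeval (l i) (maPoly q β) *
          Polynomial.aeval (-l i) (maPoly q β) /
        (Polynomial.aeval (l i) (Polynomial.derivative (arPoly p α)) *
          Polynomial.aeval (-l i) (arPoly p α)) * l i) * Complex.exp (l i * w) := by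
  set a : Fin p → ℂ := fun i => Polynomial.aeval (l i) (maPoly q β) /
        Polynomial.aeval (l i) (Polynomial.derivative (arPoly p α)) with ha
  have hij : ∀ i j, (l i + l j).re < 0 := fun i j => by
    rw [Complex.add_re]; linarith [hre i, hre j]
  have hterm : ∀ i j, IntegrableOn
      (fun u : ℝ => a i * l i * Complex.exp (l i * w) * a j * Complex.exp ((l i + l j) * u))
      (Set.Ioi 0) := fun i j =>
    (integrableOn_exp_mul_complex_Ioi (hij i j) 0).const_mul _
  have hinteg : ∫ u in Set.Ioi (0 : ℝ), ((expForm (companion p α) (maVec p q β)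
      ((companion p α).mulVec (delta p)) (u + w) *
      expForm (companion p α) (maVec p q β) (delta p) u : ℝ) : ℂ) =
      ∑ i, ∑ j, a i * l i * Complex.exp (l i * w) * a j * (-1 / (l i + l j)) := by
    have e : ∀ u : ℝ, ((expForm (companion p α) (maVec p q β)
        ((companion p α).mulVec (delta p)) (u + w) *
        expForm (companion p α) (maVec p q β) (delta p) u : ℝ) : ℂ) =
        ∑ i, ∑ j, a i * l i * Complex.exp (l i * w) * a j * Complex.exp ((l i + l j) * u) := by
      intro u
      rw [Complex.ofReal_mul, expForm_mulVec_delta_eq_sum hqp hl hroot,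
        expForm_delta_eq_sum hqp hl hroot, Finset.sum_mul_sum]
      refine Finset.sum_congr rfl fun i _ => Finset.sum_congr rfl fun j _ => ?_
      push_cast
      rw [mul_add, add_mul, Complex.exp_add, Complex.exp_add]
      ring
    simp only [e]
    rw [integral_finsetSum _ fun i _ => integrable_finsetSum _ fun j _ => hterm i j]
    refine Finset.sum_congr rfl fun i _ => ?_
    rw [integral_finsetSum _ fun j _ => hterm i j]
    refine Finset.sum_congr rfl fun j _ => ?_
    rw [integral_const_mul, integral_exp_mul_complex_Ioi (hij i j)]
    simp
  have hcomm : ∀ t, companion p α * expA (companion p α) t =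
      expA (companion p α) t * companion p α := fun t => (expA_commute _ t).symm
  rw [expForm_mul_vStar hA σ _ hcomm, Complex.ofReal_mul, ← integral_complex_ofReal, hinteg,
    Finset.mul_sum]
  push_cast
  refine Finset.sum_congr rfl fun i _ => ?_
  have hpf := sum_div_eq_aeval_div (β := β) hqp hl hroot (z := -l i) (fun j h => by
    have h1 := congrArg Complex.re h
    rw [Complex.neg_re] at h1
    linarith [hre i, hre j])
  have hs : ∑ j, a i * l i * Complex.exp (l i * w) * a j * (-1 / (l i + l j)) =
      a i * l i * Complex.exp (l i * w) * (Polynomial.aeval (-l i) (maPoly q β) /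
        Polynomial.aeval (-l i) (arPoly p α)) := by
    rw [← hpf, Finset.mul_sum]
    refine Finset.sum_congr rfl fun j _ => ?_
    rw [show -l i - l j = -(l i + l j) by ring, div_neg, neg_div, one_div]
    simp only [ha]
    ring
  rw [hs]
  simp only [ha]
  ring

end ExponentialSums

/-- The covariance of a kernel that is a sum of exponentials. -/
lemma kernelCov_eq_sum_uFun {ι : Type*} [Fintype ι] {H : ℝ} (hH0 : 0 < H) (hH1 : H < 1)
    {k θ : ℝ → ℝ} (hk : ExpDecay k) (hθ : ExpDecay θ) (hd : ∀ t, HasDerivAt θ (k t) t)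
    {l c : ι → ℂ} (hre : ∀ i, (l i).re < 0)
    (hsum : ∀ w, (θ w : ℂ) = ∑ i, c i * l i * Complex.exp (l i * w)) {h : ℝ} (hh : 0 ≤ h) :
    (kernelCov (2 * H) k h : ℂ) =
      (Real.Gamma (2 * H + 1) : ℂ) / 2 * ∑ i, c i * uFun H (l i) h := by
  have hs : -1 < 2 * H - 1 := by linarith
  have ha : 0 < 2 * H := by linarith
  have hΓ : (Real.Gamma (2 * H) : ℂ) ≠ 0 := by exact_mod_cast (Real.Gamma_pos_of_pos ha).ne'
  set E : ℂ → ℂ := fun z => ∫ u in Set.Ioi (0 : ℝ), ((u ^ (2 * H - 1) : ℝ) : ℂ) *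
    Complex.exp (z * u) with hE
  set F : ℂ → ℂ := fun z => ∫ u in (0 : ℝ)..h, ((u ^ (2 * H - 1) : ℝ) : ℂ) *
    Complex.exp (z * u) with hF
  have hfin : ∀ z : ℂ, IntegrableOn (fun u : ℝ => ((u ^ (2 * H - 1) : ℝ) : ℂ) *
      Complex.exp (z * u)) (Set.Ioc 0 h) := fun z =>
    (intervalIntegrable_iff_integrableOn_Ioc_of_le hh).1 (intervalIntegrable_rpow_mul_cexp hs z h)
  have hinf : ∀ i, IntegrableOn (fun u : ℝ => ((u ^ (2 * H - 1) : ℝ) : ℂ) *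
      Complex.exp (l i * u)) (Set.Ioi 0) := fun i => integrableOn_rpow_mul_cexp hs (hre i)
  have h1 : ((∫ u in Set.Ioc 0 h, u ^ (2 * H - 1) * θ (h - u) : ℝ) : ℂ) =
      ∑ i, c i * l i * Complex.exp (l i * h) * F (-l i) := by
    have e : ∀ u : ℝ, ((u ^ (2 * H - 1) * θ (h - u) : ℝ) : ℂ) = ∑ i,
        c i * l i * Complex.exp (l i * h) *
          (((u ^ (2 * H - 1) : ℝ) : ℂ) * Complex.exp (-l i * u)) := by
      intro u
      rw [Complex.ofReal_mul, hsum, Finset.mul_sum]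
      refine Finset.sum_congr rfl fun i _ => ?_
      rw [show l i * ((h - u : ℝ) : ℂ) = l i * h + -l i * u by push_cast; ring, Complex.exp_add]
      ring
    rw [← integral_complex_ofReal]
    simp only [e]
    rw [integral_finsetSum _ fun i _ => (hfin (-l i)).const_mul _]
    refine Finset.sum_congr rfl fun i _ => ?_
    rw [integral_const_mul, ← intervalIntegral.integral_of_le hh]
  have h2 : ((∫ u in Set.Ioi h, u ^ (2 * H - 1) * θ (u - h) : ℝ) : ℂ) =
      ∑ i, c i * l i * Complex.exp (-(l i * h)) * (E (l i) - F (l i)) := by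
    have e : ∀ u : ℝ, ((u ^ (2 * H - 1) * θ (u - h) : ℝ) : ℂ) = ∑ i,
        c i * l i * Complex.exp (-(l i * h)) *
          (((u ^ (2 * H - 1) : ℝ) : ℂ) * Complex.exp (l i * u)) := by
      intro u
      rw [Complex.ofReal_mul, hsum, Finset.mul_sum]
      refine Finset.sum_congr rfl fun i _ => ?_
      rw [show l i * ((u - h : ℝ) : ℂ) = -(l i * h) + l i * u by push_cast; ring, Complex.exp_add]
      ring
    have hinf' := fun i => (hinf i).mono_set (Set.Ioi_subset_Ioi hh)
    rw [← integral_complex_ofReal]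
    simp only [e]
    rw [integral_finsetSum _ fun i _ => (hinf' i).const_mul _]
    refine Finset.sum_congr rfl fun i _ => ?_
    rw [integral_const_mul]
    congr 1
    rw [eq_sub_iff_add_eq', hF, hE]
    simp only
    rw [intervalIntegral.integral_of_le hh, ← Set.Ioc_union_Ioi_eq_Ioi hh,
      setIntegral_union (Set.Ioc_disjoint_Ioi le_rfl) measurableSet_Ioi (hfin _) (hinf' i)]
  have h3 : ((∫ u in Set.Ioi 0, u ^ (2 * H - 1) * θ (u + h) : ℝ) : ℂ) =
      ∑ i, c i * l i * Complex.exp (l i * h) * E (l i) := by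
    have e : ∀ u : ℝ, ((u ^ (2 * H - 1) * θ (u + h) : ℝ) : ℂ) = ∑ i,
        c i * l i * Complex.exp (l i * h) *
          (((u ^ (2 * H - 1) : ℝ) : ℂ) * Complex.exp (l i * u)) := by
      intro u
      rw [Complex.ofReal_mul, hsum, Finset.mul_sum]
      refine Finset.sum_congr rfl fun i _ => ?_
      rw [show l i * ((u + h : ℝ) : ℂ) = l i * h + l i * u by push_cast; ring, Complex.exp_add]
      ring
    rw [← integral_complex_ofReal]
    simp only [e]
    rw [integral_finsetSum _ fun i _ => (hinf i).const_mul _]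
    refine Finset.sum_congr rfl fun i _ => ?_
    rw [integral_const_mul]
  have hu : ∀ i, (Real.Gamma (2 * H) : ℂ) * uFun H (l i) h =
      l i * Complex.exp (l i * h) * F (-l i)
        - l i * Complex.exp (-(l i * h)) * (E (l i) - F (l i))
        - l i * Complex.exp (l i * h) * E (l i) := by
    intro i
    have hl0 : l i ≠ 0 := fun h0 => by simpa [h0] using hre i
    have hE' : (-l i) ^ (1 - 2 * (H : ℂ)) * (Real.Gamma (2 * H) : ℂ) = -l i * E (l i) := by
      have := integral_rpow_mul_cexp_neg ha (r := -l i) (by simpa using hre i)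
      simp only [neg_neg] at this
      simp only [hE]
      rw [this, sub_eq_add_neg, Complex.cpow_add _ _ (neg_ne_zero.2 hl0), Complex.cpow_one]
      push_cast
      ring
    have hpow : ∀ z : ℂ, z ≠ 0 → z ^ (1 - 2 * (H : ℂ)) * z ^ (((2 * H : ℝ)) : ℂ) = z := by
      intro z hz
      rw [← Complex.cpow_add _ _ hz]
      push_cast
      rw [sub_add_cancel, Complex.cpow_one]
    have hP1 := incGammaP_mul (2 * H) hl0 hh
    have hP2 := incGammaP_mul (2 * H) (neg_ne_zero.2 hl0) hh
    rw [neg_mul, neg_neg] at hP2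
    have hq1 : (Real.Gamma (2 * H) : ℂ) *
        (l i ^ (1 - 2 * (H : ℂ)) * Complex.exp (l i * h) * incGammaP (2 * H) (l i * h)) =
        l i * Complex.exp (l i * h) * F (-l i) := by
      rw [hP1]
      calc _ = (l i ^ (1 - 2 * (H : ℂ)) * l i ^ (((2 * H : ℝ)) : ℂ)) * Complex.exp (l i * h) *
            F (-l i) * ((Real.Gamma (2 * H) : ℂ) / (Real.Gamma (2 * H) : ℂ)) := by ring
        _ = _ := by rw [hpow _ hl0, div_self hΓ, mul_one]
    have hq2 : (Real.Gamma (2 * H) : ℂ) * ((-l i) ^ (1 - 2 * (H : ℂ)) *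
        Complex.exp (-(l i * h)) * incGammaP (2 * H) (-(l i * h))) =
        -l i * Complex.exp (-(l i * h)) * F (l i) := by
      rw [hP2]
      calc _ = ((-l i) ^ (1 - 2 * (H : ℂ)) * (-l i) ^ (((2 * H : ℝ)) : ℂ)) *
            Complex.exp (-(l i * h)) *
            F (l i) * ((Real.Gamma (2 * H) : ℂ) / (Real.Gamma (2 * H) : ℂ)) := by ring
        _ = _ := by rw [hpow _ (neg_ne_zero.2 hl0), div_self hΓ, mul_one]
    have hcosh : 2 * Complex.cosh (l i * h) =
        Complex.exp (l i * h) + Complex.exp (-(l i * h)) := by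
      rw [Complex.cosh]; ring
    rw [uFun, mul_sub, mul_add, hq1, hq2]
    linear_combination (2 * Complex.cosh (l i * h)) * hE' - l i * E (l i) * hcosh
  have hΓ1 : (Real.Gamma (2 * H + 1) : ℂ) = 2 * H * (Real.Gamma (2 * H) : ℂ) := by
    rw [Real.Gamma_add_one ha.ne']; push_cast; ring
  rw [kernelCov_eq_sub_sub ha (by linarith) hk hθ hd hh, hΓ1, Finset.mul_sum]
  push_cast [h1, h2, h3]
  rw [mul_div_cancel_left₀ (H : ℂ) two_ne_zero, Finset.mul_sum, Finset.mul_sum, Finset.mul_sum,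
    ← Finset.sum_sub_distrib, ← Finset.sum_sub_distrib]
  refine Finset.sum_congr rfl fun i _ => ?_
  linear_combination (-(H : ℂ) * c i) * hu i

lemma IsAntipersistent.congr {γ γ' : ℝ → ℝ} (h : IsAntipersistent γ)
    (he : ∀ x, 0 ≤ x → γ' x = γ x) : IsAntipersistent γ' := by
  have hon : Set.EqOn γ γ' (Set.Ioi 0) := fun x hx => (he x (le_of_lt hx)).symm
  refine ⟨h.1.congr_fun hon measurableSet_Ioi, ?_, ?_⟩
  · rw [← setIntegral_congr_fun measurableSet_Ioi hon, h.2.1]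
  · filter_upwards [h.2.2, eventually_ge_atTop 0] with x hx h0
    rwa [he x h0]

lemma IsLongMemory.congr {γ γ' : ℝ → ℝ} (h : IsLongMemory γ)
    (he : ∀ x, 0 ≤ x → γ' x = γ x) : IsLongMemory γ' := by
  refine ⟨?_, h.2.congr' ?_⟩
  · filter_upwards [h.1, eventually_ge_atTop 0] with x hx h0
    rwa [he x h0]
  · filter_upwards [eventually_ge_atTop 0] with T hT
    refine intervalIntegral.integral_congr fun x hx => ?_
    rw [Set.uIcc_of_le hT] at hx
    exact (he x hx.1).symm

end Carfima

theorem theorem2 {Ω : Type*} [MeasurableSpace Ω] (P : Measure Ω) [IsProbabilityMeasure P]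
    (p q : ℕ) (hqp : q < p) (α β : ℕ → ℝ) (σ H : ℝ)
    (hH0 : 0 < H) (hH1 : H < 1) (hσ : 0 < σ) (hα : α 1 ≠ 0) (hβ : Carfima.maCoeff q β q ≠ 0)
    (hstable : ∀ z ∈ spectrum ℂ (Carfima.companionC p α), z.re < 0)
    (B : ℝ → Ω → ℝ) (hB : Carfima.IsFractionalBrownianMotion H B P)
    (Y : ℝ → Ω → ℝ) (hY : Carfima.IsCarfima p q α β σ B P Y)
    (hstat : Carfima.IsStationary Y P)
    (A V : Matrix (Fin p) (Fin p) ℝ) (hA : A = Carfima.companion p α)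
    (hV : V = Carfima.vStar A σ) (b : Fin p → ℝ) (hb : b = Carfima.maVec p q β)
    (t : ℝ) (ht : 0 ≤ t) :
    -- (a)
    (Carfima.MatIntegrableOn (Carfima.vStarIntegrand A σ) (Set.Ioi 0) ∧
      ∀ h : ℝ, 0 ≤ h →
        Carfima.MatIntegrableOn (fun u => u ^ (2 * H - 1) • Carfima.expA A (-u)) (Set.Ioc 0 h) ∧
        Carfima.MatIntegrableOn (fun u => u ^ (2 * H - 1) • Carfima.expA A u) (Set.Ioi 0) ∧
        Carfima.autocov P Y t h =
          H * dotProduct b ((A * Carfima.expA A h *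
            Carfima.matIntegral (fun u => u ^ (2 * H - 1) • Carfima.expA A (-u)) (Set.Ioc 0 h) *
            V).mulVec b)
          - H * dotProduct b ((A * Carfima.expA A (-h) *
            Carfima.matIntegral (fun u => u ^ (2 * H - 1) • Carfima.expA A u) (Set.Ioi h) *
            V).mulVec b)
          - H * dotProduct b ((A * Carfima.expA A h *
            Carfima.matIntegral (fun u => u ^ (2 * H - 1) • Carfima.expA A u) (Set.Ioi 0) *
            V).mulVec b)) ∧
    -- (b)
    (∀ l : Fin p → ℂ, Function.Injective l → Set.range l = spectrum ℂ (Carfima.companionC p α) →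
      ∀ h : ℝ, 0 ≤ h →
        (Carfima.autocov P Y t h : ℂ) =
          (σ : ℂ) ^ 2 / 2 * (Real.Gamma (2 * H + 1) : ℂ) *
            ∑ i : Fin p,
              Polynomial.aeval (l i) (Carfima.maPoly q β) *
                  Polynomial.aeval (-l i) (Carfima.maPoly q β) /
                (Polynomial.aeval (l i) (Polynomial.derivative (Carfima.arPoly p α)) *
                  Polynomial.aeval (-l i) (Carfima.arPoly p α)) *
                Carfima.uFun H (l i) h) ∧
    -- (c)
    (H ≠ 1 / 2 →
      Tendsto (fun h : ℝ => Carfima.autocov P Y t h /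
          (σ ^ 2 * H * (2 * H - 1) *
            ((Carfima.maPoly q β).eval 0 ^ 2 / (Carfima.arPoly p α).eval 0 ^ 2) *
            h ^ (2 * H - 2)))
        atTop (𝓝 1)) ∧
    (H < 1 / 2 → Carfima.IsAntipersistent (Carfima.autocov P Y t)) ∧
    (1 / 2 < H → Carfima.IsLongMemory (Carfima.autocov P Y t)) := by
  subst hA hV hb
  have hst : Carfima.IsStable (Carfima.companion p α) := hstable
  have hγ : ∀ h : ℝ, 0 ≤ h → Carfima.autocov P Y t h = Carfima.kernelCov (2 * H)
      (Carfima.kernelDeriv2 (Carfima.companion p α) σ (Carfima.maVec p q β)) h := fun h hh =>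
    Carfima.autocov_eq_kernelCov hH0 hH1 hst hB hY hstat ht hh
  have hk := Carfima.expDecay_kernelDeriv2 hst σ (Carfima.maVec p q β)
  have hs : -1 < 2 * H - 1 := by linarith
  have hp : 0 < p := by omega
  have hinteg := Carfima.integral_sq_mul_kernelDeriv2 hst σ (Carfima.maVec p q β)
  rw [Carfima.dotProduct_inv_mulVec_delta hp hα hst.isUnit_det] at hinteg
  have hratio : 0 < (Carfima.maPoly q β).eval 0 ^ 2 / (Carfima.arPoly p α).eval 0 ^ 2 := by
    rw [Carfima.eval_zero_maPoly, Carfima.eval_zero_arPoly hp, neg_sq]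
    positivity
  have hpos := hinteg ▸ mul_pos (pow_pos hσ 2) hratio
  refine ⟨⟨Carfima.matIntegrableOn_vStarIntegrand hst σ, fun h hh =>
    ⟨Carfima.matIntegrableOn_rpow_smul_expA_neg hs h,
      Carfima.matIntegrableOn_rpow_smul_expA hst hs, ?_⟩⟩, ?_, ?_, ?_, ?_⟩
  · rw [hγ h hh, Carfima.kernelCov_eq_matIntegral hst σ _ hH0 hH1 hh]
  · intro l hl hrange h hh
    have hmem : ∀ i, l i ∈ spectrum ℂ (Carfima.companionC p α) := fun i =>
      hrange ▸ Set.mem_range_self i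
    have hroot := fun i => Carfima.aeval_arPoly_of_mem_spectrum (hmem i)
    rw [hγ h hh, Carfima.kernelCov_eq_sum_uFun hH0 hH1 hk (Carfima.expDecay_expForm hst _ _)
      (Carfima.hasDerivAt_expForm _ _ _) (fun i => hstable _ (hmem i)) (fun w => ?_) hh]
    rotate_left
    · exact fun i => (σ : ℂ) ^ 2 * (Polynomial.aeval (l i) (Carfima.maPoly q β) *
        Polynomial.aeval (-l i) (Carfima.maPoly q β) /
        (Polynomial.aeval (l i) (Polynomial.derivative (Carfima.arPoly p α)) *
          Polynomial.aeval (-l i) (Carfima.arPoly p α)))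
    · rw [Carfima.expForm_mulVec_vStar_eq_sum hst hqp σ hl (fun i => hstable _ (hmem i)) hroot]
      simp only [mul_assoc]
    · simp only [mul_assoc, ← Finset.mul_sum]
      ring
  · intro hH
    have h1 := Carfima.tendsto_kernelCov (by linarith) (by linarith) hk (a := 2 * H)
    rw [hinteg] at h1
    set R := (Carfima.maPoly q β).eval 0 ^ 2 / (Carfima.arPoly p α).eval 0 ^ 2
    have hH' : 2 * H - 1 ≠ 0 := fun e => hH (by linarith)
    have hc : σ ^ 2 * H * (2 * H - 1) * R ≠ 0 := by
      have := hratio.ne'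
      positivity
    have h2 := h1.div_const (σ ^ 2 * H * (2 * H - 1) * R)
    rw [show 1 / 2 * (2 * H * (2 * H - 1)) * (σ ^ 2 * R) = σ ^ 2 * H * (2 * H - 1) * R by ring,
      div_self hc] at h2
    refine h2.congr' ?_
    filter_upwards [eventually_gt_atTop 0] with h hh
    rw [hγ h hh.le, show 2 * H - 2 = -(2 - 2 * H) by ring, Real.rpow_neg hh.le]
    have := (Real.rpow_pos_of_pos hh (2 - 2 * H)).ne'
    field_simp
  · intro hH
    exact (Carfima.isAntipersistent_kernelCov (by linarith) (by linarith) hk hpos).congr hγ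
  · intro hH
    exact (Carfima.isLongMemory_kernelCov (by linarith) (by linarith) hk hpos).congr hγ
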